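/- **Setting.** Let $H$ be a finitely generated free abelian group with an alternating unimodular pairing $\cup:H\times H\to\mathbb Z$ (for a closed oriented $(4\ell+2)$-manifold $M$: the free quotient of $H^{2\ell+1}(M;\mathbb Z)$ with the cup product pairing), and let $\Lambda$ be an integral Euclidean lattice with $\Lambda^*/\Lambda\simeq\mathbb Z_r^{m}$, where $r$ is a prime power. Let $\langle\cdot,\cdot\rangle$ be the real valued product pairing on $H\otimes\Lambda^*$. Put $\mathsf G=H\otimes\Lambda^*/H\otimes\Lambda\simeq\mathbb Z_r^{2n}$ with $B=e^{2\pi i\langle\cdot,\cdot\rangle}$, and $\mathsf G_{2\Lambda}=H\otimes\Lambda^*/2(H\otimes\Lambda)$ with $\psi=e^{\pi i\langle\cdot,\cdot\rangle}$. The Wu structure enters through a multiplicative quadratic refinement $\mathfrak q$ of $\psi$ on $K=\ker(\mathsf G_{2\Lambda}\to\mathsf G)$. Let $\epsilon=(j,q_r)$, where $j:\mathsf G\to\mathsf G_{2\Lambda}$ is a set-theoretic lift (for $r$ odd, the canonical one $2k\mapsto 2k$: divide by $2$ in $\mathsf G$, then multiply by $2$), and, for $r$ even, $q_r$ is a multiplicative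 quadratic refinement of $B^{r/2}$ on $\mathsf G/2\mathsf G$ of Arf invariant $0$. With $b(k_1,k_2)=j(k_1)+j(k_2)-j(k_1+k_2)$ put $$\phi(k_1,k_2)=\psi(j(k_1),j(k_2))\,\psi\big(b(k_1,k_2),j(k_1)+j(k_2)\big)\,\mathfrak q(b(k_1,k_2))^{-1},$$ the $2$-cocycle defining the Heisenberg group $\mathsf G\times U(1)$. It acts on $V=\mathbb C^{\mathsf G}$ in two commuting ways, $\rho(k)\delta_x=\phi(x,k)\delta_{x+k}$ and $\tilde\rho(k)\delta_x=B(k,x)\phi(x,k)\delta_{x+k}$. A subgroup $\mathsf L\subset\mathsf G$ is *admissible* if there is a Lagrangian (maximal isotropic) subgroup $\mathsf L'\subset H$ such that $\mathsf L$ and $\mathsf L_{2\Lambda}$ are the images of $\mathsf L'\otimes\Lambda^*$ in $\mathsf G$ and $\mathsf G_{2\Lambda}$, $j(\mathsf L)\subset\mathsf L_{2\Lambda}$, $\mathfrak q=1$ on $\mathsf L_{2\Lambda}\cap K$, and, for $r$ even, $q_r=1$ on the image of $\mathsf L$ in $\mathsf G/2\mathsf G$. An *admissible oriented LL subgroup*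 $\tilde{\mathsf L}$ is (the lift $\{(l,1):l\in\mathsf L\}$ of) such an $\mathsf L\simeq\mathbb Z_r^n$ with an orientation $o$, i.e. a generator of $\bigwedge^n_{\mathbb Z_r}\mathsf L$. Let $\mathsf I(\tilde{\mathsf L})=\{v\in V:\rho(k)v=v\ \forall k\in\mathsf L\}$ and $F_{\tilde{\mathsf L}_2,\tilde{\mathsf L}_1}:\mathsf I(\tilde{\mathsf L}_1)\to\mathsf I(\tilde{\mathsf L}_2)$, $v\mapsto\sum_{k\in\mathsf L_2}\rho(k)v$. Write $\mathsf L_{ij}=\mathsf L_i\cap\mathsf L_j$, $\mathsf L_{123}=\mathsf L_1\cap\mathsf L_2\cap\mathsf L_3$, $\mathsf S_2=\mathsf L_2\cap(\mathsf L_1+\mathsf L_3)$, $|\mathsf L|=|\mathsf L_i|$. If $\mathsf L_{12}\simeq\mathbb Z_r^{n_{12}}$ is free, choose an orientation $o_{12}$ of it and let $o_i/o_{12}$ be the induced orientation of $\mathsf L_i/\mathsf L_{12}$ (generators of $\mathsf L_{12}$ first). Let $(\cdot|\cdot)_K$ be the Kronecker symbol and $E(o_2/o_{12},o_1/o_{12})=(\beta(o_2/o_{12},o_1/o_{12})\,|\,r)_K$,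 where $\beta$ is the pairing induced on $\bigwedge^{n-n_{12}}$ by the $\mathbb Z_r$-valued pairing $\frac{r}{2\pi i}\ln B$ if $r$ is even and $\frac12\frac{r}{2\pi i}\ln B$ if $r$ is odd. **Statement.** The maps $F_{\tilde{\mathsf L}_2,\tilde{\mathsf L}_1}$ are well defined and commute with $\tilde\rho$. For all admissible oriented $\tilde{\mathsf L}_1,\tilde{\mathsf L}_2,\tilde{\mathsf L}_3$ there is a unique $a=a(\tilde{\mathsf L}_3,\tilde{\mathsf L}_2,\tilde{\mathsf L}_1)\in\mathbb C$ with $F_{\tilde{\mathsf L}_3,\tilde{\mathsf L}_2}\circ F_{\tilde{\mathsf L}_2,\tilde{\mathsf L}_1}=a\,F_{\tilde{\mathsf L}_3,\tilde{\mathsf L}_1}$. It is the Gauss sum $a=\sum_{k\in\mathsf S_2}q(k)$ of a function $q$ on $\mathsf S_2$ with $q(k_1+k_3)=\phi(k_3,k_1)$ whenever $k_1\in\mathsf L_1$, $k_3\in\mathsf L_3$, $k_1+k_3\in\mathsf L_2$; this $q$ is a tame quadratic refinement of the symmetric pairing $(k_1+k_3,k')\mapsto B(k_3,k')$ on $\mathsf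 S_2$. Moreover there is a $\mathbb C^\ast$-valued function $b$ of ordered pairs of admissible oriented LL subgroups such that $$a(\tilde{\mathsf L}_3,\tilde{\mathsf L}_2,\tilde{\mathsf L}_1)=b(\tilde{\mathsf L}_3,\tilde{\mathsf L}_2)\,b(\tilde{\mathsf L}_2,\tilde{\mathsf L}_1)\,b(\tilde{\mathsf L}_3,\tilde{\mathsf L}_1)^{-1}$$ for all triples, where, if $r$ is odd and not a prime, the triple is assumed to have $\mathsf L_{12},\mathsf L_{23},\mathsf L_{31},\mathsf L_{123}$ free over $\mathbb Z_r$. If $\mathsf L_{12}$ is free then the induced orientations $o_i/o_{12}$ exist. If moreover $r\neq2$ then, for every choice of $o_{12}$, $$b(\tilde{\mathsf L}_2,\tilde{\mathsf L}_1)=|\mathsf L_{12}|^{1/2}|\mathsf L|^{1/2}\,E(o_2/o_{12},o_1/o_{12})\quad\text{if } r \text{ is even or } r\equiv1 \bmod 4,$$ $$b(\tilde{\mathsf L}_2,\tilde{\mathsf L}_1)=|\mathsf L_{12}|^{1/2}|\mathsf L|^{1/2}\,i^{\,n-n_{12}}\,E(o_2/o_{12},o_1/o_{12})\quad\text{if }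 r\equiv-1 \bmod 4.$$ If $r=2$ then $b(\tilde{\mathsf L}_2,\tilde{\mathsf L}_1)=\pm|\mathsf L_{12}|^{1/2}|\mathsf L|^{1/2}$. -/

import Mathlib

open scoped TensorProduct

universe u v

noncomputable section

namespace AbelianGauge

/-! ### Arithmetic preliminaries -/

/-- The Kronecker symbol `(a|b)_K`: multiplicative over the prime factors of `b`, with the Legendre
symbol at odd primes, and at `2` the symbol which is `1` for `a = ±1 mod 8`, `-1` for `a = ±3 mod 8`
and `0` for `a` even. -/
def kronecker (a : ℤ) (b : ℕ) : ℤ :=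
  ZMod.χ₈ (a : ZMod 8) ^ b.factorization 2 * jacobiSym a (b / 2 ^ b.factorization 2)

/-- `q` is a (multiplicative) quadratic refinement of the pairing `P`. -/
structure IsQuadraticRefinement {A : Type*} [AddCommGroup A] (q : A → ℂ) (P : A → A → ℂ) :
    Prop where
  pairing_add_left : ∀ x y z, P (x + y) z = P x z * P y z
  pairing_add_right : ∀ x y z, P x (y + z) = P x y * P x z
  map_add : ∀ x y, q (x + y) = q x * q y * P x y
  map_nsmul : ∀ (n : ℕ) (x : A), q (n • x) = q x ^ (n ^ 2)

/-- A quadratic refinement is tame if it is trivial on the radical of the pairing it refines. -/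
def IsTame {A : Type*} [AddCommGroup A] (q : A → ℂ) (P : A → A → ℂ) : Prop :=
  ∀ x, (∀ y, P x y = 1) → q x = 1

/-- The Gauss sum of a function on a (finite) group. -/
def gaussSum {A : Type*} (q : A → ℂ) : ℂ := ∑ᶠ x, q x

/-- The dual of a lattice in a Euclidean space. -/
def dualLattice {E : Type v} [NormedAddCommGroup E] [InnerProductSpace ℝ E]
    (Λ : Submodule ℤ E) : Submodule ℤ E where
  carrier := {x | ∀ y ∈ Λ, ∃ z : ℤ, inner ℝ x y = (z : ℝ)}
  zero_mem' := fun y _ => ⟨0, by simp⟩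
  add_mem' := by
    intro a b ha hb y hy
    obtain ⟨m, hm⟩ := ha y hy
    obtain ⟨n, hn⟩ := hb y hy
    exact ⟨m + n, by rw [inner_add_left, hm, hn]; push_cast; ring⟩
  smul_mem' := by
    intro c a ha y hy
    obtain ⟨m, hm⟩ := ha y hy
    refine ⟨c * m, ?_⟩
    rw [← Int.cast_smul_eq_zsmul ℝ c a, real_inner_smul_left, hm]
    push_cast
    ring

/-! ### The groups attached to the manifold -/

/-- The topological data: `H` is the free quotient of the middle-degree integral cohomology of a
closed oriented manifold of dimension `4ℓ+2` with its (alternating, unimodular) cup product pairing,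
`Λ` is an integral Euclidean lattice (the monodromy invariant lattice), whose discriminant group is
isomorphic to `(ℤ/r)^m`, for a prime power `r`. -/
structure Background where
  H : Type u
  [addCommGroupH : AddCommGroup H]
  [freeH : Module.Free ℤ H]
  [finiteH : Module.Finite ℤ H]
  cup : H →ₗ[ℤ] H →ₗ[ℤ] ℤ
  cup_self : ∀ x, cup x x = 0
  cup_unimodular : Function.Bijective cup
  E : Type v
  [normedE : NormedAddCommGroup E]
  [innerE : InnerProductSpace ℝ E]
  [finiteE : FiniteDimensional ℝ E]
  Λ : Submodule ℤ E
  [discreteΛ : DiscreteTopology Λ]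
  [latticeΛ : IsZLattice ℝ Λ]
  integral : Λ ≤ dualLattice Λ
  r : ℕ
  isPrimePow_r : IsPrimePow r
  m : ℕ
  discriminant : Nonempty
    ((dualLattice Λ ⧸ Λ.submoduleOf (dualLattice Λ)) ≃+ (Fin m → ZMod r))

attribute [instance] Background.addCommGroupH Background.freeH Background.finiteH
  Background.normedE Background.innerE Background.finiteE Background.discreteΛ Background.latticeΛ

namespace Background

variable (D : Background.{u, v})

instance : NeZero D.r := ⟨D.isPrimePow_r.pos.ne'⟩

/-- The dual lattice `Λ*`. -/
abbrev Λd : Submodule ℤ D.E := dualLattice D.Λ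

/-- `H ⊗ Λ*`. -/
abbrev T : Type (max u v) := D.H ⊗[ℤ] D.Λd

/-- `H ⊗ Λ`, as a subgroup of `H ⊗ Λ*`. -/
def N : AddSubgroup D.T :=
  (LinearMap.lTensor D.H (Submodule.inclusion D.integral)).toAddMonoidHom.range

/-- `2 (H ⊗ Λ)`, as a subgroup of `H ⊗ Λ*`. -/
def twoN : AddSubgroup D.T := D.N.map (nsmulAddMonoidHom 2)

theorem twoN_le : D.twoN ≤ D.N := by
  rintro _ ⟨x, hx, rfl⟩
  exact D.N.nsmul_mem hx 2

/-- `G = (H ⊗ Λ*)/(H ⊗ Λ) = H ⊗ (Λ*/Λ)`. -/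
abbrev G : Type (max u v) := D.T ⧸ D.N

/-- `G_{2Λ} = (H ⊗ Λ*)/2(H ⊗ Λ) = H ⊗ (Λ*/2Λ)`. -/
abbrev G₂ : Type (max u v) := D.T ⧸ D.twoN

/-- The projection `G_{2Λ} → G`. -/
def π : D.G₂ →+ D.G := QuotientAddGroup.map D.twoN D.N (AddMonoidHom.id D.T) D.twoN_le

/-- The kernel of `G_{2Λ} → G`, that is `(H ⊗ Λ)/2(H ⊗ Λ)`. -/
abbrev K : AddSubgroup D.G₂ := D.π.ker

/-- The Euclidean pairing on `Λ*`. -/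
def latticePairing : D.Λd →ₗ[ℤ] D.Λd →ₗ[ℤ] ℝ :=
  LinearMap.mk₂ ℤ (fun x y => inner ℝ (x : D.E) (y : D.E))
    (fun x y z => by simp [inner_add_left])
    (fun c x y => by
      rw [Submodule.coe_smul, ← Int.cast_smul_eq_zsmul ℝ c (x : D.E), real_inner_smul_left,
        zsmul_eq_mul])
    (fun x y z => by simp [inner_add_right])
    (fun c x y => by
      rw [Submodule.coe_smul, ← Int.cast_smul_eq_zsmul ℝ c (y : D.E), real_inner_smul_right,
        zsmul_eq_mul])

/-- The real valued pairing `⟨h ⊗ a, h' ⊗ a'⟩ = (h ∪ h') (a, a')` on `H ⊗ Λ*`. -/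
def pair : D.T →+ D.T →+ ℝ :=
  AddMonoidHom.mk' (fun x => (TensorProduct.lid ℤ ℝ).toLinearMap.toAddMonoidHom.comp
      (TensorProduct.map₂ D.cup D.latticePairing x).toAddMonoidHom) (by
    intro x y
    ext z
    simp)

theorem pair_tmul (h h' : D.H) (a a' : D.Λd) :
    D.pair (h ⊗ₜ a) (h' ⊗ₜ a') = (D.cup h h' : ℝ) * inner ℝ (a : D.E) (a' : D.E) := by
  change (TensorProduct.lid ℤ ℝ) (D.cup h h' ⊗ₜ inner ℝ (a : D.E) (a' : D.E)) = _
  rw [TensorProduct.lid_tmul, zsmul_eq_mul]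

theorem pair_antisymm (x y : D.T) : D.pair x y = - D.pair y x := by
  induction x using TensorProduct.induction_on with
  | zero => rw [map_zero, map_zero, AddMonoidHom.zero_apply, neg_zero]
  | add a b ha hb => rw [map_add, map_add, AddMonoidHom.add_apply, ha, hb, neg_add]
  | tmul h a =>
    induction y using TensorProduct.induction_on with
    | zero => rw [map_zero, map_zero, AddMonoidHom.zero_apply, neg_zero]
    | add a b ha hb => rw [map_add, map_add, AddMonoidHom.add_apply, ha, hb, neg_add]
    | tmul h' a' =>
      have h1 : D.cup h h' = - D.cup h' h := by
        have h2 := D.cup_self (h + h')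
        simp only [map_add, LinearMap.add_apply, D.cup_self] at h2
        linarith
      rw [pair_tmul, pair_tmul, real_inner_comm, h1]
      push_cast
      ring

theorem pair_N_left (x y : D.T) (hx : x ∈ D.N) : ∃ z : ℤ, D.pair x y = (z : ℝ) := by
  obtain ⟨w, rfl⟩ := hx
  induction w using TensorProduct.induction_on with
  | zero => exact ⟨0, by rw [map_zero, map_zero, AddMonoidHom.zero_apply, Int.cast_zero]⟩
  | add a b ha hb =>
    obtain ⟨m, hm⟩ := ha
    obtain ⟨n, hn⟩ := hb
    exact ⟨m + n, by rw [map_add, map_add, AddMonoidHom.add_apply, hm, hn, Int.cast_add]⟩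
  | tmul h a =>
    induction y using TensorProduct.induction_on with
    | zero => exact ⟨0, by rw [map_zero, Int.cast_zero]⟩
    | add c d hc hd =>
      obtain ⟨m, hm⟩ := hc
      obtain ⟨n, hn⟩ := hd
      exact ⟨m + n, by rw [map_add, hm, hn, Int.cast_add]⟩
    | tmul h' a' =>
      obtain ⟨z, hz⟩ := a'.2 a a.2
      refine ⟨D.cup h h' * z, ?_⟩
      change D.pair (h ⊗ₜ Submodule.inclusion D.integral a) (h' ⊗ₜ a') = _
      rw [pair_tmul, real_inner_comm, Int.cast_mul, ← hz]
      rfl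

theorem pair_N_right (x y : D.T) (hy : y ∈ D.N) : ∃ z : ℤ, D.pair x y = (z : ℝ) := by
  obtain ⟨z, hz⟩ := D.pair_N_left y x hy
  exact ⟨-z, by rw [pair_antisymm, hz, Int.cast_neg]⟩

theorem pair_congr {M : AddSubgroup D.T} (c : ℕ)
    (hM : ∀ x ∈ M, ∃ n ∈ D.N, x = c • n) {x x' y y' : D.T} (hx : -x + x' ∈ M) (hy : -y + y' ∈ M) :
    ∃ z : ℤ, D.pair x y = D.pair x' y' + (c : ℝ) * z := by
  obtain ⟨n, hn, hn'⟩ := hM _ hx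
  obtain ⟨k, hk, hk'⟩ := hM _ hy
  obtain ⟨a, ha⟩ := D.pair_N_left n y hn
  obtain ⟨b, hb⟩ := D.pair_N_right x' k hk
  refine ⟨-(a + b), ?_⟩
  have e1 : D.pair (-x + x') y = (c : ℝ) * a := by
    rw [hn', map_nsmul, AddMonoidHom.nsmul_apply, ha, nsmul_eq_mul]
  have e2 : D.pair x' (-y + y') = (c : ℝ) * b := by
    rw [hk', map_nsmul, hb, nsmul_eq_mul]
  rw [map_add, map_neg, AddMonoidHom.add_apply, AddMonoidHom.neg_apply] at e1
  rw [map_add, map_neg] at e2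
  push_cast
  linarith

/-- The `U(1)`-valued pairing `B = exp (2πi ⟨·,·⟩)` on `G`. -/
def B (k₁ k₂ : D.G) : ℂ :=
  Quotient.liftOn₂' k₁ k₂
    (fun x y => Complex.exp (2 * Real.pi * Complex.I * (D.pair x y : ℝ))) (by
      intro x y x' y' hx hy
      rw [QuotientAddGroup.leftRel_apply] at hx hy
      obtain ⟨z, hz⟩ := D.pair_congr 1 (fun x hx => ⟨x, hx, (one_smul ℕ x).symm⟩) hx hy
      rw [Complex.exp_eq_exp_iff_exists_int]
      refine ⟨z, ?_⟩
      rw [hz]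
      push_cast
      ring)

/-- The `U(1)`-valued pairing `ψ = exp (πi ⟨·,·⟩)` on `G_{2Λ}`, a square root of `B`. -/
def ψ (j₁ j₂ : D.G₂) : ℂ :=
  Quotient.liftOn₂' j₁ j₂
    (fun x y => Complex.exp (Real.pi * Complex.I * (D.pair x y : ℝ))) (by
      intro x y x' y' hx hy
      rw [QuotientAddGroup.leftRel_apply] at hx hy
      obtain ⟨z, hz⟩ := D.pair_congr 2 (by
        rintro _ ⟨n, hn, rfl⟩
        exact ⟨n, hn, rfl⟩) hx hy
      rw [Complex.exp_eq_exp_iff_exists_int]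
      refine ⟨z, ?_⟩
      rw [hz]
      push_cast
      ring)

theorem nsmul_r_eq_zero (k : D.G) : D.r • k = 0 := by
  obtain ⟨t, rfl⟩ := QuotientAddGroup.mk_surjective k
  rw [← QuotientAddGroup.mk_nsmul, QuotientAddGroup.eq_zero_iff]
  induction t using TensorProduct.induction_on with
  | zero => rw [nsmul_zero]; exact D.N.zero_mem
  | add a b ha hb => rw [nsmul_add]; exact D.N.add_mem ha hb
  | tmul h a =>
    obtain ⟨e⟩ := D.discriminant
    have h1 : (Submodule.Quotient.mk (D.r • a) :
        D.Λd ⧸ D.Λ.submoduleOf (dualLattice D.Λ)) = 0 := by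
      apply e.injective
      rw [Submodule.Quotient.mk_smul, map_nsmul, map_zero]
      ext i
      simp
    rw [Submodule.Quotient.mk_eq_zero] at h1
    refine ⟨h ⊗ₜ (⟨_, h1⟩ : D.Λ), ?_⟩
    change h ⊗ₜ (D.r • a) = D.r • (h ⊗ₜ[ℤ] a)
    rw [← natCast_zsmul, ← natCast_zsmul, TensorProduct.tmul_smul]

/-- `G` is killed by `r`, hence is a `ℤ/r`-module. -/
instance : Module (ZMod D.r) D.G := AddCommGroup.zmodModule D.nsmul_r_eq_zero

instance : Finite D.G := by
  obtain ⟨e⟩ := D.discriminant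
  have : Finite (D.Λd ⧸ D.Λ.submoduleOf (dualLattice D.Λ)) := Finite.of_equiv _ e.symm.toEquiv
  have : Module.Finite ℤ D.Λ := ZLattice.module_finite ℝ D.Λ
  have : Module.Finite ℤ (D.Λ.submoduleOf (dualLattice D.Λ)) :=
    Module.Finite.equiv (Submodule.submoduleOfEquivOfLe D.integral).symm
  have : Module.Finite ℤ D.Λd :=
    Module.Finite.of_submodule_quotient (D.Λ.submoduleOf (dualLattice D.Λ))
  have : AddGroup.FG D.T :=
    Module.Finite.iff_addGroup_fg.mp (Module.Finite.tensorProduct ℤ D.H D.Λd)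
  have : Module.Finite ℤ D.G := Module.Finite.iff_addGroup_fg.mpr inferInstance
  have : Module.Finite (ZMod D.r) D.G := Module.Finite.of_restrictScalars_finite ℤ (ZMod D.r) D.G
  exact Module.finite_of_finite (ZMod D.r)

/-- Half the number of generators of `G = (ℤ/r)^{2n}`. -/
def n : ℕ := Module.finrank ℤ D.H / 2 * D.m

/-- The `ℤ/r`-valued pairing `(r / 2πi) ln B`: the class `c` such that `B = exp (2πi c / r)`. -/
def logB (k₁ k₂ : D.G) : ZMod D.r := Function.invFun (ZMod.stdAddChar (N := D.r)) (D.B k₁ k₂)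

/-! ### Lagrangian subgroups -/

/-- Lagrangian subgroups of `H`: the maximal isotropic subgroups. -/
def IsLagrangian (L' : Submodule ℤ D.H) : Prop :=
  (∀ x ∈ L', ∀ y ∈ L', D.cup x y = 0) ∧ ∀ x, (∀ y ∈ L', D.cup x y = 0) → x ∈ L'

/-- The image of `L' ⊗ Λ*` in `H ⊗ Λ*`, for a subgroup `L'` of `H`. -/
def tensorSub (L' : Submodule ℤ D.H) : AddSubgroup D.T :=
  (LinearMap.rTensor D.Λd L'.subtype).toAddMonoidHom.range

/-- The subgroup `L' ⊗ (Λ*/Λ)` of `G`. -/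
def lag (L' : Submodule ℤ D.H) : Submodule (ZMod D.r) D.G :=
  AddSubgroup.toZModSubmodule D.r ((D.tensorSub L').map (QuotientAddGroup.mk' D.N))

/-- The subgroup `L' ⊗ (Λ*/2Λ)` of `G_{2Λ}`. -/
def lag₂ (L' : Submodule ℤ D.H) : AddSubgroup D.G₂ :=
  (D.tensorSub L').map (QuotientAddGroup.mk' D.twoN)

/-! ### Wu structure and extra structure -/

/-- The quadratic refinement of the mod 2 cup product pairing determined by the Wu structure. -/
structure WuRefinement where
  q : D.K → ℂ
  refines : IsQuadraticRefinement q (fun b b' => D.ψ b b')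

/-- The extra structure: a set theoretic lift `j : G → G_{2Λ}`, which for `r` odd is the canonical
one (division by `2` in `G` followed by multiplication by `2`), and, for `r` even, a quadratic
refinement on `G/2G` of `B^{r/2}`, of Arf invariant zero. -/
structure ExtraStructure where
  j : D.G → D.G₂
  π_j : ∀ k, D.π (j k) = k
  j_odd : Odd D.r → ∀ t : D.T, j (QuotientAddGroup.mk (2 • t)) = QuotientAddGroup.mk (2 • t)
  q : D.G ⧸ (nsmulAddMonoidHom (α := D.G) 2).range → ℂ
  q_refines : Even D.r → ∃ P, IsQuadraticRefinement q P ∧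
    ∀ k k' : D.G, P (QuotientAddGroup.mk k) (QuotientAddGroup.mk k') = D.B k k' ^ (D.r / 2)
  q_arf : Even D.r → Complex.arg (gaussSum q) = 0

variable {D} (W : D.WuRefinement) (ε : D.ExtraStructure)

/-- The element `b(k₁, k₂)` with `j(k₁) + j(k₂) = j(k₁ + k₂) + b(k₁, k₂)`. -/
def ExtraStructure.b (k₁ k₂ : D.G) : D.K :=
  ⟨ε.j k₁ + ε.j k₂ - ε.j (k₁ + k₂), by
    rw [AddMonoidHom.mem_ker, map_sub, map_add, ε.π_j, ε.π_j, ε.π_j, sub_self]⟩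

/-- The 2-cocycle `φ` on `G` determined by the lift `j`; the Heisenberg group is `G × U(1)` with
`(k₁, t₁) (k₂, t₂) = (k₁ + k₂, φ(k₁, k₂) t₁ t₂)`. -/
def φ (k₁ k₂ : D.G) : ℂ :=
  D.ψ (ε.j k₁) (ε.j k₂) * D.ψ (ε.b k₁ k₂) (ε.j k₁ + ε.j k₂) * (W.q (ε.b k₁ k₂))⁻¹

/-- The operator `ρ(k) = ρ(k, 1)` on the space `V` of functions on `G`, which carries the regular
representation of the Heisenberg group: on the basis, `ρ(k) δ_x = φ(x, k) δ_{x + k}`. Here `δ_x`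
stands for the unit vector `Q(w, j(x)) v₀` of the Hermitian line over the point `w + x`, with `v₀` a
unit vector in the line over the base point `w`, and `ρ(k)` is the sum over `x` of the Wilson
operators `Q(w + x, j(k))`. -/
def ρ (k : D.G) : (D.G → ℂ) →ₗ[ℂ] (D.G → ℂ) where
  toFun f := fun y => φ W ε (y - k) k * f (y - k)
  map_add' f g := by ext y; simp [mul_add]
  map_smul' c f := by ext y; simp [mul_left_comm]

/-- The other action of the Heisenberg group, `ρ̃(k) δ_x = B(k, x) φ(x, k) δ_{x + k}`. -/
def ρt (k : D.G) : (D.G → ℂ) →ₗ[ℂ] (D.G → ℂ) where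
  toFun f := fun y => D.B k (y - k) * φ W ε (y - k) k * f (y - k)
  map_add' f g := by ext y; simp [mul_add]
  map_smul' c f := by ext y; simp [mul_left_comm]

/-- Admissible Lagrangian subgroups of `G`. -/
def IsAdmissible (L : Submodule (ZMod D.r) D.G) : Prop :=
  ∃ L' : Submodule ℤ D.H, D.IsLagrangian L' ∧ L = D.lag L' ∧
    (∀ k ∈ L, ε.j k ∈ D.lag₂ L') ∧
    (∀ b : D.K, (b : D.G₂) ∈ D.lag₂ L' → W.q b = 1) ∧
    (Even D.r → ∀ k ∈ L, ε.q (QuotientAddGroup.mk k) = 1)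

/-- Admissible oriented LL subgroups: the LL subgroup of an admissible Lagrangian subgroup `L` is
`{(l, 1) | l ∈ L}`, and an orientation is a generator of the top exterior power of `L ≃ (ℤ/r)^n`. -/
structure OrientedLL where
  L : Submodule (ZMod D.r) D.G
  admissible : IsAdmissible W ε L
  o : ⋀[ZMod D.r]^D.n L
  o_generates : Submodule.span (ZMod D.r) {o} = ⊤

namespace OrientedLL

variable {W ε}

/-- The irreducible module `I(L)`: the vectors invariant under `ρ(l, 1)`, `l ∈ L`. -/
def I (L : OrientedLL W ε) : Submodule ℂ (D.G → ℂ) where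
  carrier := {v | ∀ k ∈ L.L, ρ W ε k v = v}
  zero_mem' := fun k _ => map_zero _
  add_mem' := fun hv hw k hk => by rw [map_add, hv k hk, hw k hk]
  smul_mem' := fun c v hv k hk => by rw [map_smul, hv k hk]

/-- The operator `v ↦ ∑_{k ∈ L} ρ(k) v`, whose restriction to `I(L₁)` is the intertwiner
`F_{L, L₁} : I(L₁) → I(L)`. -/
def F (L : OrientedLL W ε) : (D.G → ℂ) →ₗ[ℂ] (D.G → ℂ) := ∑ᶠ k : L.L, ρ W ε (k : D.G)

/-- `L₁₂ = L₁ ∩ L₂`. -/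
abbrev inter (L₂ L₁ : OrientedLL W ε) : Submodule (ZMod D.r) D.G := L₂.L ⊓ L₁.L

/-- The subgroup `S₂` of elements of `L₂` that are sums of elements of `L₁` and `L₃`. -/
abbrev S (L₃ L₂ L₁ : OrientedLL W ε) : Submodule (ZMod D.r) D.G := L₂.L ⊓ (L₁.L ⊔ L₃.L)

/-- A presentation of the orientations `o₂/o₁₂` and `o₁/o₁₂`, for two oriented subgroups whose
intersection is free: `o₁₂ = e₁ ∧ … ∧ e_{n₁₂}`, `o₂/o₁₂ = u x₁ ∧ … ∧ x_s` and
`o₁/o₁₂ = v y₁ ∧ … ∧ y_s`, where orientations on quotients are induced by putting the generators of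
the subgroup first. -/
structure QuotientOrientations (L₂ L₁ : OrientedLL W ε) (n₁₂ s : ℕ) where
  rank_add : n₁₂ + s = D.n
  e : Module.Basis (Fin n₁₂) (ZMod D.r) (inter L₂ L₁)
  x : Fin s → L₂.L
  y : Fin s → L₁.L
  u : ZMod D.r
  v : ZMod D.r
  o₂_eq : L₂.o = u • exteriorPower.ιMulti (ZMod D.r) D.n
    (Fin.append (fun i => Submodule.inclusion inf_le_left (e i)) x ∘ Fin.cast rank_add.symm)
  o₁_eq : L₁.o = v • exteriorPower.ιMulti (ZMod D.r) D.n
    (Fin.append (fun i => Submodule.inclusion inf_le_right (e i)) y ∘ Fin.cast rank_add.symm)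

/-- `E(o₂/o₁₂, o₁/o₁₂)`: the Kronecker symbol over `r` of the pairing of the two exterior powers
induced by `(r / 2πi) ln B` for `r` even, and by its half for `r` odd. -/
def QuotientOrientations.E {L₂ L₁ : OrientedLL W ε} {n₁₂ s : ℕ}
    (f : QuotientOrientations L₂ L₁ n₁₂ s) : ℤ :=
  kronecker ((f.u * f.v * Matrix.det (Matrix.of fun i k =>
    (if Odd D.r then (2 : ZMod D.r)⁻¹ else 1) * D.logB (f.x i) (f.y k)) : ZMod D.r).val) D.r

/-- `|L₁₂|^{1/2} |L|^{1/2}`. -/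
def modulus (L₂ L₁ : OrientedLL W ε) : ℝ :=
  √(Nat.card (inter L₂ L₁)) * √(Nat.card L₂.L)

end OrientedLL

end Background

end AbelianGauge

end

open AbelianGauge Background

/-!
An admissible subgroup `L` is its own orthogonal for `B`, and the cocycle `φ` is trivial on it, so
that the operators `ρ k` with `k ∈ L` form a commutative group, and `F` is the sum of its elements.
Let `v` be invariant under `L₁`. If `k = k₁ + k₃` lies in `S₂`, then applying `F` for `L₃` to
`ρ k v` gives `q k = φ(k₃, k₁)` times `F v` (`F_ρ_of_mem`); if `k ∈ L₂` is outside
`L₁ + L₃ = (L₁ ∩ L₃)^⊥` the result is zero (`F_ρ_of_notMem`). Summing over `k ∈ L₂` gives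
`F ∘ F = a F` with the Gauss sum `a` of `q` (`F_F`), and associativity of the composition gives
the cocycle relation `a_cocycle`.

The product of the operators of `L₂` shows that `q` is multiplicative up to the symmetric pairing
`P` (`φ_add_add`). The hypothesis on the Wu refinement allows the lifts in the definition of `φ` to
be changed inside the images of the `L_i' ⊗ Λ*` (`lift_independent`), hence `q` is even
(`φ_neg_neg`), so that `q(x)² = P(x, x)` and `q(n x) = q(x) ^ (n²)`. The radical of `P` is
`L₁ ∩ L₂ + L₂ ∩ L₃`, where `q` is trivial: the refinement is tame. Its values are `r`-th roots of
unity (`q_pow_r`); for `r` even this uses the refinement `q_r`.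

To evaluate `a`, one needs the intersections to be free over `ℤ/r`. This is clear for `r` prime. For
`r` even it follows from the existence of the lift `j` to the preimages of the subgroups in `G_{2Λ}`
(`free_of_forall_mem_iff`); for the other `r` it is assumed. There are then bases of `L₁`, `L₂` and
`L₃` adapted to all intersections (`nonempty_adaptedBases`), in which `a` is a power of `r` times the
Gauss sum of a quadratic form over `ℤ/r` with unimodular polar form `σ` (`AdaptedBases.a_eq`). This
sum is given, for `r ≠ 2`, by `QuadraticGauss.formSum_eq`. Only its direction requires work: if `r`
is a square the sum is positive, and otherwise it has the direction of a sum of `p`-th roots of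
unity. For `p` odd this is a product of quadratic Gauss sums modulo `p`, whose sign is found by
comparing them modulo `p` with a product of sines; for `p = 2` it is the value of `χ₈` at the
determinant of the polar form.

On the other side, the pairings `β` of the quotient orientations are, up to squares of units,
determinants of matrices of the pairing in the adapted bases (`QuotientOrientations.exists_det_eq`),
and all three equal `σ.det` up to an explicit sign (`det_form₂₁`, `det_form₃₂`, `det_form₃₁`). Since
the Kronecker symbol is multiplicative and trivial on squares, the factors of the orientation of
`L₂` cancel, those of `L₁` and `L₃` occur on both sides, and the powers of `i` compensate the
signs; so `a` is the coboundary of the stated function (`a_mul_value`).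

For `r = 2` all the numbers `a` are real, and their moduli are given by `norm_a`. With a fixed third
subgroup `L₀`, the cocycle relation shows that the signs of the `a(L₂, L₁, L₀)` give a suitable `b`
(`signWith_cocycle`).
-/

noncomputable section

namespace QuadraticGauss

open Polynomial Finset

/-! ### The sign of the quadratic Gauss sum -/

/-- The square of the product of the `ζ ^ k - ζ ^ (-k)`, obtained from `∏ (1 - ω ^ k) = 2m + 1` for
`ω = ζ ^ 2` by pairing `k` with `-k`. -/
theorem sq_prod_pow_sub_pow (m : ℕ) {ζ : ℂ} (hζ : IsPrimitiveRoot ζ (2 * m + 1)) :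
    (∏ k ∈ range m, (ζ ^ (k + 1) - ζ ^ (2 * m - k))) ^ 2 = (-1) ^ m * (2 * m + 1 : ℝ) := by
  have hω : IsPrimitiveRoot (ζ ^ 2) (2 * m + 1) :=
    hζ.pow_of_coprime 2 (by simp)
  have h1 := hω.prod_one_sub_pow_eq_order
  rw [two_mul, prod_range_add, ← prod_range_reflect (fun k => 1 - (ζ ^ 2) ^ (m + k + 1)),
    ← prod_mul_distrib] at h1
  rw [← prod_pow]
  have h2 : ∀ k ∈ range m, (ζ ^ (k + 1) - ζ ^ (2 * m - k)) ^ 2 =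
      -1 * ((1 - (ζ ^ 2) ^ (k + 1)) * (1 - (ζ ^ 2) ^ (m + (m - 1 - k) + 1))) := by
    intro k hk
    rw [mem_range] at hk
    have e : m + (m - 1 - k) + 1 = 2 * m - k := by omega
    have h3 : ζ ^ (k + 1) * ζ ^ (2 * m - k) = 1 := by
      rw [← pow_add, show k + 1 + (2 * m - k) = 2 * m + 1 by omega, hζ.pow_eq_one]
    rw [e, ← pow_mul, ← pow_mul, mul_comm 2 (k + 1), mul_comm 2 (2 * m - k), pow_mul, pow_mul]
    linear_combination (-2 + (ζ ^ (k + 1) * ζ ^ (2 * m - k) + 1)) * h3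
  rw [prod_congr rfl h2, prod_mul_distrib, h1]
  simp
  ring

/-- For the standard root of unity `ζ` the product of the `ζ ^ k - ζ ^ (-k)` is known with its sign:
it is `I ^ m` times a product of `2 sin (2πk / (2m + 1))`, all positive. -/
theorem prod_pow_sub_pow (m : ℕ) :
    ∏ k ∈ range m, (Complex.exp (2 * Real.pi * Complex.I / (2 * m + 1 : ℕ)) ^ (k + 1) -
      Complex.exp (2 * Real.pi * Complex.I / (2 * m + 1 : ℕ)) ^ (2 * m - k)) =
    Complex.I ^ m * (√(2 * m + 1) : ℝ) := by
  set ζ := Complex.exp (2 * Real.pi * Complex.I / (2 * m + 1 : ℕ)) with hζd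
  have hζ : IsPrimitiveRoot ζ (2 * m + 1) := Complex.isPrimitiveRoot_exp _ (by omega)
  have hp : (0 : ℝ) < 2 * m + 1 := by positivity
  have key : ∀ k ∈ range m, ζ ^ (k + 1) - ζ ^ (2 * m - k) =
      Complex.I * ((2 * Real.sin (2 * Real.pi * (k + 1) / (2 * m + 1)) : ℝ) : ℂ) := by
    intro k hk
    rw [mem_range] at hk
    -- the exponent `2 * m - k` stands for `-(k + 1)` modulo `2 * m + 1`
    have h3 : ζ ^ (k + 1) * ζ ^ (2 * m - k) = 1 := by
      rw [← pow_add, show k + 1 + (2 * m - k) = 2 * m + 1 by omega, hζ.pow_eq_one]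
    have h4 : ζ ^ (k + 1) = Complex.exp ((2 * Real.pi * (k + 1) / (2 * m + 1) : ℝ) * Complex.I) := by
      rw [hζd, ← Complex.exp_nat_mul]
      congr 1
      push_cast
      ring
    have h5 : ζ ^ (2 * m - k) =
        Complex.exp (-((2 * Real.pi * (k + 1) / (2 * m + 1) : ℝ) * Complex.I)) := by
      rw [Complex.exp_neg, ← h4]
      exact eq_inv_of_mul_eq_one_right h3
    rw [h4, h5, Complex.ofReal_mul, Complex.ofReal_sin, Complex.sin]
    generalize ((2 * Real.pi * (k + 1) / (2 * m + 1) : ℝ) : ℂ) = x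
    rw [neg_mul]
    push_cast
    linear_combination (Complex.exp (x * Complex.I) - Complex.exp (-(x * Complex.I))) * Complex.I_sq
  set R : ℝ := ∏ k ∈ range m, (2 * Real.sin (2 * Real.pi * (k + 1) / (2 * m + 1))) with hR
  have hR0 : 0 < R := by
    refine prod_pos fun k hk => ?_
    rw [mem_range] at hk
    have hk' : (k + 1 : ℝ) ≤ m := by exact_mod_cast hk
    have := Real.pi_pos
    refine mul_pos two_pos (Real.sin_pos_of_pos_of_lt_pi (by positivity) ?_)
    rw [div_lt_iff₀ hp]
    nlinarith
  have h6 : ∏ k ∈ range m, (ζ ^ (k + 1) - ζ ^ (2 * m - k)) = Complex.I ^ m * (R : ℂ) := by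
    rw [prod_congr rfl key, prod_mul_distrib, hR]
    simp
  have h7 := sq_prod_pow_sub_pow m hζ
  rw [h6, mul_pow, ← pow_mul, mul_comm m 2, pow_mul, Complex.I_sq] at h7
  have h8 : R ^ 2 = 2 * m + 1 := by
    have := mul_left_cancel₀ (pow_ne_zero m (by norm_num : (-1 : ℂ) ≠ 0)) h7
    exact_mod_cast this
  rw [h6, ← h8, Real.sqrt_sq hR0.le]

/-- The operator `X d/dX`, applied `i` times to `(X - 1) ^ N`, leaves the factor
`(X - 1) ^ (N - i)`. -/
theorem exists_iterate_euler_X_sub_one_pow (K : Type*) [CommRing K] (N i : ℕ) (hi : i ≤ N) :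
    ∃ h : K[X], (fun f : K[X] => X * derivative f)^[i] ((X - 1) ^ N) = (X - 1) ^ (N - i) * h ∧
      h.eval 1 = (N.descFactorial i : K) := by
  induction i with
  | zero => exact ⟨1, by simp, by simp⟩
  | succ i ih =>
    obtain ⟨h, h1, h2⟩ := ih (by omega)
    obtain ⟨M, hM⟩ : ∃ M, N - i = M + 1 := ⟨N - i - 1, by omega⟩
    refine ⟨X * (C ((M + 1 : ℕ) : K) * h) + X * ((X - 1) * derivative h), ?_, ?_⟩
    · rw [Function.iterate_succ_apply', h1, show N - (i + 1) = M by omega, hM,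
        derivative_mul, derivative_pow, pow_succ]
      simp only [derivative_sub, derivative_X, derivative_one]
      simp
      ring
    · rw [Nat.descFactorial_succ, hM]
      simp [h2]

/-- The operator `X d/dX` multiplies the coefficient of `X ^ j` by `j`; modulo `p = 2m + 1`, applying
it `m` times introduces the Legendre symbols `j ^ m`. -/
theorem iterate_euler_sum (K : Type*) [CommRing K] (n i : ℕ) :
    (fun f : K[X] => X * derivative f)^[i] (∑ j ∈ range n, X ^ j) =
      ∑ j ∈ range n, C ((j : K) ^ i) * X ^ j := by
  induction i with
  | zero => simp
  | succ i ih =>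
    rw [Function.iterate_succ_apply', ih, derivative_sum, mul_sum]
    refine sum_congr rfl fun j _ => ?_
    rcases j with _ | j
    · rcases i with _ | i <;> simp
    · rw [derivative_C_mul, derivative_X_pow, pow_succ _ i, C_mul]
      simp only [Nat.add_sub_cancel, pow_succ]
      ring

/-- The lowest order term at `X = 1` of the polynomial behind the product of the `ζ ^ k - ζ ^ (-k)`,
in a ring where `2n + 1 = 0`. -/
theorem exists_prod_pow_sub_pow (K : Type*) [CommRing K] (m n : ℕ) (hn : (2 * n + 1 : K) = 0)
    (hm : m ≤ n) :
    ∃ h : K[X], ∏ k ∈ range m, ((X : K[X]) ^ (k + 1) - X ^ (2 * n - k)) = (X - 1) ^ m * h ∧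
      h.eval 1 = (2 ^ m * m.factorial : ℕ) := by
  induction m with
  | zero => exact ⟨1, by simp, by simp⟩
  | succ m ih =>
    obtain ⟨h, h1, h2⟩ := ih (by omega)
    have e : (X : K[X]) ^ (m + 1) - X ^ (2 * n - m) = (X - 1) *
        ((∑ i ∈ range (m + 1), X ^ i) - ∑ i ∈ range (2 * n - m), X ^ i) := by
      rw [mul_sub, mul_geom_sum, mul_geom_sum]
      ring
    refine ⟨h * ((∑ i ∈ range (m + 1), X ^ i) - ∑ i ∈ range (2 * n - m), X ^ i), ?_, ?_⟩
    · rw [prod_range_succ, h1, e, pow_succ]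
      ring
    · have h3 : ((2 * n - m : ℕ) : K) = 2 * n - m := by
        rw [Nat.cast_sub (by omega)]
        push_cast
        ring
      simp only [eval_mul, h2, eval_sub, eval_finsetSum, eval_pow, eval_X, one_pow, sum_const,
        card_range, nsmul_eq_mul, mul_one, h3, Nat.factorial_succ]
      push_cast
      linear_combination (-2 ^ m * (m.factorial : K)) * hn

/-- Modulo `p`, the cyclotomic polynomial of a prime `p` is `(X - 1) ^ (p - 1)`. -/
theorem sum_X_pow_eq (p : ℕ) [Fact p.Prime] :
    ∑ j ∈ range p, (X : (ZMod p)[X]) ^ j = (X - 1) ^ (p - 1) := by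
  have h1 : (∑ j ∈ range p, (X : (ZMod p)[X]) ^ j) * (X - 1) = (X - 1) ^ (p - 1) * (X - 1) := by
    rw [geom_sum_mul, ← pow_succ, Nat.sub_add_cancel (Fact.out : p.Prime).one_le, sub_pow_char,
      one_pow]
  exact mul_right_cancel₀ (X_sub_C_ne_zero (1 : ZMod p)) (by simpa using h1)

/-- If the Gauss sum is `s` times the product of the `ζ ^ k - ζ ^ (-k)`, with `s` an integer, then
`s` is determined modulo `p`: compare the lowest order terms at `X = 1` of the corresponding
polynomials modulo `p`. -/
theorem sign_mod (p m : ℕ) (hm : m ≠ 0) (hp : p = 2 * m + 1) [Fact p.Prime] (s : ℤ) {ζ : ℂ}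
    (hζ : IsPrimitiveRoot ζ p)
    (h : ∑ j ∈ range p, (legendreSym p j : ℂ) * ζ ^ j =
      s * ∏ k ∈ range m, (ζ ^ (k + 1) - ζ ^ (2 * m - k))) :
    ((-1) ^ m : ZMod p) = s * 2 ^ m := by
  let f : ℤ[X] := ∑ j ∈ range p, C (legendreSym p j) * X ^ j -
    C s * ∏ k ∈ range m, (X ^ (k + 1) - X ^ (2 * m - k))
  have hf : aeval ζ f = 0 := by
    simp only [f, map_sub, map_sum, map_mul, map_prod, aeval_X, map_pow, aeval_C]
    rw [sub_eq_zero]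
    simpa using h
  have hdvd : cyclotomic p ℤ ∣ f := by
    rw [cyclotomic_eq_minpoly hζ (by omega)]
    exact minpoly.isIntegrallyClosed_dvd (hζ.isIntegral (by omega)) hf
  have hdvd2 := Polynomial.map_dvd (Int.castRingHom (ZMod p)) hdvd
  rw [map_cyclotomic, cyclotomic_prime, sum_X_pow_eq] at hdvd2
  have hf2 : f.map (Int.castRingHom (ZMod p)) = ∑ j ∈ range p, C ((j : ZMod p) ^ m) * X ^ j -
    C (s : ZMod p) * ∏ k ∈ range m, (X ^ (k + 1) - X ^ (2 * m - k)) := by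
    simp only [f, Polynomial.map_sub, Polynomial.map_sum, Polynomial.map_mul, Polynomial.map_prod,
      Polynomial.map_pow, map_X, map_C]
    congr 1
    refine sum_congr rfl fun j _ => ?_
    congr 2
    have := legendreSym.eq_pow p (j : ℤ)
    rw [eq_intCast, this, show p / 2 = m by omega]
    simp
  obtain ⟨u, hu, hu1⟩ := exists_iterate_euler_X_sub_one_pow (ZMod p) (2 * m) m (by omega)
  have hp0 : (2 * m + 1 : ZMod p) = 0 := by
    have := ZMod.natCast_self p
    have e : (p : ZMod p) = ((2 * m + 1 : ℕ) : ZMod p) := by rw [← hp]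
    rw [e] at this
    exact_mod_cast this
  obtain ⟨w, hw, hw1⟩ := exists_prod_pow_sub_pow (ZMod p) m m hp0 le_rfl
  have e1 := sum_X_pow_eq p
  rw [show p - 1 = 2 * m by omega] at e1 hdvd2
  rw [hf2, hw, ← iterate_euler_sum, e1, hu, show 2 * m - m = m by omega,
    show C (s : ZMod p) * ((X - 1) ^ m * w) = (X - 1) ^ m * (C (s : ZMod p) * w) by ring,
    ← mul_sub, two_mul, pow_add] at hdvd2
  have hX : (X - 1 : (ZMod p)[X]) ≠ 0 := by simpa using X_sub_C_ne_zero (1 : ZMod p)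
  have h3 := (mul_dvd_mul_iff_left (pow_ne_zero m hX)).1 hdvd2
  have h4 : (u - C (s : ZMod p) * w).eval 1 = 0 := by
    obtain ⟨v, hv⟩ := h3
    rw [hv]
    simp [hm]
  rw [eval_sub, eval_mul, hu1, hw1, eval_C, sub_eq_zero] at h4
  -- modulo `p = 2m + 1`, the product `2m (2m - 1) ⋯ (m + 1)` is `(-1) ^ m m!`
  have h5 : ∀ i ≤ m, ((2 * m).descFactorial i : ZMod p) = (-1) ^ i * i.factorial := by
    intro i hi
    induction i with
    | zero => simp
    | succ i ih =>
      have e : ((2 * m - i : ℕ) : ZMod p) = -(i + 1) := by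
        rw [Nat.cast_sub (by omega)]
        push_cast
        linear_combination hp0
      rw [Nat.descFactorial_succ, Nat.cast_mul, ih (by omega), e, Nat.factorial_succ]
      push_cast
      ring
  rw [h5 m le_rfl] at h4
  have h6 : (m.factorial : ZMod p) ≠ 0 := by
    rw [Ne, ZMod.natCast_eq_zero_iff, (Fact.out : p.Prime).dvd_factorial]
    omega
  push_cast at h4
  exact mul_right_cancel₀ h6 (by rw [h4]; ring)

theorem sum_range_legendreSym (p : ℕ) [Fact p.Prime] :
    ∑ j ∈ range p, (legendreSym p j : ℂ) * Complex.exp (2 * Real.pi * Complex.I / p) ^ j =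
      ∑ x : ZMod p, (quadraticChar (ZMod p) x : ℂ) * ZMod.stdAddChar x := by
  refine sum_bij (fun j _ => (j : ZMod p)) (fun _ _ => mem_univ _) ?_ ?_ ?_
  · intro a ha b hb hab
    rw [mem_range] at ha hb
    rwa [ZMod.natCast_eq_natCast_iff', Nat.mod_eq_of_lt ha, Nat.mod_eq_of_lt hb] at hab
  · intro x _
    exact ⟨x.val, mem_range.2 (ZMod.val_lt x), ZMod.natCast_zmod_val x⟩
  · intro j _
    have h1 := ZMod.stdAddChar_coe (N := p) (j : ℤ)
    rw [Int.cast_natCast] at h1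
    rw [h1, ← Complex.exp_nat_mul, legendreSym]
    push_cast
    congr 2
    ring

/-- The sign of the quadratic Gauss sum. -/
theorem sum_quadraticChar_mul_stdAddChar (p : ℕ) [Fact p.Prime] (hp2 : p ≠ 2) :
    ∑ x : ZMod p, (quadraticChar (ZMod p) x : ℂ) * ZMod.stdAddChar x =
      (if p % 4 = 3 then Complex.I else 1) * (√p : ℝ) := by
  obtain ⟨m, hm⟩ : ∃ m, p = 2 * m + 1 := (Fact.out : p.Prime).odd_of_ne_two hp2
  have hpr : p.Prime := Fact.out
  have hm0 : m ≠ 0 := by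
    rintro rfl
    exact hpr.one_lt.ne' hm
  have hchar : ringChar (ZMod p) ≠ 2 := by rwa [ZMod.ringChar_zmod_n]
  have hζ : IsPrimitiveRoot (Complex.exp (2 * Real.pi * Complex.I / p)) p :=
    Complex.isPrimitiveRoot_exp p hpr.ne_zero
  have hP := prod_pow_sub_pow m
  have hP2 := sq_prod_pow_sub_pow m (ζ := Complex.exp (2 * Real.pi * Complex.I / p))
    (by rw [← hm]; exact hζ)
  rw [← hm] at hP
  have hg : (∑ x : ZMod p, (quadraticChar (ZMod p) x : ℂ) * ZMod.stdAddChar x) ^ 2 =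
      (-1) ^ m * (2 * m + 1 : ℝ) := by
    have h1 := gaussSum_sq (R' := ℂ) (χ := (quadraticChar (ZMod p)).ringHomComp (Int.castRingHom ℂ))
      (by
        intro h
        obtain ⟨x, hx⟩ := quadraticChar_exists_neg_one hchar
        have hx0 : IsUnit x := by
          rw [isUnit_iff_ne_zero]
          rintro rfl
          simp at hx
        have h2 := congrArg (fun χ : MulChar (ZMod p) ℂ => χ x) h
        simp only [MulChar.ringHomComp_apply, hx, MulChar.one_apply hx0] at h2
        norm_num at h2)
      ((quadraticChar_isQuadratic (ZMod p)).comp _) (ZMod.isPrimitive_stdAddChar p)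
    have h3 := legendreSym.eq_pow p (-1)
    rw [show p / 2 = m by omega] at h3
    have h4 : legendreSym p (-1) = (-1) ^ m := by
      rw [legendreSym.at_neg_one hp2, ZMod.χ₄_eq_neg_one_pow (by omega), show p / 2 = m by omega]
    rw [legendreSym] at h4
    push_cast at h4
    simp only [_root_.gaussSum, MulChar.ringHomComp_apply, h4, ZMod.card] at h1
    simp only [eq_intCast] at h1
    rw [h1, hm]
    push_cast
    ring
  obtain ⟨s, hs, hs2⟩ : ∃ s : ℤ, (s = 1 ∨ s = -1) ∧
      ∑ x : ZMod p, (quadraticChar (ZMod p) x : ℂ) * ZMod.stdAddChar x =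
        s * ∏ k ∈ range m, (Complex.exp (2 * Real.pi * Complex.I / p) ^ (k + 1) -
          Complex.exp (2 * Real.pi * Complex.I / p) ^ (2 * m - k)) := by
    rcases sq_eq_sq_iff_eq_or_eq_neg.1 (hg.trans hP2.symm) with h | h
    · exact ⟨1, Or.inl rfl, by rw [h]; simp⟩
    · exact ⟨-1, Or.inr rfl, by rw [h]; simp⟩
  have h5 := sign_mod p m hm0 hm s hζ (by rw [sum_range_legendreSym, hs2])
  have h6 := legendreSym.eq_pow p 2
  rw [show p / 2 = m by omega, legendreSym.at_two hp2] at h6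
  -- `sign_mod` gives `s = (2 / p) (-1) ^ m`, as a congruence between signs modulo an odd prime
  have h7 : s * ZMod.χ₈ p = (-1) ^ m := by
    have hχ : ZMod.χ₈ p = 1 ∨ ZMod.χ₈ p = -1 := by
      rw [ZMod.χ₈_nat_eq_if_mod_eight]
      split_ifs <;> [omega; simp; simp]
    have h8 : ((s * ZMod.χ₈ p : ℤ) : ZMod p) = (((-1) ^ m : ℤ) : ZMod p) := by
      push_cast
      rw [h6, h5]
      push_cast
      rfl
    have h9 : (1 : ZMod p) ≠ -1 := by
      have : Fact (2 < p) := ⟨by have := hpr.two_le; omega⟩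
      exact (ZMod.neg_one_ne_one).symm
    rcases hs with rfl | rfl <;> rcases hχ with h | h <;> rcases neg_one_pow_eq_or ℤ m with h' | h' <;>
      rw [h, h'] at h8 <;> rw [h, h'] <;> simp at h8 ⊢
    all_goals first | exact absurd h8 h9 | exact absurd h8.symm h9
  rw [hs2, hP, ← mul_assoc]
  have e : (2 * m + 1 : ℝ) = p := by rw [hm]; push_cast; ring
  rw [e]
  congr 1
  have h10 : s = (-1) ^ m * ZMod.χ₈ p := by
    rw [← h7, mul_assoc, ← sq]
    rw [ZMod.χ₈_nat_eq_if_mod_eight]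
    split_ifs <;> [omega; simp; simp]
  rw [h10, ZMod.χ₈_nat_eq_if_mod_eight, if_neg (by omega)]
  obtain ⟨c, d, hcd, hd⟩ : ∃ c d, m = 4 * c + d ∧ d < 4 := ⟨m / 4, m % 4, by omega, by omega⟩
  have e8 : p % 8 = 2 * d + 1 := by omega
  have e4 : p % 4 = (2 * d + 1) % 4 := by omega
  rw [e8, e4, hcd, pow_add, pow_mul, pow_add, pow_mul Complex.I, Complex.I_pow_four]
  interval_cases d <;> norm_num [pow_succ]

/-- The quadratic exponential sum is a Gauss sum, since `y` has `(y / p) + 1` square roots modulo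
`p`. -/
theorem sum_stdAddChar_mul_sq (p : ℕ) [Fact p.Prime] (hp2 : p ≠ 2) (a : ZMod p) (ha : a ≠ 0) :
    ∑ x : ZMod p, ZMod.stdAddChar (a * x ^ 2) =
      quadraticChar (ZMod p) a * ((if p % 4 = 3 then Complex.I else 1) * (√p : ℝ)) := by
  have hchar : ringChar (ZMod p) ≠ 2 := by rwa [ZMod.ringChar_zmod_n]
  rw [← sum_quadraticChar_mul_stdAddChar p hp2]
  have h1 : ∑ x : ZMod p, ZMod.stdAddChar (a * x ^ 2) =
      ∑ y : ZMod p, ((quadraticChar (ZMod p) y : ℂ) + 1) * ZMod.stdAddChar (a * y) := by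
    rw [← Finset.sum_fiberwise univ (fun x : ZMod p => x ^ 2)]
    refine sum_congr rfl fun y _ => ?_
    rw [sum_congr rfl (g := fun _ => ZMod.stdAddChar (a * y)) (by
      intro x hx
      rw [(mem_filter.1 hx).2])]
    rw [sum_const, nsmul_eq_mul]
    congr 1
    have := quadraticChar_card_sqrts hchar y
    have h2 : ((#{x : ZMod p | x ^ 2 = y} : ℕ) : ℤ) = quadraticChar (ZMod p) y + 1 := by
      rw [← this]
      congr 2
      ext x
      simp
    exact_mod_cast congrArg (fun z : ℤ => (z : ℂ)) h2
  have h2 : ∑ y : ZMod p, ZMod.stdAddChar (a * y) = (0 : ℂ) := by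
    have := AddChar.sum_eq_zero_of_ne_one (ZMod.isPrimitive_stdAddChar p ha)
    simpa [AddChar.mulShift_apply] using this
  simp only [add_mul, one_mul, sum_add_distrib, h1, h2, add_zero, mul_sum]
  refine Fintype.sum_equiv (Equiv.mulLeft₀ a ha) _ _ fun y => ?_
  have h3 : quadraticChar (ZMod p) a * quadraticChar (ZMod p) a = 1 := by
    rw [← sq]
    exact quadraticChar_sq_one ha
  have h4 : (quadraticChar (ZMod p) a : ℂ) * quadraticChar (ZMod p) a = 1 := by exact_mod_cast h3
  rw [show Equiv.mulLeft₀ a ha y = a * y from rfl, map_mul (quadraticChar (ZMod p))]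
  push_cast
  linear_combination (-(quadraticChar (ZMod p) y : ℂ) * ZMod.stdAddChar (a * y)) * h4

end QuadraticGauss

namespace QuadraticGauss

open Finset Matrix

/-! ### Gauss sums of quadratic forms over finite rings -/

/-- The Gauss sum of the quadratic form `v ↦ vᵀ A v`, with respect to the additive character `χ`.
The matrix `A` need not be symmetric; the polar form has matrix `A + Aᵀ`. -/
noncomputable def formSum {ι R : Type*} [Fintype ι] [DecidableEq ι] [CommRing R] [Fintype R]
    (χ : AddChar R ℂ) (A : Matrix ι ι R) : ℂ :=
  ∑ v : ι → R, χ (v ⬝ᵥ A *ᵥ v)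

/-- Two complex numbers have the same direction if they differ by a positive factor. -/
def SameDir (z w : ℂ) : Prop := ∃ c : ℝ, 0 < c ∧ z = c * w

theorem SameDir.refl (z : ℂ) : SameDir z z := ⟨1, one_pos, by simp⟩

theorem SameDir.symm {z w : ℂ} : SameDir z w → SameDir w z := by
  rintro ⟨c, hc, rfl⟩
  refine ⟨c⁻¹, inv_pos.2 hc, ?_⟩
  rw [← mul_assoc, ← Complex.ofReal_mul, inv_mul_cancel₀ hc.ne']
  simp

theorem SameDir.trans {z w u : ℂ} : SameDir z w → SameDir w u → SameDir z u := by
  rintro ⟨c, hc, rfl⟩ ⟨d, hd, rfl⟩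
  exact ⟨c * d, mul_pos hc hd, by push_cast; ring⟩

theorem SameDir.mul {z w z' w' : ℂ} : SameDir z w → SameDir z' w' → SameDir (z * z') (w * w') := by
  rintro ⟨c, hc, rfl⟩ ⟨d, hd, rfl⟩
  exact ⟨c * d, mul_pos hc hd, by push_cast; ring⟩

theorem SameDir.natCast_mul {n : ℕ} (hn : 0 < n) (z : ℂ) : SameDir (n * z) z :=
  ⟨n, by exact_mod_cast hn, by simp⟩

theorem SameDir.eq_norm_mul {z w : ℂ} (h : SameDir z w) (hw : ‖w‖ = 1) : z = ‖z‖ * w := by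
  obtain ⟨c, hc, rfl⟩ := h
  rw [norm_mul, hw, mul_one, Complex.norm_real, Real.norm_of_nonneg hc.le]

theorem form_add {ι R : Type*} [Fintype ι] [CommRing R] (A : Matrix ι ι R) (v u : ι → R) :
    (v + u) ⬝ᵥ A *ᵥ (v + u) = v ⬝ᵥ A *ᵥ v + u ⬝ᵥ A *ᵥ u + u ⬝ᵥ (A + Aᵀ) *ᵥ v := by
  have h : v ⬝ᵥ A *ᵥ u = u ⬝ᵥ Aᵀ *ᵥ v := by
    rw [dotProduct_mulVec, dotProduct_comm, mulVec_transpose]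
  rw [mulVec_add, add_dotProduct, dotProduct_add, dotProduct_add, add_mulVec, dotProduct_add, h]
  ring

theorem form_smul {ι R : Type*} [Fintype ι] [CommRing R] (A : Matrix ι ι R) (c : R) (v : ι → R) :
    (c • v) ⬝ᵥ A *ᵥ (c • v) = c ^ 2 * (v ⬝ᵥ A *ᵥ v) := by
  rw [mulVec_smul, smul_dotProduct, dotProduct_smul, smul_eq_mul, smul_eq_mul]
  ring

theorem mulVec_eq_zero_iff_of_isUnit_det {ι R : Type*} [Fintype ι] [DecidableEq ι] [CommRing R]
    {S : Matrix ι ι R} (hS : IsUnit S.det) (v : ι → R) :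
    S *ᵥ v = 0 ↔ v = 0 := by
  constructor
  · intro h
    have := congrArg (fun w => S⁻¹ *ᵥ w) h
    simpa [mulVec_mulVec, nonsing_inv_mul S hS] using this
  · rintro rfl
    simp

theorem form_fromBlocks {ι κ R : Type*} [Fintype ι] [Fintype κ] [CommRing R] (A : Matrix ι ι R) (B : Matrix ι κ R)
    (C : Matrix κ ι R) (D : Matrix κ κ R) (x : ι → R) (y : κ → R) :
    Sum.elim x y ⬝ᵥ fromBlocks A B C D *ᵥ Sum.elim x y =
      x ⬝ᵥ A *ᵥ x + x ⬝ᵥ (B + Cᵀ) *ᵥ y + y ⬝ᵥ D *ᵥ y := by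
  have h : y ⬝ᵥ C *ᵥ x = x ⬝ᵥ Cᵀ *ᵥ y := by
    rw [dotProduct_mulVec, dotProduct_comm, mulVec_transpose]
  rw [fromBlocks_mulVec, sumElim_dotProduct_sumElim]
  simp only [Sum.elim_comp_inl, Sum.elim_comp_inr, dotProduct_add, add_mulVec, h]
  ring

section General

variable {ι R : Type*} [Fintype ι] [DecidableEq ι] [CommRing R] [Fintype R]

theorem sum_addChar_dotProduct [DecidableEq R] {χ : AddChar R ℂ} (hχ : χ.IsPrimitive) (y : ι → R) :
    ∑ w : ι → R, χ (w ⬝ᵥ y) = if y = 0 then (Fintype.card R : ℂ) ^ Fintype.card ι else 0 := by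
  split_ifs with h
  · simp [h]
  · obtain ⟨i, hi⟩ := Function.ne_iff.1 h
    have h1 : ∃ c, χ (c * y i) ≠ 1 := by
      by_contra! hc
      refine hχ hi ?_
      ext c
      rw [AddChar.mulShift_apply, mul_comm, hc, AddChar.one_apply]
    obtain ⟨c, hc⟩ := h1
    have h2 : ∑ w : ι → R, χ (w ⬝ᵥ y) = χ (c * y i) * ∑ w : ι → R, χ (w ⬝ᵥ y) := by
      rw [mul_sum]
      refine (Fintype.sum_equiv (Equiv.addLeft (Pi.single i c)) _ _ fun w => ?_).symm
      rw [Equiv.coe_addLeft, add_dotProduct, single_dotProduct, AddChar.map_add_eq_mul]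
    have h3 : (1 - χ (c * y i)) * ∑ w : ι → R, χ (w ⬝ᵥ y) = 0 := by
      linear_combination h2
    exact (mul_eq_zero.1 h3).resolve_left (sub_ne_zero.2 hc.symm)

/-- The modulus of the Gauss sum of a quadratic form with unimodular polar form: expanding `|sum|²`
and substituting `v = u + w`, the sum over `w` is that of a character, which is trivial only for
`u = 0`. -/
theorem norm_formSum {χ : AddChar R ℂ} (hχ : χ.IsPrimitive) (A : Matrix ι ι R)
    (hA : IsUnit (A + Aᵀ).det) : ‖formSum χ A‖ = √(Fintype.card R) ^ Fintype.card ι := by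
  classical
  have hconj : ∀ x, (starRingEnd ℂ) (χ x) = χ (-x) := fun x => by
    rw [AddChar.map_neg_eq_conj]
  have h1 : formSum χ A * (starRingEnd ℂ) (formSum χ A) =
      (Fintype.card R : ℂ) ^ Fintype.card ι := by
    rw [formSum, map_sum, sum_mul_sum, sum_comm]
    have h2 : ∀ w : ι → R, ∑ v : ι → R, χ (v ⬝ᵥ A *ᵥ v) * (starRingEnd ℂ) (χ (w ⬝ᵥ A *ᵥ w)) =
        ∑ u : ι → R, χ (u ⬝ᵥ A *ᵥ u) * χ (w ⬝ᵥ (A + Aᵀ) *ᵥ u) := by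
      intro w
      refine (Fintype.sum_equiv (Equiv.addRight w) _ _ fun u => ?_).symm
      rw [Equiv.coe_addRight, form_add, hconj, ← AddChar.map_add_eq_mul, ← AddChar.map_add_eq_mul]
      congr 1
      ring
    rw [sum_congr rfl fun w _ => h2 w, sum_comm]
    simp_rw [← mul_sum, sum_addChar_dotProduct hχ, mulVec_eq_zero_iff_of_isUnit_det hA]
    simp
  rw [Complex.mul_conj, Complex.normSq_eq_norm_sq] at h1
  have h3 : ‖formSum χ A‖ ^ 2 = (Fintype.card R : ℝ) ^ Fintype.card ι := by exact_mod_cast h1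
  have h4 : (√(Fintype.card R : ℝ) ^ Fintype.card ι) ^ 2 =
      (Fintype.card R : ℝ) ^ Fintype.card ι := by
    rw [← pow_mul, mul_comm, pow_mul, Real.sq_sqrt (Nat.cast_nonneg _)]
  exact (pow_left_inj₀ (norm_nonneg _) (by positivity) two_ne_zero).1 (h3.trans h4.symm)

/-- Averaging over the translations by multiples of an element `t` of square zero concentrates the
Gauss sum on the vectors killed by `t`. -/
theorem formSum_eq_sum_filter [DecidableEq R] {χ : AddChar R ℂ} (hχ : χ.IsPrimitive)
    (A : Matrix ι ι R) (hA : IsUnit (A + Aᵀ).det) (t : R) (ht : t ^ 2 = 0) :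
    formSum χ A = ∑ v : ι → R with t • v = 0, χ (v ⬝ᵥ A *ᵥ v) := by
  have hcard : (Fintype.card R : ℂ) ^ Fintype.card ι ≠ 0 :=
    pow_ne_zero _ (Nat.cast_ne_zero.2 Fintype.card_ne_zero)
  have h1 : ∑ u : ι → R, ∑ v : ι → R, χ (v ⬝ᵥ A *ᵥ v) * χ (u ⬝ᵥ (A + Aᵀ) *ᵥ (t • v)) =
      (Fintype.card R : ℂ) ^ Fintype.card ι * formSum χ A := by
    have h2 : ∀ u : ι → R, ∑ v : ι → R, χ (v ⬝ᵥ A *ᵥ v) * χ (u ⬝ᵥ (A + Aᵀ) *ᵥ (t • v)) =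
        formSum χ A := by
      intro u
      refine Fintype.sum_equiv (Equiv.addRight (t • u)) _ _ fun v => ?_
      rw [Equiv.coe_addRight, form_add, form_smul, ht, zero_mul, add_zero,
        ← AddChar.map_add_eq_mul, mulVec_smul, smul_dotProduct, dotProduct_smul]
    rw [sum_congr rfl fun u _ => h2 u]
    simp
  rw [sum_comm] at h1
  simp_rw [← mul_sum, sum_addChar_dotProduct hχ, mulVec_eq_zero_iff_of_isUnit_det hA] at h1
  rw [sum_filter]
  apply mul_left_cancel₀ hcard
  rw [← h1, mul_sum]
  refine sum_congr rfl fun v _ => ?_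
  split_ifs <;> ring

theorem formSum_submatrix {κ : Type*} [Fintype κ] [DecidableEq κ] (χ : AddChar R ℂ)
    (A : Matrix ι ι R) (e : κ ≃ ι) : formSum χ (A.submatrix e e) = formSum χ A := by
  refine Fintype.sum_equiv (Equiv.arrowCongr e (Equiv.refl R)) _ _ fun v => ?_
  congr 1
  have h : (Equiv.arrowCongr e (Equiv.refl R)) v = v ∘ e.symm := rfl
  rw [h, submatrix_mulVec_equiv, ← comp_equiv_symm_dotProduct]

/-- Splitting off an orthogonal summand (completing the square). -/
theorem exists_formSum_fromBlocks {κ : Type*} [Fintype κ] [DecidableEq κ] (χ : AddChar R ℂ)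
    (A : Matrix ι ι R) (B : Matrix ι κ R) (C : Matrix κ ι R) (D : Matrix κ κ R)
    (hA : IsUnit (A + Aᵀ).det) :
    ∃ D' : Matrix κ κ R, formSum χ (fromBlocks A B C D) = formSum χ A * formSum χ D' ∧
      (fromBlocks A B C D + (fromBlocks A B C D)ᵀ).det = (A + Aᵀ).det * (D' + D'ᵀ).det := by
  let : Invertible (A + Aᵀ) := invertibleOfIsUnitDet _ hA
  set S := A + Aᵀ with hS
  have hST : Sᵀ = S := by rw [hS, transpose_add, transpose_transpose, add_comm]
  set U := B + Cᵀ with hU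
  -- translating `x` by `-K y` removes the mixed term `x ⬝ᵥ U *ᵥ y`
  obtain ⟨K, hK⟩ : ∃ K, K = ⅟S * U := ⟨_, rfl⟩
  have hSK : S * K = U := by rw [hK, ← Matrix.mul_assoc, mul_invOf_self, Matrix.one_mul]
  have hKT : ∀ (y : κ → R) (w : ι → R), (K *ᵥ y) ⬝ᵥ w = y ⬝ᵥ Kᵀ *ᵥ w := fun y w => by
    rw [dotProduct_mulVec y Kᵀ, vecMul_transpose]
  refine ⟨D + Kᵀ * A * K - Kᵀ * U, ?_, ?_⟩
  · rw [formSum, formSum, formSum, sum_mul_sum, ← Fintype.sum_prod_type']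
    have e : ∀ z : (ι → R) × (κ → R), z = (z.1, z.2) := fun z => rfl
    rw [Fintype.sum_equiv (Equiv.sumArrowEquivProdArrow ι κ R) _
      (fun z : (ι → R) × (κ → R) => χ (z.1 ⬝ᵥ A *ᵥ z.1 + z.1 ⬝ᵥ U *ᵥ z.2 + z.2 ⬝ᵥ D *ᵥ z.2))
      (fun v => by
        rw [← form_fromBlocks]
        congr 1
        have : v = Sum.elim (v ∘ Sum.inl) (v ∘ Sum.inr) := (Sum.elim_comp_inl_inr v).symm
        conv_lhs => rw [this]
        rfl)]
    rw [Fintype.sum_prod_type, Fintype.sum_prod_type, sum_comm, sum_comm (s := univ (α := ι → R))]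
    refine sum_congr rfl fun y _ => ?_
    refine (Fintype.sum_equiv (Equiv.addRight (-(K *ᵥ y))) _ _ fun x => ?_).symm
    rw [Equiv.coe_addRight, form_add, ← AddChar.map_add_eq_mul]
    congr 1
    have h1 : (-(K *ᵥ y)) ⬝ᵥ S *ᵥ x = -(x ⬝ᵥ U *ᵥ y) := by
      rw [neg_dotProduct, dotProduct_mulVec (K *ᵥ y) S x, ← mulVec_transpose, hST, mulVec_mulVec,
        hSK, dotProduct_comm]
    have h2 : (-(K *ᵥ y)) ⬝ᵥ A *ᵥ (-(K *ᵥ y)) = y ⬝ᵥ (Kᵀ * A * K) *ᵥ y := by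
      rw [mulVec_neg, neg_dotProduct_neg, hKT, mulVec_mulVec, mulVec_mulVec]
    have h3 : (x + -(K *ᵥ y)) ⬝ᵥ U *ᵥ y = x ⬝ᵥ U *ᵥ y - y ⬝ᵥ (Kᵀ * U) *ᵥ y := by
      rw [add_dotProduct, neg_dotProduct, hKT, mulVec_mulVec]
      ring
    rw [h1, h2, h3, sub_mulVec, add_mulVec, dotProduct_sub, dotProduct_add]
    ring
  -- the polar form of `D'` is the Schur complement of `A + Aᵀ`
  · rw [fromBlocks_transpose, fromBlocks_add, det_fromBlocks₁₁]
    congr 2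
    have hUT : C + Bᵀ = Uᵀ := by rw [hU, transpose_add, transpose_transpose, add_comm]
    rw [hUT, Matrix.mul_assoc, ← hK]
    simp only [transpose_sub, transpose_add, transpose_mul, transpose_transpose]
    have h4 : Uᵀ * K = Kᵀ * A * K + Kᵀ * (Aᵀ * K) := by
      rw [Matrix.mul_assoc, ← Matrix.mul_add, ← Matrix.add_mul, ← hS, hSK, ← hSK, transpose_mul,
        hST, Matrix.mul_assoc]
    have h5 : Kᵀ * U = Kᵀ * A * K + Kᵀ * (Aᵀ * K) := by
      rw [Matrix.mul_assoc, ← Matrix.mul_add, ← Matrix.add_mul, ← hS, hSK]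
    rw [h4, h5]
    abel

end General

/-! ### Gauss sums of quadratic forms over `ℤ/r`, for a prime power `r` -/

/-- The fibres of a homomorphism of finite groups over its image all have the same number of elements. -/
theorem exists_sum_comp_eq {V W : Type*} [AddCommGroup V] [AddCommGroup W] [Fintype V] [Fintype W]
    (f : V →+ W) :
    ∃ c : ℕ, 0 < c ∧ ∀ (s : Finset W), (∀ w, w ∈ s ↔ w ∈ f.range) → ∀ F : W → ℂ,
      ∑ v, F (f v) = c * ∑ w ∈ s, F w := by
  classical
  refine ⟨#{v | f v = 0}, card_pos.2 ⟨0, by simp⟩, fun s hs F => ?_⟩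
  rw [← sum_fiberwise_of_maps_to (s := univ) (t := s) (g := f) (fun v _ => (hs _).2 ⟨v, rfl⟩),
    mul_sum]
  refine sum_congr rfl fun w hw => ?_
  obtain ⟨v₀, rfl⟩ := (hs w).1 hw
  rw [sum_congr rfl (g := fun _ => F (f v₀)) (fun v hv => by rw [(mem_filter.1 hv).2]),
    sum_const, nsmul_eq_mul]
  congr 2
  refine card_bij (fun v _ => v - v₀) (by simp [sub_eq_zero]) (by simp) fun v hv => ?_
  exact ⟨v + v₀, by simpa using hv, by simp⟩

theorem addChar_sum {A ι : Type*} [AddCommMonoid A] (χ : AddChar A ℂ) (s : Finset ι) (f : ι → A) :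
    χ (∑ i ∈ s, f i) = ∏ i ∈ s, χ (f i) := by
  classical
  induction s using Finset.induction_on with
  | empty => simp
  | insert a s ha ih => rw [sum_insert ha, prod_insert ha, AddChar.map_add_eq_mul, ih]

section ZMod

variable {r : ℕ} [NeZero r]

theorem exists_eq_natCast_mul {c d : ℕ} (h : r = c * d) (x : ZMod r) (hx : (c : ZMod r) * x = 0) :
    ∃ y, x = (d : ZMod r) * y := by
  have hc : 0 < c := Nat.pos_of_ne_zero (by rintro rfl; exact NeZero.ne r (by simp [h]))
  rw [← ZMod.natCast_zmod_val x, ← Nat.cast_mul, ZMod.natCast_eq_zero_iff] at hx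
  obtain ⟨y, hy⟩ : d ∣ x.val := Nat.dvd_of_mul_dvd_mul_left hc (h.symm.dvd.trans hx)
  exact ⟨y, by rw [← Nat.cast_mul, ← hy, ZMod.natCast_zmod_val]⟩

theorem stdAddChar_natCast_mul {c d : ℕ} [NeZero d] (h : r = c * d) (x : ZMod r) :
    ZMod.stdAddChar ((c : ZMod r) * x) =
      ZMod.stdAddChar (ZMod.castHom (Dvd.intro_left c h.symm) (ZMod d) x) := by
  obtain ⟨j, rfl⟩ := ZMod.intCast_surjective x
  have hc : (c : ℂ) ≠ 0 := Nat.cast_ne_zero.2 (by rintro rfl; exact NeZero.ne r (by simp [h]))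
  have hd : (d : ℂ) ≠ 0 := Nat.cast_ne_zero.2 (NeZero.ne d)
  have e : (c : ZMod r) * (j : ZMod r) = ((c * j : ℤ) : ZMod r) := by push_cast; rfl
  have hr : (r : ℂ) = c * d := by rw [h]; push_cast; rfl
  rw [e, map_intCast (ZMod.castHom (Dvd.intro_left c h.symm) (ZMod d)), ZMod.stdAddChar_coe, ZMod.stdAddChar_coe, hr]
  congr 1
  push_cast
  field_simp

variable {ι : Type*} [Fintype ι] [DecidableEq ι]

/-- The sum over the vectors killed by `c`, when `r = c d`, is a sum over multiples of `d`. -/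
theorem sameDir_sum_filter {c d : ℕ} (h : r = c * d) (A : Matrix ι ι (ZMod r)) :
    SameDir (∑ v : ι → ZMod r with (c : ZMod r) • v = 0, ZMod.stdAddChar (v ⬝ᵥ A *ᵥ v))
      (∑ v : ι → ZMod r, ZMod.stdAddChar ((d : ZMod r) ^ 2 * (v ⬝ᵥ A *ᵥ v))) := by
  have hcd : (c : ZMod r) * d = 0 := by rw [← Nat.cast_mul, ← h, ZMod.natCast_self]
  obtain ⟨n, hn, H⟩ := exists_sum_comp_eq
    (DistribSMul.toAddMonoidHom (ι → ZMod r) (d : ZMod r))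
  have h1 := H {v | (c : ZMod r) • v = 0} (fun w => by
    rw [mem_filter, AddMonoidHom.mem_range]
    constructor
    · rintro ⟨-, hw⟩
      choose y hy using fun i => exists_eq_natCast_mul h (w i) (congrFun hw i)
      exact ⟨y, by ext i; exact (hy i).symm⟩
    · rintro ⟨y, rfl⟩
      refine ⟨mem_univ _, ?_⟩
      rw [DistribSMul.toAddMonoidHom_apply, smul_smul, hcd, zero_smul])
    (fun v => ZMod.stdAddChar (v ⬝ᵥ A *ᵥ v))
  simp only [DistribSMul.toAddMonoidHom_apply, form_smul] at h1
  rw [h1]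
  exact (SameDir.natCast_mul hn _).symm

/-- When `r = t²`, the sum over the vectors killed by `t` has only terms equal to `1`, so the Gauss
sum is positive. -/
theorem formSum_sameDir_one {t : ℕ} (h : r = t * t) (A : Matrix ι ι (ZMod r))
    (hA : IsUnit (A + Aᵀ).det) : SameDir (formSum ZMod.stdAddChar A) 1 := by
  have ht : (t : ZMod r) ^ 2 = 0 := by rw [sq, ← Nat.cast_mul, ← h, ZMod.natCast_self]
  rw [formSum_eq_sum_filter (ZMod.isPrimitive_stdAddChar r) A hA t ht]
  refine (sameDir_sum_filter h A).trans ?_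
  simp only [ht, zero_mul, AddChar.map_zero_eq_one, sum_const, nsmul_eq_mul]
  exact SameDir.natCast_mul (card_pos.2 univ_nonempty) 1

/-- When `r = p t²`, the Gauss sum over `ℤ/r` reduces to one with values in the `p`-th roots of
unity. -/
theorem formSum_sameDir_formSum {p t : ℕ} [NeZero p] (h : r = t * t * p) (A : Matrix ι ι (ZMod r))
    (hA : IsUnit (A + Aᵀ).det) : SameDir (formSum ZMod.stdAddChar A)
      (formSum ((ZMod.stdAddChar (N := p)).compAddMonoidHom
        (ZMod.castHom (Dvd.intro_left (t * t) h.symm) (ZMod p) : ZMod r →+ ZMod p)) A) := by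
  have ht : ((p * t : ℕ) : ZMod r) ^ 2 = 0 := by
    rw [sq, ← Nat.cast_mul, ZMod.natCast_eq_zero_iff, h]
    exact ⟨p, by ring⟩
  rw [formSum_eq_sum_filter (ZMod.isPrimitive_stdAddChar r) A hA _ ht]
  refine (sameDir_sum_filter (d := t) (by rw [h]; ring) A).trans ?_
  rw [formSum]
  have e : ∀ x : ZMod r, ZMod.stdAddChar ((t : ZMod r) ^ 2 * x) = ((ZMod.stdAddChar (N := p)).compAddMonoidHom
        (ZMod.castHom (Dvd.intro_left (t * t) h.symm) (ZMod p) : ZMod r →+ ZMod p)) x := by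
    intro x
    rw [sq, ← Nat.cast_mul, stdAddChar_natCast_mul h]
    rfl
  simp only [e]
  exact SameDir.refl _

end ZMod

/-! ### Odd primes -/

/-- For an odd prime the form is diagonalised, and the Gauss sum is a product of one-variable sums. -/
theorem formSum_prime (p : ℕ) [Fact p.Prime] (hp2 : p ≠ 2) {ι : Type*} [Fintype ι] [DecidableEq ι]
    (A : Matrix ι ι (ZMod p)) (hA : IsUnit (A + Aᵀ).det) :
    formSum ZMod.stdAddChar A = quadraticChar (ZMod p) (((2 : ZMod p)⁻¹ • (A + Aᵀ)).det) *
      ((if p % 4 = 3 then Complex.I else 1) * (√p : ℝ)) ^ Fintype.card ι := by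
  have h2 : (2 : ZMod p) ≠ 0 := by
    intro h
    have h' : ((2 : ℕ) : ZMod p) = 0 := by exact_mod_cast h
    rw [ZMod.natCast_eq_zero_iff, Nat.prime_dvd_prime_iff_eq Fact.out Nat.prime_two] at h'
    exact hp2 h'
  let : Invertible (2 : ZMod p) := invertibleOfNonzero h2
  set M := (2 : ZMod p)⁻¹ • (A + Aᵀ) with hM
  have hMdet : M.det ≠ 0 := by
    rw [hM, det_smul]
    exact mul_ne_zero (pow_ne_zero _ (inv_ne_zero h2)) hA.ne_zero
  have hMT : Mᵀ = M := by rw [hM, transpose_smul, transpose_add, transpose_transpose, add_comm]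
  have hform : ∀ v : ι → ZMod p, v ⬝ᵥ A *ᵥ v = v ⬝ᵥ M *ᵥ v := by
    intro v
    have h : v ⬝ᵥ Aᵀ *ᵥ v = v ⬝ᵥ A *ᵥ v := by
      rw [dotProduct_mulVec, vecMul_transpose, dotProduct_comm]
    rw [hM, smul_mulVec, dotProduct_smul, add_mulVec, dotProduct_add, h, smul_eq_mul, ← two_mul,
      inv_mul_cancel_left₀ h2]
  obtain ⟨v, hv⟩ := LinearMap.BilinForm.exists_orthogonal_basis (B := Matrix.toBilin' M) (by
    constructor
    intro x y
    rw [RingHom.id_apply, toBilin'_apply', toBilin'_apply', dotProduct_mulVec, dotProduct_comm,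
      ← mulVec_transpose, hMT])
  let e : Fin (Module.finrank (ZMod p) (ι → ZMod p)) ≃ ι :=
    Fintype.equivOfCardEq (by rw [Fintype.card_fin, Module.finrank_fintype_fun_eq_card])
  let w := v.reindex e
  let P : Matrix ι ι (ZMod p) := Matrix.of fun i j => w j i
  let d : ι → ZMod p := fun i => w i ⬝ᵥ M *ᵥ w i
  have hP : Pᵀ * M * P = diagonal d := by
    ext i j
    have h1 : (Pᵀ * M * P) i j = w i ⬝ᵥ M *ᵥ w j := by
      rw [Matrix.mul_assoc]
      rfl
    rw [h1, diagonal_apply]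
    split_ifs with hij
    · rw [← hij]
    · have h3 := hv (i := e.symm i) (j := e.symm j) (by simpa using hij)
      rw [Function.onFun, toBilin'_apply'] at h3
      simpa [w] using h3
  have hPv : ∀ c : ι → ZMod p, P *ᵥ c = w.equivFun.symm c := by
    intro c
    rw [Module.Basis.equivFun_symm_apply]
    ext i
    simp [mulVec, dotProduct, P, mul_comm]
  have hsum : formSum ZMod.stdAddChar A = ∏ i, ∑ x : ZMod p, ZMod.stdAddChar (d i * x ^ 2) := by
    rw [formSum, prod_univ_sum, Fintype.piFinset_univ]
    refine (Fintype.sum_equiv w.equivFun.symm.toEquiv _ _ fun c => ?_).symm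
    have h4 : (w.equivFun.symm c) ⬝ᵥ A *ᵥ (w.equivFun.symm c) = ∑ i, d i * c i ^ 2 := by
      have h5 : ∀ u : ι → ZMod p, (P *ᵥ c) ⬝ᵥ u = c ⬝ᵥ Pᵀ *ᵥ u := fun u => by
        rw [dotProduct_mulVec c Pᵀ, vecMul_transpose]
      rw [hform, ← hPv, h5, mulVec_mulVec, mulVec_mulVec, hP, dotProduct]
      refine sum_congr rfl fun i _ => ?_
      rw [mulVec_diagonal]
      ring
    change _ = ZMod.stdAddChar ((w.equivFun.symm c) ⬝ᵥ A *ᵥ (w.equivFun.symm c))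
    rw [h4, addChar_sum]
  have hdet : ∏ i, d i = P.det ^ 2 * M.det := by
    rw [← det_diagonal, ← hP, det_mul, det_mul, det_transpose]
    ring
  have hPdet : P.det ≠ 0 := by
    have : Function.Surjective P.mulVec := fun y => ⟨w.equivFun y, by
      rw [hPv, LinearEquiv.symm_apply_apply]⟩
    exact (isUnit_iff_isUnit_det P).1 (mulVec_surjective_iff_isUnit.1 this) |>.ne_zero
  have hd : ∀ i, d i ≠ 0 := fun i hi =>
    mul_ne_zero (pow_ne_zero 2 hPdet) hMdet (by rw [← hdet]; exact prod_eq_zero (mem_univ i) hi)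
  rw [hsum, prod_congr rfl fun i _ => sum_stdAddChar_mul_sq p hp2 (d i) (hd i), prod_mul_distrib,
    prod_const, card_univ]
  congr 1
  rw [← Int.cast_prod, ← map_prod, hdet, map_mul, map_pow, quadraticChar_sq_one hPdet, one_mul]

theorem sameDir_pow_of_sq {z : ℂ} {c : ℝ} (hc : 0 < c) (n : ℕ) : SameDir ((z * c) ^ n) (z ^ n) :=
  ⟨c ^ n, pow_pos hc n, by rw [mul_pow]; push_cast; ring⟩

/-! ### The prime two -/

/-- The sign character of `ZMod r`, for `r` even. -/
noncomputable def parityChar (r : ℕ) (h : 2 ∣ r) : AddChar (ZMod r) ℂ :=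
  (ZMod.stdAddChar (N := 2)).compAddMonoidHom (ZMod.castHom h (ZMod 2) : ZMod r →+ ZMod 2)

theorem stdAddChar_two_one : ZMod.stdAddChar (1 : ZMod 2) = -1 := by
  have := ZMod.stdAddChar_coe (N := 2) 1
  rw [Int.cast_one] at this
  rw [this]
  push_cast
  rw [show 2 * (Real.pi : ℂ) * Complex.I * 1 / 2 = Real.pi * Complex.I by ring, Complex.exp_pi_mul_I]

section Two

variable {r : ℕ} (h2 : 2 ∣ r)

theorem parityChar_add_two_mul (x y : ZMod r) :
    parityChar r h2 (x + 2 * y) = parityChar r h2 x := by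
  change ZMod.stdAddChar (ZMod.castHom h2 (ZMod 2) (x + 2 * y)) =
    ZMod.stdAddChar (ZMod.castHom h2 (ZMod 2) x)
  rw [map_add, map_mul, map_ofNat, show (2 : ZMod 2) = 0 from rfl, zero_mul, add_zero]

theorem parityChar_one : parityChar r h2 1 = -1 := by
  change ZMod.stdAddChar (ZMod.castHom h2 (ZMod 2) 1) = -1
  rw [map_one, stdAddChar_two_one]

theorem exists_two_mul (x : ZMod r) : ∃ y, x = 2 * y ∨ x = 2 * y + 1 := by
  obtain ⟨j, rfl⟩ := ZMod.intCast_surjective x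
  rcases Int.even_or_odd' j with ⟨k, rfl | rfl⟩
  · exact ⟨k, Or.inl (by push_cast; rfl)⟩
  · exact ⟨k, Or.inr (by push_cast; rfl)⟩

theorem parityChar_two_mul (y : ZMod r) : parityChar r h2 (2 * y) = 1 := by
  have := parityChar_add_two_mul h2 0 y
  rwa [zero_add, AddChar.map_zero_eq_one] at this

theorem parityChar_two_mul_add_one (y : ZMod r) : parityChar r h2 (2 * y + 1) = -1 := by
  rw [add_comm, parityChar_add_two_mul, parityChar_one]

theorem exists_sq_sub_self (x : ZMod r) : ∃ y, x ^ 2 = x + 2 * y := by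
  obtain ⟨y, rfl | rfl⟩ := exists_two_mul x
  · exact ⟨2 * y ^ 2 - y, by ring⟩
  · exact ⟨2 * y ^ 2 + y, by ring⟩

theorem sum_parityChar_mul [NeZero r] (z : ZMod r) :
    ∑ y, parityChar r h2 (z * y) = if parityChar r h2 z = 1 then (r : ℂ) else 0 := by
  obtain ⟨w, rfl | rfl⟩ := exists_two_mul z
  · rw [if_pos (parityChar_two_mul h2 w)]
    simp_rw [mul_assoc, parityChar_two_mul]
    simp [ZMod.card]
  · rw [if_neg (by rw [parityChar_two_mul_add_one]; norm_num)]
    have h1 : ∑ y, parityChar r h2 ((2 * w + 1) * y) =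
        -∑ y, parityChar r h2 ((2 * w + 1) * y) := by
      rw [← sum_neg_distrib]
      refine Fintype.sum_equiv (Equiv.addRight 1) _ _ fun y => ?_
      rw [Equiv.coe_addRight, mul_add, mul_one, AddChar.map_add_eq_mul _ _ (2 * w + 1),
        parityChar_two_mul_add_one]
      ring
    linear_combination h1 / 2

/-- A binary form `a x² + b x y + c y²` with `b` odd. Modulo `2` the exponent is `a x + (x + c) y`; the
sum over `y` forces `x = c` modulo `2`, which leaves the sign `(-1) ^ (a c)`, that is
`χ₈ (4 a c - b²)`. -/
theorem formSum_parityChar_two [NeZero r] (h8 : 8 ∣ r) (A : Matrix (Fin 2) (Fin 2) (ZMod r))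
    (hA : IsUnit ((A + Aᵀ) 0 1)) :
    SameDir (formSum (parityChar r h2) A)
      (ZMod.χ₈ (ZMod.castHom h8 (ZMod 8) (A + Aᵀ).det) : ℂ) := by
  have : Fact (1 < r) := ⟨by have := Nat.le_of_dvd (NeZero.pos r) h8; omega⟩
  set a := A 0 0
  set c := A 1 1
  set b := (A + Aᵀ) 0 1 with hb
  have hb2 : ∃ b', b = 2 * b' + 1 := by
    obtain ⟨b', h | h⟩ := exists_two_mul b
    · exfalso
      have h3 := hA.map (ZMod.castHom h2 (ZMod 2))
      rw [h, map_mul, map_ofNat, show (2 : ZMod 2) = 0 from rfl, zero_mul] at h3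
      exact not_isUnit_zero h3
    · exact ⟨b', h⟩
  obtain ⟨b', hb'⟩ := hb2
  have hdet : (A + Aᵀ).det = 4 * (a * c) - b ^ 2 := by
    rw [det_fin_two, hb]
    simp only [Matrix.add_apply, transpose_apply, a, c]
    ring
  have hsum : formSum (parityChar r h2) A = parityChar r h2 (a * c) *
      ((r : ℂ) * #{x : ZMod r | parityChar r h2 (c + x) = 1}) := by
    rw [formSum, Fintype.sum_equiv (finTwoArrowEquiv (ZMod r)) _
      (fun z : ZMod r × ZMod r => parityChar r h2 (a * z.1 ^ 2 + b * z.1 * z.2 + c * z.2 ^ 2))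
      (fun v => by
        change _ = parityChar r h2 (a * v 0 ^ 2 + b * v 0 * v 1 + c * v 1 ^ 2)
        congr 1
        simp only [dotProduct, mulVec, Fin.sum_univ_two, hb, Matrix.add_apply,
          transpose_apply, a, c]
        ring), Fintype.sum_prod_type]
    have h1 : ∀ x : ZMod r, ∑ y, parityChar r h2 (a * x ^ 2 + b * x * y + c * y ^ 2) =
        if parityChar r h2 (c + x) = 1 then parityChar r h2 (a * c) * (r : ℂ) else 0 := by
      intro x
      have h3 : ∀ y, parityChar r h2 (a * x ^ 2 + b * x * y + c * y ^ 2) =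
          parityChar r h2 (a * x) * parityChar r h2 ((c + x) * y) := by
        intro y
        obtain ⟨x', hx'⟩ := exists_sq_sub_self x
        obtain ⟨y', hy'⟩ := exists_sq_sub_self y
        rw [hx', hy', hb', ← AddChar.map_add_eq_mul,
          ← parityChar_add_two_mul h2 (a * x + (c + x) * y) (a * x' + b' * x * y + c * y')]
        congr 1
        ring
      rw [sum_congr rfl fun y _ => h3 y, ← mul_sum, sum_parityChar_mul]
      split_ifs with h4
      · congr 1
        obtain ⟨w, hw⟩ : ∃ w, c + x = 2 * w := by
          obtain ⟨w, hw | hw⟩ := exists_two_mul (c + x)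
          · exact ⟨w, hw⟩
          · rw [hw, parityChar_two_mul_add_one] at h4
            norm_num at h4
        rw [← parityChar_add_two_mul h2 (a * x) (a * (c - w))]
        congr 1
        linear_combination a * hw
      · ring
    rw [sum_congr rfl fun x _ => h1 x, ← sum_filter, sum_const, nsmul_eq_mul]
    ring
  have hpos : 0 < #{x : ZMod r | parityChar r h2 (c + x) = 1} :=
    card_pos.2 ⟨-c, by simp⟩
  have hsign : parityChar r h2 (a * c) =
      (ZMod.χ₈ (ZMod.castHom h8 (ZMod 8) (A + Aᵀ).det) : ℂ) := by
    have hu := hA.map (ZMod.castHom h8 (ZMod 8))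
    rw [hdet, RingHom.map_sub, RingHom.map_mul, map_pow, map_ofNat]
    obtain ⟨w, hw | hw⟩ := exists_two_mul (a * c)
    · rw [hw, parityChar_two_mul, RingHom.map_mul, map_ofNat]
      generalize ZMod.castHom h8 (ZMod 8) b = β at hu
      generalize ZMod.castHom h8 (ZMod 8) w = ω
      have : ∀ β ω : ZMod 8, IsUnit β → ZMod.χ₈ (4 * (2 * ω) - β ^ 2) = 1 := by decide
      rw [this β ω hu]
      simp
    · rw [hw, parityChar_two_mul_add_one, RingHom.map_add, RingHom.map_mul, map_ofNat, map_one]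
      generalize ZMod.castHom h8 (ZMod 8) b = β at hu
      generalize ZMod.castHom h8 (ZMod 8) w = ω
      have : ∀ β ω : ZMod 8, IsUnit β → ZMod.χ₈ (4 * (2 * ω + 1) - β ^ 2) = -1 := by decide
      rw [this β ω hu]
      simp
  rw [hsum, hsign, ← Nat.cast_mul, mul_comm]
  exact SameDir.natCast_mul (Nat.mul_pos (NeZero.pos r) hpos) _

/-- The sign of the sum of `(-1) ^ Q(v)`, for a quadratic form with unimodular polar form, is given
by the discriminant modulo `8`. -/
theorem formSum_parityChar [NeZero r] (h8 : 8 ∣ r)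
    (hu : ∀ x : ZMod r, ZMod.castHom h2 (ZMod 2) x ≠ 0 → IsUnit x) (n : ℕ) :
    ∀ (ι : Type) [Fintype ι] [DecidableEq ι], Fintype.card ι = n → ∀ A : Matrix ι ι (ZMod r),
      IsUnit (A + Aᵀ).det → SameDir (formSum (parityChar r h2) A)
        (ZMod.χ₈ (ZMod.castHom h8 (ZMod 8) (A + Aᵀ).det) : ℂ) := by
  induction n using Nat.strong_induction_on with
  | _ n ih =>
  intro ι _ _ hn A hA
  rcases isEmpty_or_nonempty ι with he | ⟨⟨i⟩⟩
  · rw [det_isEmpty, map_one, map_one, formSum]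
    have h0 : ∀ v : ι → ZMod r, v ⬝ᵥ A *ᵥ v = 0 := fun v => by simp [dotProduct]
    simp only [h0, AddChar.map_zero_eq_one]
    simpa using SameDir.refl 1
  -- the polar form is alternating modulo `2`, so some off-diagonal entry is a unit
  obtain ⟨j, hij, hu'⟩ : ∃ j, i ≠ j ∧ IsUnit ((A + Aᵀ) i j) := by
    by_contra! hc
    have h1 : ∀ j, ZMod.castHom h2 (ZMod 2) ((A + Aᵀ) i j) = 0 := by
      intro j
      by_cases hij : i = j
      · rw [← hij, Matrix.add_apply, transpose_apply, ← two_mul, map_mul, map_ofNat,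
          show (2 : ZMod 2) = 0 from rfl, zero_mul]
      · by_contra h
        exact hc j hij (hu _ h)
    have h3 := hA.map (ZMod.castHom h2 (ZMod 2))
    rw [RingHom.map_det, det_eq_zero_of_row_eq_zero i h1] at h3
    exact not_isUnit_zero h3
  -- split off the block on `{i, j}`, whose polar determinant `4 a c - b²` is odd
  let f : Fin 2 ⊕ {x // x ≠ i ∧ x ≠ j} → ι := Sum.elim ![i, j] Subtype.val
  have hf : Function.Bijective f := by
    constructor
    · rintro (x | x) (y | y) hxy
      · fin_cases x <;> fin_cases y <;> simp [f] at hxy ⊢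
        · exact hij hxy
        · exact hij hxy.symm
      · fin_cases x <;> simp [f] at hxy
        · exact absurd hxy.symm y.2.1
        · exact absurd hxy.symm y.2.2
      · fin_cases y <;> simp [f] at hxy
        · exact absurd hxy x.2.1
        · exact absurd hxy x.2.2
      · exact congrArg Sum.inr (Subtype.ext hxy)
    · intro x
      by_cases h1 : x = i
      · exact ⟨Sum.inl 0, by simp [f, h1]⟩
      by_cases h3 : x = j
      · exact ⟨Sum.inl 1, by simp [f, h3]⟩
      exact ⟨Sum.inr ⟨x, h1, h3⟩, rfl⟩
  let e := Equiv.ofBijective f hf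
  set A' := A.submatrix e e with hA'
  have hdet : (A' + A'ᵀ).det = (A + Aᵀ).det := by
    rw [← det_submatrix_equiv_self e (A + Aᵀ)]
    rfl
  have hcard : Fintype.card {x // x ≠ i ∧ x ≠ j} < n := by
    have := Fintype.card_congr e
    rw [Fintype.card_sum, Fintype.card_fin, hn] at this
    omega
  have h01 : IsUnit ((A'.toBlocks₁₁ + A'.toBlocks₁₁ᵀ) 0 1) := hu'
  have h11 : IsUnit (A'.toBlocks₁₁ + A'.toBlocks₁₁ᵀ).det := by
    apply hu
    have h3 := h01.map (ZMod.castHom h2 (ZMod 2))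
    have h4 : (A'.toBlocks₁₁ + A'.toBlocks₁₁ᵀ).det = 2 * (2 * (A'.toBlocks₁₁ 0 0 *
        A'.toBlocks₁₁ 1 1)) - ((A'.toBlocks₁₁ + A'.toBlocks₁₁ᵀ) 0 1) ^ 2 := by
      rw [det_fin_two]
      simp only [Matrix.add_apply, transpose_apply]
      ring
    rw [h4, map_sub, map_mul, map_pow, map_ofNat, show (2 : ZMod 2) = 0 from rfl, zero_mul, zero_sub]
    exact neg_ne_zero.2 (pow_ne_zero 2 h3.ne_zero)
  obtain ⟨D, hD1, hD2⟩ := exists_formSum_fromBlocks (parityChar r h2) A'.toBlocks₁₁ A'.toBlocks₁₂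
    A'.toBlocks₂₁ A'.toBlocks₂₂ h11
  rw [fromBlocks_toBlocks] at hD1 hD2
  rw [hdet] at hD2
  have hDu : IsUnit (D + Dᵀ).det := by
    rw [hD2] at hA
    exact isUnit_of_mul_isUnit_right hA
  rw [← formSum_submatrix _ A e, ← hA', hD1, hD2, map_mul, map_mul]
  push_cast
  exact (formSum_parityChar_two h2 h8 _ h01).mul (ih _ hcard _ rfl D hDu)

end Two

/-! ### The Kronecker symbol and the evaluation of Gauss sums -/

/-- The Kronecker symbol `(x|r)_K` of a residue class `x` modulo `r`, computed on its
representative in `[0, r)`. -/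
noncomputable def kron (r : ℕ) (x : ZMod r) : ℤ := AbelianGauge.kronecker x.val r

/-- The class by which the symmetric pairing is multiplied: a half for `r` odd, one for `r` even. -/
noncomputable def halfUnit (r : ℕ) : ZMod r := if Odd r then 2⁻¹ else 1

theorem kron_two_pow {k : ℕ} (x : ZMod (2 ^ k)) :
    kron (2 ^ k) x = ZMod.χ₈ ((x.val : ℤ) : ZMod 8) ^ k := by
  rw [kron, AbelianGauge.kronecker, Nat.prime_two.factorization_pow, Finsupp.single_eq_same,
    Nat.div_self (by positivity), jacobiSym.one_right, mul_one]

theorem kron_of_odd {r : ℕ} (hr : Odd r) (x : ZMod r) : kron r x = jacobiSym x.val r := by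
  have h : r.factorization 2 = 0 :=
    Nat.factorization_eq_zero_of_not_dvd fun h => (Nat.not_even_iff_odd.2 hr) (even_iff_two_dvd.2 h)
  rw [kron, AbelianGauge.kronecker, h, pow_zero, pow_zero, one_mul, Nat.div_one]

theorem kron_intCast_of_odd {r : ℕ} [NeZero r] (hr : Odd r) (j : ℤ) :
    kron r (j : ZMod r) = jacobiSym j r := by
  rw [kron_of_odd hr, ZMod.val_intCast, ← jacobiSym.mod_left]

theorem χ₈_sq_of_isUnit {x : ZMod 8} (h : IsUnit x) : ZMod.χ₈ x ^ 2 = 1 := by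
  revert x
  decide

theorem isUnit_cast_eight {k : ℕ} (hk : k ≠ 0) {x : ZMod (2 ^ k)} (hx : IsUnit x) :
    IsUnit (((x.val : ℤ) : ZMod 8)) := by
  rw [← ZMod.natCast_zmod_val x, ZMod.isUnit_iff_coprime] at hx
  rw [Int.cast_natCast, ZMod.isUnit_iff_coprime]
  have := Nat.Coprime.coprime_dvd_right (dvd_pow_self 2 hk) hx
  exact Nat.Coprime.pow_right 3 this

theorem kron_two_pow_of_even {k : ℕ} (hk : k ≠ 0) (he : Even k) {x : ZMod (2 ^ k)} (hx : IsUnit x) :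
    kron (2 ^ k) x = 1 := by
  obtain ⟨c, rfl⟩ := he.two_dvd
  rw [kron_two_pow, pow_mul, χ₈_sq_of_isUnit (isUnit_cast_eight hk hx), one_pow]

theorem kron_two_pow_of_odd {k : ℕ} (h8 : 8 ∣ 2 ^ k) (ho : Odd k) {x : ZMod (2 ^ k)}
    (hx : IsUnit x) : kron (2 ^ k) x = ZMod.χ₈ (ZMod.castHom h8 (ZMod 8) x) := by
  have h1 : ZMod.castHom h8 (ZMod 8) x = ((x.val : ℤ) : ZMod 8) := by
    conv_lhs => rw [← ZMod.natCast_zmod_val x]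
    rw [map_natCast, Int.cast_natCast]
  have h2 := χ₈_sq_of_isUnit (isUnit_cast_eight (fun h => by simp [h] at ho) hx)
  have h3 : ∀ z : ℤ, z ^ 2 = 1 → z ^ k = z := by
    obtain ⟨c, rfl⟩ := ho
    intro z hz
    rw [pow_succ, pow_mul, hz, one_pow, one_mul]
  rw [kron_two_pow, h1, h3 _ h2]

/-- For a prime power `r ≠ 2` the Kronecker symbol is trivial on units for even powers of `2`, is `χ₈`
for odd powers of `2`, which are divisible by `8`, and is a Jacobi symbol for odd `r`. -/
theorem kron_cases {r : ℕ} (hr : IsPrimePow r) (h2 : r ≠ 2) : (∃ k, k ≠ 0 ∧ Even k ∧ r = 2 ^ k) ∨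
    (∃ k, Odd k ∧ 8 ∣ 2 ^ k ∧ r = 2 ^ k) ∨ Odd r := by
  obtain ⟨p, k, hp, hk, rfl⟩ := (isPrimePow_nat_iff r).1 hr
  rcases hp.eq_two_or_odd' with rfl | ho
  · rcases Nat.even_or_odd k with h | h
    · exact Or.inl ⟨k, hk.ne', h, rfl⟩
    · refine Or.inr (Or.inl ⟨k, h, ?_, rfl⟩)
      have h3 : 3 ≤ k := by
        obtain ⟨c, rfl⟩ := h
        rcases c with _ | c
        · simp at h2
        · omega
      exact pow_dvd_pow 2 h3
  · exact Or.inr (Or.inr ho.pow)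

theorem kron_mul {r : ℕ} (hr : IsPrimePow r) (h2 : r ≠ 2)
    {x y : ZMod r} (hx : IsUnit x) (hy : IsUnit y) :
    kron r (x * y) = kron r x * kron r y := by
  rcases kron_cases hr h2 with ⟨k, hk, he, rfl⟩ | ⟨k, ho, h8, rfl⟩ | ho
  · rw [kron_two_pow_of_even hk he hx, kron_two_pow_of_even hk he hy,
      kron_two_pow_of_even hk he (hx.mul hy), one_mul]
  · rw [kron_two_pow_of_odd h8 ho hx, kron_two_pow_of_odd h8 ho hy,
      kron_two_pow_of_odd h8 ho (hx.mul hy), map_mul, map_mul]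
  · have : NeZero r := ⟨hr.pos.ne'⟩
    obtain ⟨a, rfl⟩ := ZMod.intCast_surjective x
    obtain ⟨b, rfl⟩ := ZMod.intCast_surjective y
    rw [← Int.cast_mul, kron_intCast_of_odd ho, kron_intCast_of_odd ho, kron_intCast_of_odd ho,
      jacobiSym.mul_left]

theorem kron_mul_self {r : ℕ} (hr : IsPrimePow r) (h2 : r ≠ 2)
    {x : ZMod r} (hx : IsUnit x) : kron r x * kron r x = 1 := by
  rcases kron_cases hr h2 with ⟨k, hk, he, rfl⟩ | ⟨k, ho, h8, rfl⟩ | ho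
  · rw [kron_two_pow_of_even hk he hx, one_mul]
  · rw [kron_two_pow_of_odd h8 ho hx, ← sq, χ₈_sq_of_isUnit (hx.map _)]
  · have : NeZero r := ⟨hr.pos.ne'⟩
    rw [← ZMod.natCast_zmod_val x, ZMod.isUnit_iff_coprime] at hx
    rw [kron_of_odd ho, ← sq, jacobiSym.sq_one]
    rw [Int.gcd_natCast_natCast]
    exact hx

theorem kron_neg_one {r : ℕ} (hr : IsPrimePow r) (h2 : r ≠ 2) :
    kron r (-1) = if r % 4 = 3 then -1 else 1 := by
  have hu : IsUnit (-1 : ZMod r) := isUnit_one.neg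
  rcases kron_cases hr h2 with ⟨k, hk, he, rfl⟩ | ⟨k, ho, h8, rfl⟩ | ho
  · have h : (2 ^ k) % 4 ≠ 3 := by
      have := dvd_pow_self 2 hk
      omega
    rw [kron_two_pow_of_even hk he hu, if_neg h]
  · have h : (2 ^ k) % 4 ≠ 3 := by
      have : 2 ∣ 2 ^ k := Dvd.dvd.trans (by norm_num) h8
      omega
    rw [kron_two_pow_of_odd h8 ho hu, if_neg h, map_neg, map_one]
    decide
  · have : NeZero r := ⟨hr.pos.ne'⟩
    have := kron_intCast_of_odd ho (-1)
    rw [Int.cast_neg, Int.cast_one] at this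
    rw [this, jacobiSym.at_neg_one ho, ZMod.χ₄_nat_eq_if_mod_four]
    have := Nat.odd_iff.1 ho
    rw [if_neg (by omega)]
    split_ifs <;> first | rfl | omega

theorem kron_mul_sq {r : ℕ} (hr : IsPrimePow r) (h2 : r ≠ 2)
    {x y : ZMod r} (hx : IsUnit x) (hy : IsUnit y) :
    kron r (x * y ^ 2) = kron r x := by
  rw [kron_mul hr h2 hx (hy.pow 2), sq, kron_mul hr h2 hy hy, kron_mul_self hr h2 hy, mul_one]

theorem isUnit_halfUnit {r : ℕ} : IsUnit (halfUnit r) := by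
  rw [halfUnit]
  split_ifs with h
  · have h3 : (2 : ZMod r) * 2⁻¹ = 1 := by
      have := ZMod.coe_mul_inv_eq_one (n := r) 2 (Nat.coprime_two_left.2 h)
      exact_mod_cast this
    exact IsUnit.of_mul_eq_one 2 (by rw [mul_comm, h3])
  · exact isUnit_one

/-- The Gauss sum of a quadratic form with unimodular polar form over `ℤ/r`, for a prime power
`r ≠ 2`. Its modulus is given by `norm_formSum`. For `r = p ^ k` its direction is trivial if `k` is
even, and is that of a sum of `p`-th roots of unity if `k` is odd. -/
theorem formSum_eq {r : ℕ} [NeZero r] (hr : IsPrimePow r) (h2 : r ≠ 2) {ι : Type} [Fintype ι]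
    [DecidableEq ι] (A : Matrix ι ι (ZMod r)) (hA : IsUnit (A + Aᵀ).det) :
    formSum ZMod.stdAddChar A = (√r ^ Fintype.card ι : ℝ) *
      ((if r % 4 = 3 then Complex.I else 1) ^ Fintype.card ι *
        kron r ((halfUnit r • (A + Aᵀ)).det)) := by
  have hS : IsUnit ((halfUnit r • (A + Aᵀ)).det) := by
    rw [det_smul]
    exact (isUnit_halfUnit.pow _).mul hA
  have hnorm := norm_formSum (ZMod.isPrimitive_stdAddChar r) A hA
  rw [ZMod.card] at hnorm
  rw [← hnorm]
  apply SameDir.eq_norm_mul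
  swap
  · have h3 : ‖((kron r ((halfUnit r • (A + Aᵀ)).det) : ℤ) : ℂ)‖ = 1 := by
      have h4 := kron_mul_self hr h2 hS
      have h5 := congrArg (fun z : ℤ => ‖(z : ℂ)‖) h4
      simp only [Int.cast_mul, norm_mul, Int.cast_one, norm_one] at h5
      nlinarith [norm_nonneg ((kron r ((halfUnit r • (A + Aᵀ)).det) : ℤ) : ℂ)]
    rw [norm_mul, h3, norm_pow, mul_one]
    split_ifs <;> simp
  obtain ⟨p, k, hp, hk, rfl⟩ := (isPrimePow_nat_iff r).1 hr
  have : Fact p.Prime := ⟨hp⟩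
  rcases hp.eq_two_or_odd' with rfl | ho
  -- for `p = 2` no halving is needed, and the phase `I` does not occur
  · have hodd : ¬ Odd (2 ^ k) := Nat.not_odd_iff_even.2 ((Nat.even_pow' hk.ne').2 even_two)
    have h4 : (2 ^ k) % 4 ≠ 3 := by
      have := dvd_pow_self 2 hk.ne'
      omega
    have hh : halfUnit (2 ^ k) = 1 := by rw [halfUnit, if_neg hodd]
    rw [if_neg h4, one_pow, one_mul, hh, one_smul]
    rcases Nat.even_or_odd k with he | ho
    · rw [kron_two_pow_of_even hk.ne' he hA]
      obtain ⟨c, hc⟩ := he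
      simpa using formSum_sameDir_one (t := 2 ^ c) (by rw [hc, pow_add]) A hA
    · have h8 : 8 ∣ 2 ^ k := by
        have h3 : 3 ≤ k := by
          obtain ⟨c, rfl⟩ := ho
          rcases c with _ | c
          · simp at h2
          · omega
        exact pow_dvd_pow 2 h3
      rw [kron_two_pow_of_odd h8 ho hA]
      obtain ⟨c, hc⟩ := ho
      refine (formSum_sameDir_formSum (p := 2) (t := 2 ^ c) (by rw [hc]; ring) A hA).trans ?_
      refine formSum_parityChar (dvd_pow_self 2 hk.ne') h8 (fun x hx => ?_) _ ι rfl A hA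
      rw [← ZMod.natCast_zmod_val x, map_natCast, Ne, ZMod.natCast_eq_zero_iff] at hx
      rw [← ZMod.natCast_zmod_val x, ZMod.isUnit_iff_coprime]
      exact ((Nat.prime_two.coprime_iff_not_dvd.2 hx).pow_left k).symm
  -- for `p` odd the symbol is a power of the Legendre symbol modulo `p`
  · have hp2 : p ≠ 2 := by
      rintro rfl
      exact absurd ho (by decide)
    have hor : Odd (p ^ k) := ho.pow
    have hkr : ∀ j : ℤ, kron (p ^ k) (j : ZMod (p ^ k)) = legendreSym p j ^ k := by
      intro j
      rw [kron_intCast_of_odd hor, jacobiSym.pow_right, jacobiSym.legendreSym.to_jacobiSym]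
    obtain ⟨j, hj⟩ := ZMod.intCast_surjective ((halfUnit (p ^ k) • (A + Aᵀ)).det)
    have hj1 : legendreSym p j ^ 2 = 1 := by
      have h5 := hS.map (ZMod.castHom (dvd_pow_self p hk.ne') (ZMod p))
      rw [← hj, map_intCast] at h5
      exact legendreSym.sq_one p h5.ne_zero
    rw [← hj, hkr]
    rcases Nat.even_or_odd k with he | hok
    · obtain ⟨c, hc⟩ := he
      have h4 : (p ^ k) % 4 ≠ 3 := by
        obtain ⟨d, hd⟩ := ho.pow (n := c)
        have : p ^ k = 4 * (d * d + d) + 1 := by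
          rw [hc, pow_add, hd]
          ring
        omega
      have h5 : legendreSym p j ^ k = 1 := by rw [hc, ← two_mul, pow_mul, hj1, one_pow]
      rw [if_neg h4, h5]
      simpa using formSum_sameDir_one (t := p ^ c) (by rw [hc, pow_add]) A hA
    · obtain ⟨c, hc⟩ := hok
      have h4 : (p ^ k) % 4 = p % 4 := by
        obtain ⟨d, hd⟩ := ho.pow (n := c)
        have : p ^ k = 4 * (p * (d * d + d)) + p := by
          rw [hc, pow_succ, two_mul, pow_add, hd]
          ring
        omega
      have hdvd : p ∣ p ^ k := dvd_pow_self p hk.ne'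
      set φ := ZMod.castHom hdvd (ZMod p) with hφ
      have hmap : A.map φ + (A.map φ)ᵀ = (A + Aᵀ).map φ := by
        ext i j
        simp
      have hA' : IsUnit (A.map φ + (A.map φ)ᵀ).det := by
        rw [hmap, ← RingHom.mapMatrix_apply, ← RingHom.map_det]
        exact hA.map φ
      have hjφ : (2 : ZMod p)⁻¹ ^ Fintype.card ι * (A.map φ + (A.map φ)ᵀ).det = (j : ZMod p) := by
        have h5 := congrArg φ hj
        rw [map_intCast] at h5
        rw [h5, det_smul, map_mul, map_pow, hmap, ← RingHom.mapMatrix_apply, ← RingHom.map_det]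
        congr 2
        have h6 : (2 : ZMod (p ^ k)) * halfUnit (p ^ k) = 1 := by
          rw [halfUnit, if_pos hor]
          have := ZMod.coe_mul_inv_eq_one (n := p ^ k) 2 (Nat.coprime_two_left.2 hor)
          exact_mod_cast this
        have h7 := congrArg φ h6
        rw [map_mul, map_one, map_ofNat] at h7
        exact inv_eq_of_mul_eq_one_right h7
      have h5 : legendreSym p j ^ k = legendreSym p j := by
        rw [hc, pow_succ, pow_mul, hj1, one_pow, one_mul]
      rw [h4, h5]
      refine (formSum_sameDir_formSum (p := p) (t := p ^ c) (by rw [hc]; ring) A hA).trans ?_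
      -- the remaining sum only depends on the vectors modulo `p`
      obtain ⟨n, hn, H⟩ := exists_sum_comp_eq (φ.toAddMonoidHom.compLeft ι)
      have h8 := H univ (fun w => ⟨fun _ => by
        choose v hv using fun i => ZMod.castHom_surjective hdvd (w i)
        exact ⟨v, funext hv⟩, fun _ => mem_univ _⟩)
        (fun w => ZMod.stdAddChar (w ⬝ᵥ A.map φ *ᵥ w))
      have h9 : formSum ((ZMod.stdAddChar (N := p)).compAddMonoidHom
        (ZMod.castHom hdvd (ZMod p) : ZMod (p ^ k) →+ ZMod p)) A =
          n * formSum ZMod.stdAddChar (A.map φ) := by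
        rw [formSum, formSum, ← h8]
        refine sum_congr rfl fun v _ => ?_
        change ZMod.stdAddChar (φ (v ⬝ᵥ A *ᵥ v)) =
          ZMod.stdAddChar ((φ ∘ v) ⬝ᵥ A.map φ *ᵥ (φ ∘ v))
        rw [RingHom.map_dotProduct]
        congr 2
        ext i
        exact RingHom.map_mulVec φ A v i
      rw [h9]
      refine (SameDir.natCast_mul hn _).trans ?_
      rw [formSum_prime p hp2 _ hA', det_smul, hjφ, mul_comm]
      have hp0 : (0 : ℝ) < √p := Real.sqrt_pos.2 (by exact_mod_cast hp.pos)
      exact (sameDir_pow_of_sq hp0 _).mul (SameDir.refl _)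

end QuadraticGauss

namespace AbelianGauge

/-! ### Lattices and Lagrangian subgroups over the integers -/

/-- A lattice contains its double dual. -/
theorem mem_of_mem_dualLattice_dualLattice {E : Type v} [NormedAddCommGroup E]
    [InnerProductSpace ℝ E] [FiniteDimensional ℝ E] (Λ : Submodule ℤ E) [DiscreteTopology Λ]
    [IsZLattice ℝ Λ] {x : E} (hx : x ∈ dualLattice (dualLattice Λ)) : x ∈ Λ := by
  have : Module.Finite ℤ Λ := ZLattice.module_finite ℝ Λ
  have : Module.Free ℤ Λ := ZLattice.module_free ℝ Λ
  have hd : ∀ N : Submodule ℤ E, LinearMap.BilinForm.dualSubmodule (innerₗ E) N = dualLattice N := by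
    intro N
    ext x
    rw [LinearMap.BilinForm.mem_dualSubmodule]
    change _ ↔ ∀ y ∈ N, ∃ z : ℤ, inner ℝ x y = (z : ℝ)
    refine forall₂_congr fun y _ => ?_
    rw [Submodule.mem_one]
    simp only [innerₗ_apply_apply, eq_intCast]
    exact exists_congr fun z => eq_comm
  have hnd : LinearMap.BilinForm.Nondegenerate (innerₗ E) := by
    refine ⟨fun x hx => ?_, fun x hx => ?_⟩
    · exact inner_self_eq_zero.1 (hx x)
    · exact inner_self_eq_zero.1 (hx x)
  have hs : LinearMap.BilinForm.IsSymm (innerₗ E) := ⟨fun x y => real_inner_comm _ _⟩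
  have h := LinearMap.BilinForm.dualSubmodule_dualSubmodule_of_basis (R := ℤ) (innerₗ E) hnd hs
    ((Module.Free.chooseBasis ℤ Λ).ofZLatticeBasis ℝ Λ)
  rw [Module.Basis.ofZLatticeBasis_span ℝ Λ, hd, hd] at h
  rwa [h] at hx

namespace Background

variable (D : Background.{u, v})

theorem moduleFinite_Λd : Module.Finite ℤ D.Λd := by
  obtain ⟨e⟩ := D.discriminant
  have : Finite (D.Λd ⧸ D.Λ.submoduleOf (dualLattice D.Λ)) := Finite.of_equiv _ e.symm.toEquiv
  have : Module.Finite ℤ D.Λ := ZLattice.module_finite ℝ D.Λ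
  have : Module.Finite ℤ (D.Λ.submoduleOf (dualLattice D.Λ)) :=
    Module.Finite.equiv (Submodule.submoduleOfEquivOfLe D.integral).symm
  exact Module.Finite.of_submodule_quotient (D.Λ.submoduleOf (dualLattice D.Λ))

/-- Coordinates on the dual lattice which lift the isomorphism of the discriminant group with
`(ℤ/r) ^ m`: the functionals `d a` and the vectors `lam a` are dual to each other modulo `r`, and
the lattice is the common kernel of the functionals modulo `r`. -/
structure Coordinates where
  d : Fin D.m → D.Λd →ₗ[ℤ] ℤ
  lam : Fin D.m → D.Λd
  mem_iff : ∀ x : D.Λd, (x : D.E) ∈ D.Λ ↔ ∀ a, (D.r : ℤ) ∣ d a x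
  d_lam : ∀ a b, (D.r : ℤ) ∣ d a (lam b) - if a = b then 1 else 0

/-- The dual lattice is free, so the components of its projection to `(ℤ/r) ^ m` lift to integral
functionals. -/
theorem nonempty_coordinates : Nonempty D.Coordinates := by
  obtain ⟨e⟩ := D.discriminant
  have := D.moduleFinite_Λd
  have : Module.IsTorsionFree ℤ D.E := .of_smul_eq_zero fun k x hkx => by
    rw [← Int.cast_smul_eq_zsmul ℝ, smul_eq_zero, Int.cast_eq_zero] at hkx
    exact hkx
  have : Module.Free ℤ D.Λd := inferInstance
  let e' : (D.Λd ⧸ D.Λ.submoduleOf (dualLattice D.Λ)) →ₗ[ℤ] (Fin D.m → ZMod D.r) :=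
    e.toAddMonoidHom.toIntLinearMap
  let g : D.Λd →ₗ[ℤ] (Fin D.m → ZMod D.r) := e' ∘ₗ Submodule.mkQ _
  have hg : Function.Surjective g := fun y => by
    obtain ⟨x, hx⟩ := Submodule.mkQ_surjective _ (e.symm y)
    exact ⟨x, by change e (Submodule.mkQ _ x) = y; rw [hx, AddEquiv.apply_symm_apply]⟩
  let c : ℤ →ₗ[ℤ] ZMod D.r := (Int.castAddHom (ZMod D.r)).toIntLinearMap
  have hc : Function.Surjective c := ZMod.intCast_surjective
  have hd : ∀ a, ∃ d : D.Λd →ₗ[ℤ] ℤ, c ∘ₗ d = LinearMap.proj a ∘ₗ g := fun a =>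
    Module.projective_lifting_property c (LinearMap.proj a ∘ₗ g) hc
  choose d hd using hd
  choose lam hlam using fun a : Fin D.m => hg (Pi.single a 1)
  have hd' : ∀ a x, ((d a x : ℤ) : ZMod D.r) = g x a := fun a x => LinearMap.congr_fun (hd a) x
  refine ⟨⟨d, lam, fun x => ?_, fun a b => ?_⟩⟩
  · have h1 : (x : D.E) ∈ D.Λ ↔ g x = 0 := by
      change x ∈ D.Λ.submoduleOf (dualLattice D.Λ) ↔ e (Submodule.mkQ _ x) = 0
      rw [EmbeddingLike.map_eq_zero_iff, ← LinearMap.mem_ker, Submodule.ker_mkQ]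
    rw [h1, funext_iff]
    refine forall_congr' fun a => ?_
    rw [← hd', ← ZMod.intCast_zmod_eq_zero_iff_dvd]
    rfl
  · rw [← ZMod.intCast_zmod_eq_zero_iff_dvd, Int.cast_sub, hd', hlam, Pi.single_apply]
    split_ifs <;> simp

variable {D}

section Lagrangian

variable {L' : Submodule ℤ D.H}

/-- A Lagrangian subgroup of `H` is saturated, since it is its own orthogonal. -/
theorem IsLagrangian.mem_of_zsmul_mem (hL : D.IsLagrangian L') {k : ℤ} (hk : k ≠ 0) {x : D.H}
    (hx : k • x ∈ L') : x ∈ L' := by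
  refine hL.2 x fun y hy => ?_
  have h := hL.1 _ hx y hy
  rw [map_smul, LinearMap.smul_apply, smul_eq_mul] at h
  exact (mul_eq_zero.1 h).resolve_left hk

theorem IsLagrangian.free_quotient (hL : D.IsLagrangian L') : Module.Free ℤ (D.H ⧸ L') := by
  have : Module.IsTorsionFree ℤ (D.H ⧸ L') := .of_smul_eq_zero fun k x hkx => by
    obtain ⟨x, rfl⟩ := L'.mkQ_surjective x
    rw [← map_smul, Submodule.mkQ_apply, Submodule.Quotient.mk_eq_zero] at hkx
    rw [Submodule.mkQ_apply, Submodule.Quotient.mk_eq_zero]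
    exact or_iff_not_imp_left.2 fun hk => hL.mem_of_zsmul_mem hk hkx
  infer_instance

/-- A Lagrangian subgroup of `H` is a direct summand, because the quotient is torsion free, hence
free. -/
theorem IsLagrangian.exists_projection (hL : D.IsLagrangian L') :
    ∃ p : D.H →ₗ[ℤ] L', ∀ x : L', p x = x := by
  have := hL.free_quotient
  obtain ⟨s, hs⟩ := Module.projective_lifting_property L'.mkQ LinearMap.id L'.mkQ_surjective
  have hs' : ∀ y, L'.mkQ (s y) = y := fun y => LinearMap.congr_fun hs y
  have hmem : ∀ x, (LinearMap.id - s ∘ₗ L'.mkQ : D.H →ₗ[ℤ] D.H) x ∈ L' := fun x => by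
    refine (Submodule.Quotient.mk_eq_zero L').1 ?_
    change L'.mkQ (x - s (L'.mkQ x)) = 0
    rw [map_sub, hs', sub_self]
  refine ⟨LinearMap.codRestrict L' (LinearMap.id - s ∘ₗ L'.mkQ) hmem, fun x => Subtype.ext ?_⟩
  have h0 : L'.mkQ (x : D.H) = 0 := by
    rw [← LinearMap.mem_ker, L'.ker_mkQ]
    exact x.2
  simp [h0]

theorem IsLagrangian.exists_cup_eq (hL : D.IsLagrangian L') (f : L' →ₗ[ℤ] ℤ) :
    ∃ h : D.H, ∀ x : L', D.cup h x = f x := by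
  obtain ⟨p, hp⟩ := hL.exists_projection
  obtain ⟨h, hh⟩ := D.cup_unimodular.2 (f ∘ₗ p)
  exact ⟨h, fun x => by rw [hh, LinearMap.comp_apply, hp]⟩

/-- A Lagrangian subgroup has half the rank: `H ⧸ L'` is dual to `L'`. -/
theorem IsLagrangian.finrank_eq (hL : D.IsLagrangian L') :
    Module.finrank ℤ D.H = 2 * Module.finrank ℤ L' := by
  let g : D.H →ₗ[ℤ] Module.Dual ℤ L' := (LinearMap.lcomp ℤ ℤ L'.subtype) ∘ₗ D.cup
  have hg : Function.Surjective g := fun f => by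
    obtain ⟨h, hh⟩ := hL.exists_cup_eq f
    exact ⟨h, LinearMap.ext fun x => hh x⟩
  have hker : LinearMap.ker g = L' := by
    ext x
    rw [LinearMap.mem_ker]
    constructor
    · intro h
      exact hL.2 x fun y hy => LinearMap.congr_fun h ⟨y, hy⟩
    · intro hx
      exact LinearMap.ext fun y => hL.1 x hx y y.2
  have h1 := (g.quotKerEquivOfSurjective hg).finrank_eq
  rw [hker, Module.finrank_linearMap_self] at h1
  rw [← Submodule.finrank_quotient_add_finrank L', h1, two_mul]

/-- An element that pairs with a Lagrangian subgroup to multiples of `k` lies in it modulo `k`. -/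
theorem IsLagrangian.exists_eq_add_zsmul (hL : D.IsLagrangian L') {k : ℤ} {x : D.H}
    (hx : ∀ y ∈ L', k ∣ D.cup x y) : ∃ l ∈ L', ∃ h : D.H, x = l + k • h := by
  let f : L' →ₗ[ℤ] ℤ :=
    { toFun := fun y => D.cup x y / k
      map_add' := fun y z => by
        rw [Submodule.coe_add, map_add, Int.add_ediv_of_dvd_left (hx y y.2)]
      map_smul' := fun c y => by
        rw [Submodule.coe_smul, map_smul, smul_eq_mul, Int.mul_ediv_assoc _ (hx y y.2)]
        rfl }
  obtain ⟨h, hh⟩ := hL.exists_cup_eq f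
  refine ⟨x - k • h, hL.2 _ fun y hy => ?_, h, by abel⟩
  have h1 : D.cup h y = D.cup x y / k := hh ⟨y, hy⟩
  rw [map_sub, LinearMap.sub_apply, map_smul, LinearMap.smul_apply, h1, smul_eq_mul,
    Int.mul_ediv_cancel' (hx y hy), sub_self]

end Lagrangian

/-! ### Coordinates on the finite groups -/

namespace Coordinates

variable (C : D.Coordinates)

/-- The coordinate `h ⊗ x ↦ d a x • h` of an element of `H ⊗ Λ*`. -/
def coord (a : Fin D.m) : D.T →ₗ[ℤ] D.H :=
  (TensorProduct.rid ℤ D.H).toLinearMap ∘ₗ LinearMap.lTensor D.H (C.d a)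

theorem coord_tmul (a : Fin D.m) (h : D.H) (x : D.Λd) : C.coord a (h ⊗ₜ x) = C.d a x • h := by
  change TensorProduct.rid ℤ D.H (h ⊗ₜ C.d a x) = _
  rw [TensorProduct.rid_tmul]

theorem tmul_mem_N (h : D.H) {x : D.Λd} (hx : (x : D.E) ∈ D.Λ) : (h ⊗ₜ x : D.T) ∈ D.N :=
  ⟨h ⊗ₜ (⟨x, hx⟩ : D.Λ), rfl⟩

theorem zsmul_mem_N (t : D.T) : (D.r : ℤ) • t ∈ D.N := by
  have h := D.nsmul_r_eq_zero (QuotientAddGroup.mk t)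
  rw [← QuotientAddGroup.mk_nsmul, QuotientAddGroup.eq_zero_iff] at h
  rwa [natCast_zsmul]

theorem coord_mem (a : Fin D.m) {L' : Submodule ℤ D.H} {t : D.T} (ht : t ∈ D.tensorSub L') :
    C.coord a t ∈ L' := by
  obtain ⟨w, rfl⟩ := ht
  induction w using TensorProduct.induction_on with
  | zero => rw [map_zero, map_zero]; exact L'.zero_mem
  | add x y hx hy => rw [map_add, map_add]; exact L'.add_mem hx hy
  | tmul l x =>
    change C.coord a ((l : D.H) ⊗ₜ x) ∈ L'
    rw [coord_tmul]
    exact L'.smul_mem _ l.2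

theorem exists_coord_eq (a : Fin D.m) {t : D.T} (ht : t ∈ D.N) :
    ∃ h, C.coord a t = (D.r : ℤ) • h := by
  obtain ⟨w, rfl⟩ := ht
  induction w using TensorProduct.induction_on with
  | zero => exact ⟨0, by rw [map_zero, map_zero, smul_zero]⟩
  | add x y hx hy =>
    obtain ⟨h, hh⟩ := hx
    obtain ⟨h', hh'⟩ := hy
    exact ⟨h + h', by rw [map_add, map_add, hh, hh', smul_add]⟩
  | tmul h x =>
    obtain ⟨z, hz⟩ := (C.mem_iff (Submodule.inclusion D.integral x)).1 x.2 a
    refine ⟨z • h, ?_⟩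
    change C.coord a (h ⊗ₜ Submodule.inclusion D.integral x) = _
    rw [coord_tmul, hz, mul_smul]

theorem exists_coord_eq_of_mem_twoN (a : Fin D.m) {t : D.T} (ht : t ∈ D.twoN) :
    ∃ h, C.coord a t = (2 * D.r : ℤ) • h := by
  obtain ⟨w, hw, rfl⟩ := ht
  obtain ⟨h, hh⟩ := C.exists_coord_eq a hw
  refine ⟨h, ?_⟩
  rw [nsmulAddMonoidHom_apply, map_nsmul, hh, mul_smul, ← natCast_zsmul]
  rfl

theorem sub_sum_coord_mem_N (t : D.T) : t - ∑ a, C.coord a t ⊗ₜ C.lam a ∈ D.N := by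
  induction t using TensorProduct.induction_on with
  | zero => simp [D.N.zero_mem]
  | add x y hx hy =>
    have h := D.N.add_mem hx hy
    simp only [map_add, TensorProduct.add_tmul, Finset.sum_add_distrib]
    convert h using 1
    abel
  | tmul h x =>
    have h1 : (h ⊗ₜ x : D.T) - ∑ a, C.coord a (h ⊗ₜ x) ⊗ₜ C.lam a =
        h ⊗ₜ (x - ∑ a, C.d a x • C.lam a) := by
      rw [TensorProduct.tmul_sub, TensorProduct.tmul_sum]
      simp_rw [coord_tmul, TensorProduct.smul_tmul]
    rw [h1]
    refine tmul_mem_N h ((C.mem_iff _).2 fun b => ?_)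
    rw [map_sub, map_sum]
    have h2 : ∀ a, C.d b (C.d a x • C.lam a) = (if b = a then C.d a x else 0) +
        C.d a x * (C.d b (C.lam a) - if b = a then 1 else 0) := fun a => by
      rw [map_smul, smul_eq_mul]
      split_ifs <;> ring
    simp_rw [h2, Finset.sum_add_distrib]
    rw [Finset.sum_ite_eq, if_pos (Finset.mem_univ b), sub_add_cancel_left, dvd_neg]
    exact Finset.dvd_sum fun a _ => (C.d_lam b a).mul_left _

theorem exists_coord_sum_eq (b : Fin D.m) (w : Fin D.m → D.H) :
    ∃ h, C.coord b (∑ a, w a ⊗ₜ C.lam a) = w b + (D.r : ℤ) • h := by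
  choose z hz using fun a => C.d_lam b a
  refine ⟨∑ a, z a • w a, ?_⟩
  rw [map_sum]
  have h2 : ∀ a, C.coord b (w a ⊗ₜ C.lam a) = (if b = a then w a else 0) +
      (D.r : ℤ) • z a • w a := fun a => by
    rw [coord_tmul, smul_smul, ← hz, sub_smul]
    split_ifs <;> simp
  simp_rw [h2, Finset.sum_add_distrib, Finset.smul_sum]
  rw [Finset.sum_ite_eq, if_pos (Finset.mem_univ b)]

theorem tmul_mem_tensorSub {L' : Submodule ℤ D.H} {l : D.H} (hl : l ∈ L') (x : D.Λd) :
    (l ⊗ₜ x : D.T) ∈ D.tensorSub L' :=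
  ⟨(⟨l, hl⟩ : L') ⊗ₜ x, rfl⟩

/-- An element lies in the image of `L' ⊗ Λ*` in `G` when its coordinates lie in `L'` modulo `r`. -/
theorem mem_lag_iff {L' : Submodule ℤ D.H} (t : D.T) :
    (QuotientAddGroup.mk t : D.G) ∈ D.lag L' ↔
      ∀ a, ∃ l ∈ L', ∃ h, C.coord a t = l + (D.r : ℤ) • h := by
  constructor
  · rintro ⟨s, hs, hst⟩ a
    have h1 : -s + t ∈ D.N := QuotientAddGroup.eq.1 hst
    obtain ⟨h, hh⟩ := C.exists_coord_eq a h1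
    refine ⟨C.coord a s, C.coord_mem a hs, h, ?_⟩
    rw [← hh, map_add, map_neg]
    abel
  · intro H
    choose l hl h hh using H
    refine ⟨∑ a, l a ⊗ₜ C.lam a, AddSubgroup.sum_mem _ fun a _ => tmul_mem_tensorSub (hl a) _, ?_⟩
    refine QuotientAddGroup.eq.2 ?_
    have h1 := C.sub_sum_coord_mem_N t
    have h2 : (D.r : ℤ) • ∑ a, h a ⊗ₜ C.lam a ∈ D.N := zsmul_mem_N _
    convert D.N.add_mem h1 h2 using 1
    simp_rw [hh, TensorProduct.add_tmul, Finset.sum_add_distrib, Finset.smul_sum,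
      TensorProduct.smul_tmul']
    abel

/-- The coordinates of an element of the image of `L' ⊗ Λ*` in `G_{2Λ}` lie in `L'` modulo `2r`. -/
theorem exists_of_mem_lag₂ {L' : Submodule ℤ D.H} {t : D.T}
    (ht : (QuotientAddGroup.mk t : D.G₂) ∈ D.lag₂ L') (a : Fin D.m) :
    ∃ l ∈ L', ∃ h, C.coord a t = l + (2 * D.r : ℤ) • h := by
  obtain ⟨s, hs, hst⟩ := ht
  have h1 : -s + t ∈ D.twoN := QuotientAddGroup.eq.1 hst
  obtain ⟨h, hh⟩ := C.exists_coord_eq_of_mem_twoN a h1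
  refine ⟨C.coord a s, C.coord_mem a hs, h, ?_⟩
  rw [← hh, map_add, map_neg]
  abel

/-- Integrality of the pairing with `l ⊗ Λ*` is a condition on the coordinates, because the lattice
is its own double dual. -/
theorem dvd_cup_coord {t : D.T} {l : D.H} (ht : ∀ x : D.Λd, ∃ z : ℤ, D.pair t (l ⊗ₜ x) = z)
    (b : Fin D.m) : (D.r : ℤ) ∣ D.cup (C.coord b t) l := by
  set y : D.Λd := ∑ a, D.cup (C.coord a t) l • C.lam a with hy
  have h1 : (y : D.E) ∈ D.Λ := by
    refine mem_of_mem_dualLattice_dualLattice D.Λ fun x hx => ?_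
    obtain ⟨z, hz⟩ := ht ⟨x, hx⟩
    obtain ⟨z', hz'⟩ := D.pair_N_left _ (l ⊗ₜ ⟨x, hx⟩) (C.sub_sum_coord_mem_N t)
    refine ⟨z - z', ?_⟩
    rw [map_sub, AddMonoidHom.sub_apply, hz, map_sum, AddMonoidHom.finsetSum_apply] at hz'
    simp_rw [pair_tmul] at hz'
    have h2 : (y : D.E) = ∑ a, (D.cup (C.coord a t) l : ℝ) • (C.lam a : D.E) := by
      rw [hy]
      push_cast
      simp_rw [Int.cast_smul_eq_zsmul]
    rw [h2, sum_inner]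
    simp_rw [real_inner_smul_left]
    push_cast
    linarith
  have h2 := (C.mem_iff y).1 h1 b
  have h3 : C.d b y = D.cup (C.coord b t) l + ∑ a, D.cup (C.coord a t) l *
      (C.d b (C.lam a) - if b = a then 1 else 0) := by
    rw [hy, map_sum]
    have h4 : ∀ a, C.d b (D.cup (C.coord a t) l • C.lam a) =
        (if b = a then D.cup (C.coord a t) l else 0) + D.cup (C.coord a t) l *
          (C.d b (C.lam a) - if b = a then 1 else 0) := fun a => by
      rw [map_smul, smul_eq_mul]
      split_ifs <;> ring
    simp_rw [h4, Finset.sum_add_distrib]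
    rw [Finset.sum_ite_eq, if_pos (Finset.mem_univ b)]
  rw [h3] at h2
  exact (dvd_add_left (Finset.dvd_sum fun a _ => (C.d_lam b a).mul_left _)).1 h2

end Coordinates

/-! ### The pairing with values in `ℤ/r` -/

theorem B_mk (x y : D.T) : D.B (QuotientAddGroup.mk x) (QuotientAddGroup.mk y) =
    Complex.exp (2 * Real.pi * Complex.I * (D.pair x y : ℝ)) := rfl

theorem ψ_mk (x y : D.T) : D.ψ (QuotientAddGroup.mk x) (QuotientAddGroup.mk y) =
    Complex.exp (Real.pi * Complex.I * (D.pair x y : ℝ)) := rfl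

theorem B_add_left (x y z : D.G) : D.B (x + y) z = D.B x z * D.B y z := by
  obtain ⟨x, rfl⟩ := QuotientAddGroup.mk_surjective x
  obtain ⟨y, rfl⟩ := QuotientAddGroup.mk_surjective y
  obtain ⟨z, rfl⟩ := QuotientAddGroup.mk_surjective z
  rw [← QuotientAddGroup.mk_add, B_mk, B_mk, B_mk, ← Complex.exp_add, map_add,
    AddMonoidHom.add_apply]
  congr 1
  push_cast
  ring

theorem B_antisymm (x y : D.G) : D.B x y = (D.B y x)⁻¹ := by
  obtain ⟨x, rfl⟩ := QuotientAddGroup.mk_surjective x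
  obtain ⟨y, rfl⟩ := QuotientAddGroup.mk_surjective y
  rw [B_mk, B_mk, ← Complex.exp_neg, pair_antisymm]
  congr 1
  push_cast
  ring

theorem B_add_right (x y z : D.G) : D.B x (y + z) = D.B x y * D.B x z := by
  rw [B_antisymm, B_add_left, mul_inv, ← B_antisymm, ← B_antisymm]

theorem B_self (x : D.G) : D.B x x = 1 := by
  obtain ⟨x, rfl⟩ := QuotientAddGroup.mk_surjective x
  have h : D.pair x x = 0 := by
    have := D.pair_antisymm x x
    linarith
  rw [B_mk, h]
  simp

theorem B_zero_left (x : D.G) : D.B 0 x = 1 := by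
  have h := B_add_left 0 0 x
  rw [add_zero] at h
  exact (mul_eq_left₀ (by
    obtain ⟨x, rfl⟩ := QuotientAddGroup.mk_surjective x
    exact Complex.exp_ne_zero _)).1 h.symm

theorem B_nsmul_left (n : ℕ) (x y : D.G) : D.B (n • x) y = D.B x y ^ n := by
  induction n with
  | zero => rw [zero_smul, B_zero_left, pow_zero]
  | succ n ih => rw [succ_nsmul, B_add_left, ih, pow_succ]

theorem stdAddChar_logB (x y : D.G) : ZMod.stdAddChar (D.logB x y) = D.B x y := by
  refine Function.invFun_eq (f := ZMod.stdAddChar (N := D.r)) ?_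
  have h1 : D.B x y ^ D.r = 1 := by rw [← B_nsmul_left, nsmul_r_eq_zero, B_zero_left]
  obtain ⟨j, -, hj⟩ := (Complex.isPrimitiveRoot_exp D.r (NeZero.ne D.r)).eq_pow_of_pow_eq_one h1
  refine ⟨(j : ℤ), ?_⟩
  rw [ZMod.stdAddChar_coe, ← hj, ← Complex.exp_nat_mul]
  congr 1
  push_cast
  ring

theorem logB_add_left (x y z : D.G) : D.logB (x + y) z = D.logB x z + D.logB y z := by
  apply ZMod.injective_stdAddChar
  rw [AddChar.map_add_eq_mul, stdAddChar_logB, stdAddChar_logB, stdAddChar_logB, B_add_left]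

theorem logB_add_right (x y z : D.G) : D.logB x (y + z) = D.logB x y + D.logB x z := by
  apply ZMod.injective_stdAddChar
  rw [AddChar.map_add_eq_mul, stdAddChar_logB, stdAddChar_logB, stdAddChar_logB, B_add_right]

variable (D) in
/-- The pairing `(r / 2πi) ln B`, as a bilinear form over `ℤ/r`. -/
def form : LinearMap.BilinForm (ZMod D.r) D.G :=
  LinearMap.mk₂ (ZMod D.r) D.logB logB_add_left
    (fun c x y => ZMod.map_smul (AddMonoidHom.mk' (fun x => D.logB x y)
      (fun x z => logB_add_left x z y)) c x)
    logB_add_right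
    (fun c x y => ZMod.map_smul (AddMonoidHom.mk' (fun y => D.logB x y) (logB_add_right x)) c y)

theorem stdAddChar_form (x y : D.G) : ZMod.stdAddChar (D.form x y) = D.B x y :=
  stdAddChar_logB x y

theorem form_eq_zero_iff (x y : D.G) : D.form x y = 0 ↔ D.B x y = 1 := by
  rw [← stdAddChar_form, ← ZMod.injective_stdAddChar.eq_iff, AddChar.map_zero_eq_one]

theorem form_self (x : D.G) : D.form x x = 0 := by rw [form_eq_zero_iff, B_self]

theorem form_antisymm (x y : D.G) : D.form x y = -D.form y x := by
  have h := form_self (x + y)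
  simp only [map_add, LinearMap.add_apply, form_self] at h
  linear_combination h

theorem exists_pair_eq_of_B_eq_one {t s : D.T}
    (h : D.B (QuotientAddGroup.mk t) (QuotientAddGroup.mk s) = 1) : ∃ z : ℤ, D.pair t s = z := by
  rw [B_mk, Complex.exp_eq_one_iff] at h
  obtain ⟨z, hz⟩ := h
  refine ⟨z, ?_⟩
  have h1 : (2 * Real.pi * Complex.I) ≠ 0 := Complex.two_pi_I_ne_zero
  have h2 := mul_left_cancel₀ h1 (hz.trans (mul_comm _ _))
  exact_mod_cast h2

/-- The pairing of `G` is nondegenerate, by unimodularity of the cup product and `dvd_cup_coord`. -/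
theorem form_nondegenerate {x : D.G} (hx : ∀ y, D.form x y = 0) : x = 0 := by
  obtain ⟨C⟩ := D.nonempty_coordinates
  obtain ⟨t, rfl⟩ := QuotientAddGroup.mk_surjective x
  have h1 : ∀ a l, (D.r : ℤ) ∣ D.cup (C.coord a t) l := fun a l =>
    C.dvd_cup_coord (fun x => exists_pair_eq_of_B_eq_one ((form_eq_zero_iff _ _).1 (hx _))) a
  have h2 : (QuotientAddGroup.mk t : D.G) ∈ D.lag ⊥ := (C.mem_lag_iff t).2 fun a => by
    refine ⟨0, zero_mem _, ?_⟩
    let f : D.H →ₗ[ℤ] ℤ :=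
      { toFun := fun y => D.cup (C.coord a t) y / D.r
        map_add' := fun y z => by rw [map_add, Int.add_ediv_of_dvd_left (h1 a y)]
        map_smul' := fun c y => by
          rw [map_smul, smul_eq_mul, Int.mul_ediv_assoc _ (h1 a y)]
          rfl }
    obtain ⟨h, hh⟩ := D.cup_unimodular.2 f
    refine ⟨h, D.cup_unimodular.1 ?_⟩
    rw [zero_add, map_smul, hh]
    ext y
    exact (Int.mul_ediv_cancel' (h1 a y)).symm
  obtain ⟨s, ⟨w, rfl⟩, hs⟩ := h2
  rw [← hs]
  have h3 : ∀ w : (⊥ : Submodule ℤ D.H) ⊗[ℤ] D.Λd, w = 0 := fun w => by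
    induction w using TensorProduct.induction_on with
    | zero => rfl
    | tmul x y => rw [Subsingleton.elim x 0, TensorProduct.zero_tmul]
    | add x y hx hy => rw [hx, hy, add_zero]
  rw [h3 w, map_zero, map_zero]

/-! ### Lagrangian subgroups of `G` -/

section Lagrangian

variable {L' : Submodule ℤ D.H}

theorem pair_eq_zero_of_mem (hL : D.IsLagrangian L') {t s : D.T} (ht : t ∈ D.tensorSub L')
    (hs : s ∈ D.tensorSub L') : D.pair t s = 0 := by
  obtain ⟨w, rfl⟩ := ht
  obtain ⟨z, rfl⟩ := hs
  induction w using TensorProduct.induction_on with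
  | zero => rw [map_zero, map_zero, AddMonoidHom.zero_apply]
  | add a b ha hb => rw [map_add, map_add, AddMonoidHom.add_apply, ha, hb, add_zero]
  | tmul l x =>
    induction z using TensorProduct.induction_on with
    | zero => rw [map_zero, map_zero]
    | add a b ha hb => rw [map_add, map_add, ha, hb, add_zero]
    | tmul l' x' =>
      change D.pair ((l : D.H) ⊗ₜ x) ((l' : D.H) ⊗ₜ x') = 0
      rw [pair_tmul, hL.1 _ l.2 _ l'.2, Int.cast_zero, zero_mul]

theorem IsLagrangian.form_eq_zero (hL : D.IsLagrangian L') {x y : D.G} (hx : x ∈ D.lag L')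
    (hy : y ∈ D.lag L') : D.form x y = 0 := by
  obtain ⟨t, ht, rfl⟩ := hx
  obtain ⟨s, hs, rfl⟩ := hy
  rw [form_eq_zero_iff]
  refine (B_mk t s).trans ?_
  rw [pair_eq_zero_of_mem hL ht hs]
  simp

/-- The image of a Lagrangian subgroup in `G` contains its orthogonal. -/
theorem IsLagrangian.mem_lag (hL : D.IsLagrangian L') {x : D.G}
    (hx : ∀ y ∈ D.lag L', D.form x y = 0) : x ∈ D.lag L' := by
  obtain ⟨C⟩ := D.nonempty_coordinates
  obtain ⟨t, rfl⟩ := QuotientAddGroup.mk_surjective x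
  refine (C.mem_lag_iff t).2 fun a => hL.exists_eq_add_zsmul fun l hl => ?_
  exact C.dvd_cup_coord (fun x => exists_pair_eq_of_B_eq_one ((form_eq_zero_iff _ _).1
    (hx _ ⟨_, Coordinates.tmul_mem_tensorSub hl x, rfl⟩))) a

theorem ψ_eq_one_of_mem (hL : D.IsLagrangian L') {x y : D.G₂} (hx : x ∈ D.lag₂ L')
    (hy : y ∈ D.lag₂ L') : D.ψ x y = 1 := by
  obtain ⟨t, ht, rfl⟩ := hx
  obtain ⟨s, hs, rfl⟩ := hy
  refine (ψ_mk t s).trans ?_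
  rw [pair_eq_zero_of_mem hL ht hs]
  simp

/-- A Lagrangian subgroup of `G` is free over `ℤ/r`, of rank `n`. -/
theorem IsLagrangian.nonempty_basis (hL : D.IsLagrangian L') :
    Nonempty (Module.Basis (Fin D.n) (ZMod D.r) (D.lag L')) := by
  obtain ⟨C⟩ := D.nonempty_coordinates
  let b := Module.finBasis ℤ L'
  let x : Fin (Module.finrank ℤ L') × Fin D.m → D.lag L' := fun i =>
    ⟨QuotientAddGroup.mk ((b i.1 : D.H) ⊗ₜ C.lam i.2),
      ⟨_, Coordinates.tmul_mem_tensorSub (b i.1).2 _, rfl⟩⟩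
  have hr : (D.r : ℤ) ≠ 0 := Int.natCast_ne_zero.2 (NeZero.ne D.r)
  have hsum : ∀ z : Fin (Module.finrank ℤ L') × Fin D.m → ℤ,
      ((∑ i, (z i : ZMod D.r) • x i : D.lag L') : D.G) =
        QuotientAddGroup.mk (∑ a, (∑ i, z (i, a) • (b i : D.H)) ⊗ₜ C.lam a) := by
    intro z
    rw [Fintype.sum_prod_type, Finset.sum_comm, Submodule.coe_sum, ← QuotientAddGroup.mk'_apply,
      map_sum]
    refine Finset.sum_congr rfl fun a _ => ?_
    rw [Submodule.coe_sum, TensorProduct.sum_tmul, map_sum]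
    refine Finset.sum_congr rfl fun i _ => ?_
    rw [Submodule.coe_smul, Int.cast_smul_eq_zsmul, ← TensorProduct.smul_tmul', map_zsmul]
    rfl
  have hli : LinearIndependent (ZMod D.r) x := by
    rw [Fintype.linearIndependent_iff]
    intro c hc i
    choose z hz using fun i => ZMod.intCast_surjective (c i)
    have h1 : (QuotientAddGroup.mk (∑ a, (∑ i, z (i, a) • (b i : D.H)) ⊗ₜ C.lam a) : D.G) = 0 := by
      rw [← hsum]
      simp_rw [hz]
      rw [hc]
      rfl
    obtain ⟨h, hh⟩ := C.exists_coord_eq i.2 ((QuotientAddGroup.eq_zero_iff _).1 h1)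
    obtain ⟨h', hh'⟩ := C.exists_coord_sum_eq i.2 (fun a => ∑ i, z (i, a) • (b i : D.H))
    have h2 : ∑ j, z (j, i.2) • (b j : D.H) = (D.r : ℤ) • (h - h') := by
      rw [smul_sub, ← hh, hh']
      abel
    -- `L'` is saturated, so that a relation modulo `r` can be divided by `r` inside `L'`
    have h3 : h - h' ∈ L' := by
      refine hL.mem_of_zsmul_mem hr ?_
      rw [← h2]
      exact L'.sum_mem fun j _ => L'.smul_mem _ (b j).2
    have h4 : ∑ j, z (j, i.2) • b j = (D.r : ℤ) • (⟨h - h', h3⟩ : L') := by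
      apply Subtype.ext
      rw [Submodule.coe_sum]
      simpa using h2
    have h5 := congrArg (fun y => b.repr y i.1) h4
    simp only [map_sum, map_smul, Module.Basis.repr_self, Finsupp.coe_finsetSum,
      Finset.sum_apply, Finsupp.smul_apply] at h5
    rw [← hz, show i = (i.1, i.2) from rfl, ZMod.intCast_zmod_eq_zero_iff_dvd]
    refine ⟨b.repr ⟨h - h', h3⟩ i.1, ?_⟩
    rw [smul_eq_mul] at h5
    rw [← h5, Finset.sum_eq_single i.1] <;> simp +contextual
  have hspan : ⊤ ≤ Submodule.span (ZMod D.r) (Set.range x) := by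
    rintro ⟨y, hy⟩ -
    obtain ⟨t, ht, rfl⟩ := hy
    let z : Fin (Module.finrank ℤ L') × Fin D.m → ℤ := fun i =>
      b.repr ⟨C.coord i.2 t, C.coord_mem i.2 ht⟩ i.1
    have h1 : ∀ a, ∑ i, z (i, a) • (b i : D.H) = C.coord a t := fun a => by
      have := congrArg Subtype.val (b.sum_repr ⟨C.coord a t, C.coord_mem a ht⟩)
      rw [Submodule.coe_sum] at this
      exact this
    have h2 : (⟨_, ⟨t, ht, rfl⟩⟩ : D.lag L') = ∑ i, (z i : ZMod D.r) • x i := by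
      apply Subtype.ext
      rw [hsum]
      simp_rw [h1]
      have h3 := C.sub_sum_coord_mem_N t
      rw [sub_eq_neg_add] at h3
      exact (QuotientAddGroup.eq.2 h3).symm
    rw [h2]
    exact Submodule.sum_mem _ fun i _ => Submodule.smul_mem _ _ (Submodule.subset_span ⟨i, rfl⟩)
  refine ⟨(Module.Basis.mk hli hspan).reindex (Fintype.equivOfCardEq ?_)⟩
  rw [Fintype.card_prod, Fintype.card_fin, Fintype.card_fin, Fintype.card_fin, n, hL.finrank_eq,
    Nat.mul_div_cancel_left _ two_pos]

end Lagrangian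

end Background

end AbelianGauge

namespace AbelianGauge

/-! ### Modules over `ℤ/r`, for a prime power `r` -/

theorem isUnit_zmod_primePow {p k : ℕ} (hp : p.Prime) (x : ZMod (p ^ k)) :
    IsUnit x ∨ ∃ y, x = (p : ZMod (p ^ k)) * y := by
  have : NeZero (p ^ k) := ⟨pow_ne_zero k hp.ne_zero⟩
  rw [← ZMod.natCast_zmod_val x]
  by_cases h : p ∣ x.val
  · obtain ⟨c, hc⟩ := h
    exact .inr ⟨c, by rw [hc, Nat.cast_mul]⟩
  · exact .inl ((ZMod.isUnit_iff_coprime _ _).2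
      (((Nat.Prime.coprime_iff_not_dvd hp).2 h).symm.pow_right k))

theorem not_isUnit_zmod_primePow {p k : ℕ} (hp : p.Prime) (hk : k ≠ 0) (y : ZMod (p ^ k)) :
    ¬ IsUnit ((p : ZMod (p ^ k)) * y) := fun h => by
  have h1 : IsUnit ((p : ℕ) : ZMod (p ^ k)) := isUnit_of_mul_isUnit_left h
  rw [ZMod.isUnit_iff_coprime, Nat.coprime_pow_right_iff (Nat.pos_of_ne_zero hk),
    Nat.coprime_self] at h1
  exact hp.one_lt.ne' h1

theorem isLocalRing_zmod {r : ℕ} (hr : IsPrimePow r) : IsLocalRing (ZMod r) := by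
  obtain ⟨p, k, hp, hk, rfl⟩ := (isPrimePow_nat_iff r).1 hr
  have : Nontrivial (ZMod (p ^ k)) := ZMod.nontrivial_iff.2 hr.ne_one
  refine IsLocalRing.of_isUnit_or_isUnit_one_sub_self fun x => ?_
  by_contra! h
  obtain ⟨y, hy⟩ := (isUnit_zmod_primePow hp _).resolve_left h.1
  obtain ⟨z, hz⟩ := (isUnit_zmod_primePow hp _).resolve_left h.2
  refine not_isUnit_zmod_primePow hp hk.ne' (y + z) ?_
  rw [mul_add, ← hy, ← hz, add_sub_cancel]
  exact isUnit_one

/-- A finite module over `ℤ/p^k` is free as soon as all its elements of order less than `p ^ k` are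
divisible by `p`. -/
theorem free_zmod_of_forall_exists_nsmul {r p k : ℕ} (hr : r = p ^ k) (hp : p.Prime) (hk : k ≠ 0)
    {M : Type*} [AddCommGroup M] [Module (ZMod r) M] [Finite M]
    (h : ∀ x : M, ∀ j < k, p ^ j • x = 0 → ∃ y, x = p • y) : Module.Free (ZMod r) M := by
  subst hr
  have : NeZero (p ^ k) := ⟨pow_ne_zero k hp.ne_zero⟩
  have : IsLocalRing (ZMod (p ^ k)) :=
    isLocalRing_zmod ((isPrimePow_nat_iff _).2 ⟨p, k, hp, Nat.pos_of_ne_zero hk, rfl⟩)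
  have hmem : ∀ x, x ∈ IsLocalRing.maximalIdeal (ZMod (p ^ k)) ↔
      ∃ y, x = (p : ZMod (p ^ k)) * y := fun x => by
    rw [IsLocalRing.mem_maximalIdeal, mem_nonunits_iff]
    refine ⟨fun hx => (isUnit_zmod_primePow hp x).resolve_left hx, ?_⟩
    rintro ⟨y, rfl⟩
    exact not_isUnit_zmod_primePow hp hk y
  let ϖ : IsLocalRing.maximalIdeal (ZMod (p ^ k)) := ⟨p, (hmem _).2 ⟨1, (mul_one _).symm⟩⟩
  have : Module.Finite (ZMod (p ^ k)) M := Module.Finite.of_finite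
  have := Module.finitePresentation_of_finite (ZMod (p ^ k)) M
  -- freeness follows from flatness, tested on the maximal ideal `(p)`
  refine Module.free_of_maximalIdeal_rTensor_injective ?_
  rw [injective_iff_map_eq_zero]
  intro z
  obtain ⟨m, rfl⟩ : ∃ m : M, z = ϖ ⊗ₜ m := by
    induction z using TensorProduct.induction_on with
    | zero => exact ⟨0, (TensorProduct.tmul_zero _ _).symm⟩
    | add x y hx hy =>
      obtain ⟨a, rfl⟩ := hx
      obtain ⟨b, rfl⟩ := hy
      exact ⟨a + b, (TensorProduct.tmul_add _ _ _).symm⟩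
    | tmul x y =>
      obtain ⟨c, hc⟩ := (hmem _).1 x.2
      refine ⟨c • y, ?_⟩
      rw [← TensorProduct.smul_tmul]
      congr 1
      exact Subtype.ext (hc.trans (mul_comm _ _))
  intro hm
  replace hm : (p : ZMod (p ^ k)) ⊗ₜ[ZMod (p ^ k)] m = 0 := hm
  have hm' : p • m = 0 := by
    have := congrArg (TensorProduct.lid (ZMod (p ^ k)) M) hm
    rwa [TensorProduct.lid_tmul, map_zero, Nat.cast_smul_eq_nsmul] at this
  -- an element killed by `p` is divisible by `p ^ (k - 1)`, one factor at a time
  have hdiv : ∀ j < k, ∃ y : M, m = p ^ j • y := fun j => by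
    induction j with
    | zero => exact fun _ => ⟨m, by simp⟩
    | succ j ih =>
      intro hj
      obtain ⟨y, hy⟩ := ih (by omega)
      obtain ⟨y', hy'⟩ := h y (j + 1) hj (by rw [pow_succ', mul_smul, ← hy, hm'])
      exact ⟨y', by rw [hy, hy', smul_smul, pow_succ]⟩
  obtain ⟨y, hy⟩ := hdiv (k - 1) (by omega)
  have h0 : (p ^ (k - 1) : ℕ) • ϖ = 0 := by
    apply Subtype.ext
    change (p ^ (k - 1) : ℕ) • (p : ZMod (p ^ k)) = 0
    rw [nsmul_eq_mul, ← Nat.cast_mul, ← pow_succ, Nat.sub_add_cancel (Nat.pos_of_ne_zero hk),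
      ZMod.natCast_self]
  rw [hy, ← Nat.cast_smul_eq_nsmul (ZMod (p ^ k)), ← TensorProduct.smul_tmul,
    Nat.cast_smul_eq_nsmul, h0, TensorProduct.zero_tmul]

namespace Background

variable {D : Background.{u, v}}

/-- For `r` even, an intersection of admissible subgroups is free. If `2 ^ j x = 0` with `2 ^ j < r`,
the coordinates of the lift `j(x)` are divisible by `2`; as `j(x)` belongs to the images of all the
`L_i' ⊗ Λ*` in `G_{2Λ}`, half of it belongs to their images in `G`, so that `x` is divisible by `2`
in the intersection. -/
theorem free_of_forall_mem_iff {W : D.WuRefinement} {ε : D.ExtraStructure} (he : Even D.r)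
    {ι : Type*} (L : ι → Submodule (ZMod D.r) D.G) (hL : ∀ i, IsAdmissible W ε (L i)) [Nonempty ι]
    (M : Submodule (ZMod D.r) D.G) (hM : ∀ x, x ∈ M ↔ ∀ i, x ∈ L i) :
    Module.Free (ZMod D.r) M := by
  obtain ⟨p, k, hp, hk, hr⟩ := (isPrimePow_nat_iff D.r).1 D.isPrimePow_r
  have hp2 : p = 2 := by
    rw [← hr, even_iff_two_dvd] at he
    exact ((Nat.prime_dvd_prime_iff_eq Nat.prime_two hp).1 (Nat.prime_two.dvd_of_dvd_pow he)).symm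
  subst hp2
  obtain ⟨C⟩ := D.nonempty_coordinates
  choose L' hL' hLL' hj _ _ using hL
  refine free_zmod_of_forall_exists_nsmul hr.symm hp hk.ne' ?_
  rintro ⟨x, hx⟩ j hjk hjx
  obtain ⟨t, ht⟩ := QuotientAddGroup.mk_surjective (ε.j x)
  have htx : (QuotientAddGroup.mk t : D.G) = x := by
    have := ε.π_j x
    rw [← ht] at this
    exact this
  have h1 : ∀ a, ∃ Z : D.H, C.coord a t = (2 : ℤ) • Z := fun a => by
    have h2 : (2 ^ j : ℕ) • t ∈ D.N := by
      rw [← QuotientAddGroup.eq_zero_iff, QuotientAddGroup.mk_nsmul, htx]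
      exact congrArg Subtype.val hjx
    obtain ⟨h, hh⟩ := C.exists_coord_eq a h2
    obtain ⟨c, hc⟩ := Nat.exists_eq_add_of_lt hjk
    refine ⟨(2 ^ c : ℤ) • h, ?_⟩
    have h3 : (2 ^ j : ℤ) • (C.coord a t - (2 : ℤ) • (2 ^ c : ℤ) • h) = 0 := by
      rw [map_nsmul, ← natCast_zsmul] at hh
      push_cast at hh
      rw [smul_sub, hh, smul_smul, smul_smul, ← sub_smul, ← hr, hc]
      convert zero_smul ℤ h using 2
      push_cast
      ring
    rw [smul_eq_zero] at h3
    exact sub_eq_zero.1 (h3.resolve_left (by positivity))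
  choose Z hZ using h1
  set y : D.T := ∑ a, Z a ⊗ₜ C.lam a with hy
  refine ⟨⟨QuotientAddGroup.mk y, (hM _).2 fun i => ?_⟩, Subtype.ext ?_⟩
  · rw [hLL' i, C.mem_lag_iff]
    intro a
    have h3 := hj i x ((hM x).1 hx i)
    rw [← ht] at h3
    obtain ⟨l, hl, h, hh⟩ := C.exists_of_mem_lag₂ h3 a
    obtain ⟨h', hh'⟩ := C.exists_coord_sum_eq a Z
    -- modulo `2r` the coordinate `2 Z a` lies in `L_i'`, which is saturated
    refine ⟨Z a - (D.r : ℤ) • h, (hL' i).mem_of_zsmul_mem two_ne_zero ?_, h' + h, ?_⟩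
    · convert hl using 1
      rw [smul_sub, ← hZ, hh, smul_smul]
      abel
    · rw [hh', smul_add]
      abel
  · change x = (2 : ℕ) • (QuotientAddGroup.mk y : D.G)
    rw [← htx, ← QuotientAddGroup.mk_nsmul, eq_comm, QuotientAddGroup.eq, neg_add_eq_sub]
    convert C.sub_sum_coord_mem_N t using 2
    rw [hy, Finset.smul_sum]
    refine Finset.sum_congr rfl fun a _ => ?_
    rw [hZ, TensorProduct.smul_tmul', ← natCast_zsmul]
    rfl

/-! ### The Heisenberg cocycle -/

theorem ψ_add_left (x y z : D.G₂) : D.ψ (x + y) z = D.ψ x z * D.ψ y z := by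
  obtain ⟨x, rfl⟩ := QuotientAddGroup.mk_surjective x
  obtain ⟨y, rfl⟩ := QuotientAddGroup.mk_surjective y
  obtain ⟨z, rfl⟩ := QuotientAddGroup.mk_surjective z
  rw [← QuotientAddGroup.mk_add, ψ_mk, ψ_mk, ψ_mk, ← Complex.exp_add, map_add,
    AddMonoidHom.add_apply]
  congr 1
  push_cast
  ring

theorem ψ_antisymm (x y : D.G₂) : D.ψ x y = (D.ψ y x)⁻¹ := by
  obtain ⟨x, rfl⟩ := QuotientAddGroup.mk_surjective x
  obtain ⟨y, rfl⟩ := QuotientAddGroup.mk_surjective y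
  rw [ψ_mk, ψ_mk, ← Complex.exp_neg, pair_antisymm]
  congr 1
  push_cast
  ring

theorem ψ_add_right (x y z : D.G₂) : D.ψ x (y + z) = D.ψ x y * D.ψ x z := by
  rw [ψ_antisymm, ψ_add_left, mul_inv, ← ψ_antisymm, ← ψ_antisymm]

theorem ψ_ne_zero (x y : D.G₂) : D.ψ x y ≠ 0 := by
  obtain ⟨x, rfl⟩ := QuotientAddGroup.mk_surjective x
  obtain ⟨y, rfl⟩ := QuotientAddGroup.mk_surjective y
  exact Complex.exp_ne_zero _

theorem ψ_zero_left (x : D.G₂) : D.ψ 0 x = 1 := by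
  have h := ψ_add_left 0 0 x
  rw [add_zero] at h
  exact (mul_eq_left₀ (ψ_ne_zero _ _)).1 h.symm

theorem ψ_neg_left (x y : D.G₂) : D.ψ (-x) y = (D.ψ x y)⁻¹ := by
  refine eq_inv_of_mul_eq_one_left ?_
  rw [← ψ_add_left, neg_add_cancel, ψ_zero_left]

theorem ψ_neg_right (x y : D.G₂) : D.ψ x (-y) = (D.ψ x y)⁻¹ := by
  rw [ψ_antisymm, ψ_neg_left, ← ψ_antisymm]

theorem ψ_sub_left (x y z : D.G₂) : D.ψ (x - y) z = D.ψ x z * (D.ψ y z)⁻¹ := by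
  rw [sub_eq_add_neg, ψ_add_left, ψ_neg_left]

theorem ψ_sub_right (x y z : D.G₂) : D.ψ x (y - z) = D.ψ x y * (D.ψ x z)⁻¹ := by
  rw [sub_eq_add_neg, ψ_add_right, ψ_neg_right]

theorem ψ_self (x : D.G₂) : D.ψ x x = 1 := by
  obtain ⟨x, rfl⟩ := QuotientAddGroup.mk_surjective x
  have h : D.pair x x = 0 := by
    have := D.pair_antisymm x x
    linarith
  rw [ψ_mk, h]
  simp

theorem ψ_sq (x y : D.G₂) : D.ψ x y ^ 2 = D.B (D.π x) (D.π y) := by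
  obtain ⟨x, rfl⟩ := QuotientAddGroup.mk_surjective x
  obtain ⟨y, rfl⟩ := QuotientAddGroup.mk_surjective y
  change _ = D.B (QuotientAddGroup.mk x) (QuotientAddGroup.mk y)
  rw [ψ_mk, B_mk, ← Complex.exp_nat_mul]
  congr 1
  push_cast
  ring

theorem B_ne_zero (x y : D.G) : D.B x y ≠ 0 := by
  obtain ⟨x, rfl⟩ := QuotientAddGroup.mk_surjective x
  obtain ⟨y, rfl⟩ := QuotientAddGroup.mk_surjective y
  exact Complex.exp_ne_zero _

/-- On `K` the pairing `ψ` takes the values `1` and `-1`, hence it is symmetric there. -/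
theorem ψ_mul_self_of_mem_K (b : D.K) (y : D.G₂) : D.ψ b y * D.ψ b y = 1 := by
  rw [← sq, ψ_sq, AddMonoidHom.mem_ker.1 b.2, B_zero_left]

theorem ψ_inv_of_mem_K (b : D.K) (y : D.G₂) : (D.ψ b y)⁻¹ = D.ψ b y :=
  inv_eq_of_mul_eq_one_left (ψ_mul_self_of_mem_K b y)

theorem ψ_comm_of_mem_K (b : D.K) (y : D.G₂) : D.ψ y b = D.ψ b y := by
  rw [ψ_antisymm, ψ_inv_of_mem_K]

theorem two_nsmul_K (b : D.K) : b + b = 0 := by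
  obtain ⟨b, hb⟩ := b
  obtain ⟨t, rfl⟩ := QuotientAddGroup.mk_surjective b
  have ht : (QuotientAddGroup.mk t : D.G) = 0 := hb
  refine Subtype.ext ?_
  change (QuotientAddGroup.mk t + QuotientAddGroup.mk t : D.G₂) = 0
  rw [← QuotientAddGroup.mk_add, QuotientAddGroup.eq_zero_iff]
  exact ⟨t, (QuotientAddGroup.eq_zero_iff t).1 ht, two_nsmul t⟩

section Wu

variable (W : D.WuRefinement)

theorem WuRefinement.q_add (b b' : D.K) : W.q (b + b') = W.q b * W.q b' * D.ψ b b' :=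
  W.refines.map_add b b'

theorem WuRefinement.q_zero : W.q 0 = 1 := by
  have h := W.refines.map_nsmul 0 0
  rwa [zero_smul, zero_pow two_ne_zero, pow_zero] at h

theorem WuRefinement.q_mul_self (b : D.K) : W.q b * W.q b = 1 := by
  have h := W.q_add b b
  rwa [two_nsmul_K, W.q_zero, ψ_self, mul_one, eq_comm] at h

theorem WuRefinement.q_inv (b : D.K) : (W.q b)⁻¹ = W.q b :=
  inv_eq_of_mul_eq_one_left (W.q_mul_self b)

theorem WuRefinement.q_ne_zero (b : D.K) : W.q b ≠ 0 := left_ne_zero_of_mul_eq_one (W.q_mul_self b)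

end Wu

variable (W : D.WuRefinement) (ε : D.ExtraStructure)

theorem φ_ne_zero (x y : D.G) : φ W ε x y ≠ 0 :=
  mul_ne_zero (mul_ne_zero (ψ_ne_zero _ _) (ψ_ne_zero _ _)) (inv_ne_zero (W.q_ne_zero _))

/-- The failure `β` of lifts of three elements to add up to the lift of their sum enters the two
sides of the cocycle identity in the same, symmetric way. -/
theorem φ_cocycle_aux {a b c d f : D.G₂} {β₁ β₂ β : D.K} (h₁ : (β₁ : D.G₂) = a + b - d)
    (h₂ : (β₂ : D.G₂) = d + c - f) (h : (β : D.G₂) = a + b + c - f) :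
    D.ψ a b * D.ψ β₁ (a + b) * (W.q β₁)⁻¹ * (D.ψ d c * D.ψ β₂ (d + c) * (W.q β₂)⁻¹) =
      D.ψ a b * D.ψ a c * D.ψ b c * D.ψ β (a + b + c) * W.q β := by
  have hβ : β = β₁ + β₂ := by
    apply Subtype.ext
    rw [AddSubgroup.coe_add, h, h₁, h₂]
    abel
  have hd : d = a + b - β₁ := by rw [h₁]; abel
  rw [hβ, W.q_add, AddSubgroup.coe_add, hd, W.q_inv, W.q_inv]
  simp only [ψ_add_left, ψ_add_right, ψ_sub_left, ψ_sub_right, ψ_inv_of_mem_K]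
  rw [← ψ_comm_of_mem_K β₁ (β₂ : D.G₂)]
  ring

theorem ExtraStructure.b_comm (x y : D.G) : ε.b x y = ε.b y x := by
  apply Subtype.ext
  change ε.j x + ε.j y - ε.j (x + y) = ε.j y + ε.j x - ε.j (y + x)
  rw [add_comm (ε.j x), add_comm x]

/-- The commutator of the Heisenberg group is `B`. -/
theorem φ_comm (x y : D.G) : φ W ε x y = D.B x y * φ W ε y x := by
  have h : D.B x y = D.ψ (ε.j x) (ε.j y) ^ 2 := by rw [ψ_sq, ε.π_j, ε.π_j]
  rw [φ, φ, ε.b_comm y x, add_comm (ε.j y), h, ψ_antisymm (ε.j y)]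
  field_simp [ψ_ne_zero]

theorem φ_cocycle (x y z : D.G) :
    φ W ε x y * φ W ε (x + y) z = φ W ε y z * φ W ε x (y + z) := by
  have hK : ε.j x + ε.j y + ε.j z - ε.j (x + y + z) ∈ D.K := by
    rw [AddMonoidHom.mem_ker]
    simp only [map_sub, map_add, ε.π_j, sub_self]
  have h1 := φ_cocycle_aux W (β₁ := ε.b x y) (β₂ := ε.b (x + y) z) (β := ⟨_, hK⟩) rfl rfl rfl
  have h2 := φ_cocycle_aux W (β₁ := ε.b y z) (β₂ := ε.b (y + z) x) (β := ⟨_, hK⟩) rfl rfl (by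
    change ε.j x + ε.j y + ε.j z - ε.j (x + y + z) = _
    rw [add_comm (y + z), ← add_assoc x]
    abel)
  have h3 : D.B x y = D.ψ (ε.j x) (ε.j y) ^ 2 := by rw [ψ_sq, ε.π_j, ε.π_j]
  have h4 : D.B x z = D.ψ (ε.j x) (ε.j z) ^ 2 := by rw [ψ_sq, ε.π_j, ε.π_j]
  have h5 : ε.j y + ε.j z + ε.j x = ε.j x + ε.j y + ε.j z := by abel
  rw [φ_comm W ε x (y + z), B_add_right, h3, h4, mul_left_comm (φ W ε y z)]
  refine h1.trans ?_
  refine Eq.trans ?_ (congrArg _ h2.symm)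
  rw [h5, ψ_antisymm (ε.j y) (ε.j x), ψ_antisymm (ε.j z) (ε.j x)]
  have h6 := ψ_ne_zero (ε.j x) (ε.j y)
  have h7 := ψ_ne_zero (ε.j x) (ε.j z)
  field_simp

/-! ### Admissible subgroups -/

section Admissible

variable {W ε} {L : Submodule (ZMod D.r) D.G}

theorem IsAdmissible.form_eq_zero (hL : IsAdmissible W ε L) {x y : D.G} (hx : x ∈ L) (hy : y ∈ L) :
    D.form x y = 0 := by
  obtain ⟨L', hL', rfl, -⟩ := hL
  exact hL'.form_eq_zero hx hy

/-- An admissible subgroup contains its orthogonal. -/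
theorem IsAdmissible.mem (hL : IsAdmissible W ε L) {x : D.G} (hx : ∀ y ∈ L, D.form x y = 0) :
    x ∈ L := by
  obtain ⟨L', hL', rfl, -⟩ := hL
  exact hL'.mem_lag hx

theorem IsAdmissible.B_eq_one (hL : IsAdmissible W ε L) {x y : D.G} (hx : x ∈ L) (hy : y ∈ L) :
    D.B x y = 1 := (form_eq_zero_iff x y).1 (hL.form_eq_zero hx hy)

/-- The cocycle is trivial on an admissible subgroup, because all lifts stay in the image of
`L' ⊗ Λ*`, where `ψ` and the refinement are trivial. -/
theorem IsAdmissible.φ_eq_one (hL : IsAdmissible W ε L) {x y : D.G} (hx : x ∈ L) (hy : y ∈ L) :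
    φ W ε x y = 1 := by
  obtain ⟨L', hL', rfl, hj, hq, -⟩ := hL
  have hb : (ε.b x y : D.G₂) ∈ D.lag₂ L' :=
    sub_mem (add_mem (hj x hx) (hj y hy)) (hj _ (add_mem hx hy))
  rw [φ, ψ_eq_one_of_mem hL' (hj x hx) (hj y hy),
    ψ_eq_one_of_mem hL' hb (add_mem (hj x hx) (hj y hy)), hq _ hb]
  simp

end Admissible

/-! ### The two actions of the Heisenberg group -/

theorem ρ_ρ (k k' : D.G) (f : D.G → ℂ) :
    ρ W ε k' (ρ W ε k f) = φ W ε k k' • ρ W ε (k + k') f := by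
  ext y
  change φ W ε (y - k') k' * (φ W ε (y - k' - k) k * f (y - k' - k)) =
    φ W ε k k' * (φ W ε (y - (k + k')) (k + k') * f (y - (k + k')))
  have h := φ_cocycle W ε (y - (k + k')) k k'
  rw [show y - (k + k') + k = y - k' by abel] at h
  rw [show y - k' - k = y - (k + k') by abel]
  linear_combination f (y - (k + k')) * h

theorem ρ_comm (k k' : D.G) (f : D.G → ℂ) :
    ρ W ε k' (ρ W ε k f) = D.B k k' • ρ W ε k (ρ W ε k' f) := by
  rw [ρ_ρ, ρ_ρ, smul_smul, φ_comm W ε k k', add_comm k']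

/-- In the form `φ(k, x) δ_{k + x}`, the action `ρ̃` is translation on the other side. -/
theorem ρt_apply (k : D.G) (f : D.G → ℂ) (y : D.G) :
    ρt W ε k f y = φ W ε k (y - k) * f (y - k) := by
  rw [φ_comm W ε k]
  rfl

theorem ρ_ρt (k k' : D.G) (f : D.G → ℂ) :
    ρ W ε k (ρt W ε k' f) = ρt W ε k' (ρ W ε k f) := by
  ext y
  rw [ρt_apply]
  change φ W ε (y - k) k * ρt W ε k' f (y - k) =
    φ W ε k' (y - k') * (φ W ε (y - k' - k) k * f (y - k' - k))
  rw [ρt_apply]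
  have h := φ_cocycle W ε k' (y - k - k') k
  rw [show k' + (y - k - k') = y - k by abel, show y - k - k' + k = y - k' by abel] at h
  rw [show y - k' - k = y - k - k' by abel]
  linear_combination f (y - k - k') * h

open Classical in
theorem ρ_single_zero_apply (k y : D.G) :
    ρ W ε k (Pi.single 0 1) y = if y = k then φ W ε 0 k else 0 := by
  change φ W ε (y - k) k * (Pi.single 0 1 : D.G → ℂ) (y - k) = _
  rw [Pi.single_apply]
  simp only [sub_eq_zero]
  split_ifs with h
  · rw [h, sub_self, mul_one]
  · rw [mul_zero]

theorem smul_ρ_injective {k : D.G} {c c' : ℂ}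
    (h : ∀ f : D.G → ℂ, c • ρ W ε k f = c' • ρ W ε k f) : c = c' := by
  classical
  have h1 := congrFun (h (Pi.single 0 1)) k
  rw [Pi.smul_apply, Pi.smul_apply, ρ_single_zero_apply, if_pos rfl, smul_eq_mul,
    smul_eq_mul] at h1
  exact mul_right_cancel₀ (φ_ne_zero W ε 0 k) h1

end Background

end AbelianGauge

namespace AbelianGauge

/-! ### Duality of finite modules over `ℤ/r` -/

/-- For a pairing of finite modules of the same size which is nondegenerate on one side, each
subgroup is its own double annihilator, because all characters come from the pairing. -/
theorem mem_of_forall_annihilator {r : ℕ} [NeZero r] {V W : Type*} [AddCommGroup V]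
    [AddCommGroup W] [Finite V] [Finite W] [Module (ZMod r) V] [Module (ZMod r) W]
    (β : V →ₗ[ZMod r] W →ₗ[ZMod r] ZMod r) (hβ : ∀ w, (∀ v, β v w = 0) → w = 0)
    (hcard : Nat.card V = Nat.card W) (N : AddSubgroup V) {x : V}
    (hx : ∀ w, (∀ n ∈ N, β n w = 0) → β x w = 0) : x ∈ N := by
  let Φ : W → AddChar V ℂ := fun w =>
    (ZMod.stdAddChar (N := r)).compAddMonoidHom (β.flip w).toAddMonoidHom
  have hΦ : ∀ w v, Φ w v = ZMod.stdAddChar (β v w) := fun _ _ => rfl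
  have hinj : Function.Injective Φ := fun w w' h => by
    rw [← sub_eq_zero]
    refine hβ _ fun v => ?_
    rw [map_sub, sub_eq_zero]
    exact ZMod.injective_stdAddChar (by rw [← hΦ, ← hΦ, h])
  have := Fintype.ofFinite V
  have := Fintype.ofFinite W
  have hbij : Function.Bijective Φ := (Fintype.bijective_iff_injective_and_card Φ).2
    ⟨hinj, by rw [AddChar.card_eq, ← Nat.card_eq_fintype_card, ← Nat.card_eq_fintype_card, hcard]⟩
  by_contra hxN
  have hx0 : (QuotientAddGroup.mk' N x) ≠ 0 := fun h => hxN ((QuotientAddGroup.eq_zero_iff x).1 h)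
  obtain ⟨θ, hθ⟩ := AddChar.exists_apply_ne_zero.2 hx0
  obtain ⟨w, hw⟩ := hbij.2 (θ.compAddMonoidHom (QuotientAddGroup.mk' N))
  have hw' : ∀ v, ZMod.stdAddChar (β v w) = θ (QuotientAddGroup.mk' N v) := fun v => by
    rw [← hΦ, hw]
    rfl
  refine hθ ?_
  rw [← hw', hx w fun n hn => ?_, AddChar.map_zero_eq_one]
  apply ZMod.injective_stdAddChar
  rw [hw', show QuotientAddGroup.mk' N n = 0 from (QuotientAddGroup.eq_zero_iff n).2 hn,
    AddChar.map_zero_eq_one, AddChar.map_zero_eq_one]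

/-- A linear map to a finite free module over `ℤ/r` is onto as soon as no nonzero functional
vanishes on its image. -/
theorem surjective_of_forall_dotProduct {r : ℕ} [NeZero r] {V ι : Type*} [AddCommGroup V]
    [Module (ZMod r) V] [Fintype ι] (f : V →ₗ[ZMod r] (ι → ZMod r))
    (hf : ∀ c : ι → ZMod r, (∀ x, f x ⬝ᵥ c = 0) → c = 0) : Function.Surjective f := fun y => by
  classical
  let β : (ι → ZMod r) →ₗ[ZMod r] (ι → ZMod r) →ₗ[ZMod r] ZMod r :=
    LinearMap.mk₂ (ZMod r) (fun x y => x ⬝ᵥ y) add_dotProduct smul_dotProduct dotProduct_add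
      (fun c x y => dotProduct_smul c x y)
  have h := mem_of_forall_annihilator β (fun w hw => by
    ext j
    rw [← single_one_dotProduct j w]
    exact hw _) rfl f.range.toAddSubgroup (x := y) (fun w hw => by
      rw [hf w fun x => hw _ ⟨x, rfl⟩, map_zero])
  exact h

/-- A finite module over `ℤ/r`, for a prime power `r`, which is a direct summand of a free module
is free. -/
theorem free_of_projection {r : ℕ} (hr : IsPrimePow r) {V W : Type*} [AddCommGroup V]
    [AddCommGroup W] [Module (ZMod r) V] [Module (ZMod r) W] [Module.Free (ZMod r) V] [Finite V]
    (i : W →ₗ[ZMod r] V) (p : V →ₗ[ZMod r] W) (h : p ∘ₗ i = LinearMap.id) :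
    Module.Free (ZMod r) W := by
  have := isLocalRing_zmod hr
  have : Module.Projective (ZMod r) W := Module.Projective.of_split i p h
  have hp : Function.Surjective p := fun w => ⟨i w, LinearMap.congr_fun h w⟩
  have : Finite W := Finite.of_surjective p hp
  have : Module.Finite (ZMod r) W := Module.Finite.of_finite
  exact Module.free_of_flat_of_isLocalRing

namespace Background

variable {D : Background.{u, v}}

/-- Each subgroup of `G` is its own double orthogonal. -/
theorem mem_of_forall_form_eq_zero (N : Submodule (ZMod D.r) D.G) {x : D.G}
    (hx : ∀ w, (∀ n ∈ N, D.form n w = 0) → D.form x w = 0) : x ∈ N :=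
  mem_of_forall_annihilator D.form (fun w hw => form_nondegenerate fun y => by
    rw [form_antisymm, hw, neg_zero]) rfl N.toAddSubgroup hx

section Lagrangian

variable {W : D.WuRefinement} {ε : D.ExtraStructure} {L₁ L₂ L₃ : Submodule (ZMod D.r) D.G}

/-- The orthogonal of `L₁ ∩ L₃` is `L₁ + L₃`. -/
theorem mem_sup_of_forall_form_eq_zero (h₁ : IsAdmissible W ε L₁) (h₃ : IsAdmissible W ε L₃)
    {x : D.G} (hx : ∀ l ∈ L₁ ⊓ L₃, D.form l x = 0) : x ∈ L₁ ⊔ L₃ := by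
  refine mem_of_forall_form_eq_zero _ fun w hw => ?_
  rw [form_antisymm, hx w, neg_zero]
  refine ⟨h₁.mem fun y hy => ?_, h₃.mem fun y hy => ?_⟩
  · rw [form_antisymm, hw y (Submodule.mem_sup_left hy), neg_zero]
  · rw [form_antisymm, hw y (Submodule.mem_sup_right hy), neg_zero]

/-- The orthogonal of `L₂ ∩ (L₁ + L₃)` is `L₂ + L₁ ∩ L₃`. -/
theorem mem_sup_inf_of_forall_form_eq_zero (h₁ : IsAdmissible W ε L₁) (h₂ : IsAdmissible W ε L₂)
    (h₃ : IsAdmissible W ε L₃) {x : D.G} (hx : ∀ y ∈ L₂ ⊓ (L₁ ⊔ L₃), D.form x y = 0) :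
    x ∈ L₂ ⊔ (L₁ ⊓ L₃) := by
  refine mem_of_forall_form_eq_zero _ fun w hw => hx w ⟨h₂.mem fun y hy => ?_,
    mem_sup_of_forall_form_eq_zero h₁ h₃ fun l hl => hw l (Submodule.mem_sup_right hl)⟩
  rw [form_antisymm, hw y (Submodule.mem_sup_left hy), neg_zero]

end Lagrangian

/-! ### The quadratic refinement attached to three Lagrangian subgroups -/

section Triple

variable {W : D.WuRefinement} {ε : D.ExtraStructure} {L₁ L₂ L₃ : Submodule (ZMod D.r) D.G}

/-- The cocycle in terms of the three lifts `j x`, `j y` and `j (x + y)`; in this form the lifts can be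
changed separately. -/
theorem φ_eq (W : D.WuRefinement) (ε : D.ExtraStructure) (x y : D.G) :
    φ W ε x y = D.ψ (ε.j x) (ε.j y) * (D.ψ (ε.j (x + y)) (ε.j x + ε.j y))⁻¹ * W.q (ε.b x y) := by
  have h : (ε.b x y : D.G₂) = ε.j x + ε.j y - ε.j (x + y) := rfl
  rw [φ, h, ψ_sub_left, ψ_self, one_mul, W.q_inv]

/-- If the lifts are taken in the subgroups `L_{i,2Λ}`, changing one of them does not change the
expression of the cocycle. -/
theorem lift_independent {L₁' L₂' L₃' : Submodule ℤ D.H} (hL₁ : D.IsLagrangian L₁')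
    (hL₂ : D.IsLagrangian L₂') (hL₃ : D.IsLagrangian L₃')
    (hq₁ : ∀ b : D.K, (b : D.G₂) ∈ D.lag₂ L₁' → W.q b = 1)
    (hq₂ : ∀ b : D.K, (b : D.G₂) ∈ D.lag₂ L₂' → W.q b = 1)
    (hq₃ : ∀ b : D.K, (b : D.G₂) ∈ D.lag₂ L₃' → W.q b = 1)
    {c₁ c₂ c₃ : D.G₂} {κ₁ κ₂ κ₃ β β' : D.K} (hc₁ : c₁ ∈ D.lag₂ L₁') (hc₂ : c₂ ∈ D.lag₂ L₂')
    (hc₃ : c₃ ∈ D.lag₂ L₃') (hκ₁ : (κ₁ : D.G₂) ∈ D.lag₂ L₁') (hκ₂ : (κ₂ : D.G₂) ∈ D.lag₂ L₂')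
    (hκ₃ : (κ₃ : D.G₂) ∈ D.lag₂ L₃') (hβ : (β : D.G₂) = c₃ + c₁ - c₂)
    (hβ' : (β' : D.G₂) = (c₃ + κ₃) + (c₁ + κ₁) - (c₂ + κ₂)) :
    D.ψ (c₃ + κ₃) (c₁ + κ₁) * (D.ψ (c₂ + κ₂) ((c₃ + κ₃) + (c₁ + κ₁)))⁻¹ * W.q β' =
      D.ψ c₃ c₁ * (D.ψ c₂ (c₃ + c₁))⁻¹ * W.q β := by
  have h : β' + κ₂ = β + (κ₃ + κ₁) := by
    apply Subtype.ext
    rw [AddSubgroup.coe_add, AddSubgroup.coe_add, AddSubgroup.coe_add, hβ, hβ']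
    abel
  have hq := congrArg W.q h
  rw [W.q_add, W.q_add, W.q_add, hq₁ _ hκ₁, hq₂ _ hκ₂, hq₃ _ hκ₃, AddSubgroup.coe_add, hβ', hβ]
    at hq
  have e1 := ψ_eq_one_of_mem hL₁ hc₁ hκ₁
  have e2 := ψ_eq_one_of_mem hL₂ hc₂ hκ₂
  have e3 := ψ_eq_one_of_mem hL₃ hc₃ hκ₃
  simp only [ψ_add_left, ψ_add_right, ψ_sub_left, mul_inv, ψ_self, e1, e2, e3,
    ψ_inv_of_mem_K] at hq ⊢
  rw [ψ_comm_of_mem_K] at e1 e2 e3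
  simp only [ψ_comm_of_mem_K _ c₁, ψ_comm_of_mem_K _ c₂, ψ_comm_of_mem_K _ c₃,
    ψ_comm_of_mem_K κ₁ (κ₃ : D.G₂), ψ_comm_of_mem_K κ₂ (κ₃ : D.G₂),
    ψ_comm_of_mem_K κ₁ (κ₂ : D.G₂), ψ_inv_of_mem_K] at hq ⊢
  -- a product of values of `ψ` on `K`, hence a sign
  have hs : (D.ψ κ₃ c₁ * D.ψ κ₁ c₃ * D.ψ κ₁ κ₃ * D.ψ κ₃ c₂ * D.ψ κ₁ c₂) ^ 2 = 1 := by
    simp only [mul_pow]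
    simp only [sq, ψ_mul_self_of_mem_K, mul_one]
  linear_combination D.ψ c₃ c₁ * (D.ψ c₂ c₃)⁻¹ * (D.ψ c₂ c₁)⁻¹ *
    (D.ψ κ₃ c₁ * D.ψ κ₁ c₃ * D.ψ κ₁ κ₃ * D.ψ κ₃ c₂ * D.ψ κ₁ c₂) * hq +
    D.ψ c₃ c₁ * (D.ψ c₂ c₃)⁻¹ * (D.ψ c₂ c₁)⁻¹ * W.q β * hs

/-- The cocycle is even on the pairs in question: `-j x` and `j (-x)` are two lifts of `-x`, and the
expression of the cocycle does not depend on the lifts. -/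
theorem φ_neg_neg (h₁ : IsAdmissible W ε L₁) (h₂ : IsAdmissible W ε L₂)
    (h₃ : IsAdmissible W ε L₃) {x y : D.G} (hx : x ∈ L₃) (hy : y ∈ L₁) (hxy : x + y ∈ L₂) :
    φ W ε (-x) (-y) = φ W ε x y := by
  obtain ⟨L₁', hL₁, rfl, hj₁, hq₁, -⟩ := h₁
  obtain ⟨L₂', hL₂, rfl, hj₂, hq₂, -⟩ := h₂
  obtain ⟨L₃', hL₃, rfl, hj₃, hq₃, -⟩ := h₃
  have hK : ∀ z : D.G, ε.j z + ε.j (-z) ∈ D.K := fun z => by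
    rw [AddMonoidHom.mem_ker, map_add, ε.π_j, ε.π_j, add_neg_cancel]
  have hs : -x + -y = -(x + y) := by abel
  have e1 : -ε.j x + (ε.j x + ε.j (-x)) = ε.j (-x) := by abel
  have e2 : -ε.j y + (ε.j y + ε.j (-y)) = ε.j (-y) := by abel
  have e3 : -ε.j (x + y) + (ε.j (x + y) + ε.j (-(x + y))) = ε.j (-x + -y) := by rw [hs]; abel
  have h := lift_independent hL₁ hL₂ hL₃ hq₁ hq₂ hq₃ (c₁ := -ε.j y) (c₂ := -ε.j (x + y))
    (c₃ := -ε.j x) (κ₁ := ⟨_, hK y⟩) (κ₂ := ⟨_, hK (x + y)⟩) (κ₃ := ⟨_, hK x⟩) (β := -ε.b x y)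
    (β' := ε.b (-x) (-y)) (neg_mem (hj₁ _ hy)) (neg_mem (hj₂ _ hxy)) (neg_mem (hj₃ _ hx))
    (add_mem (hj₁ _ hy) (hj₁ _ (neg_mem hy))) (add_mem (hj₂ _ hxy) (hj₂ _ (neg_mem hxy)))
    (add_mem (hj₃ _ hx) (hj₃ _ (neg_mem hx)))
    (by
      change -(ε.j x + ε.j y - ε.j (x + y)) = _
      abel)
    (by
      change ε.j (-x) + ε.j (-y) - ε.j (-x + -y) = _
      rw [e1, e2, e3])
  rw [e1, e2, e3, neg_eq_of_add_eq_zero_left (two_nsmul_K (ε.b x y)), ← neg_add] at h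
  rw [φ_eq, φ_eq, hs, h, ← neg_add (ε.j x), ψ_neg_left, ψ_neg_right, ψ_neg_left, ψ_neg_right]
  simp

/-- Cocycle values on `L₃ × L₁` depend on the sum only. -/
theorem φ_eq_of_add_eq (h₁ : IsAdmissible W ε L₁) (h₃ : IsAdmissible W ε L₃) {x y x' y' : D.G}
    (hx : x ∈ L₃) (hy : y ∈ L₁) (hx' : x' ∈ L₃) (hy' : y' ∈ L₁) (h : x + y = x' + y') :
    φ W ε x y = φ W ε x' y' := by
  have e1 : x - x' = y' - y := by rw [sub_eq_sub_iff_add_eq_add, h, add_comm]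
  have h3 : x - x' ∈ L₃ := sub_mem hx hx'
  have h1 : x - x' ∈ L₁ := by rw [e1]; exact sub_mem hy' hy
  have h2 := φ_cocycle W ε x' (x - x') y
  rw [h₃.φ_eq_one hx' h3, h₁.φ_eq_one h1 hy, add_sub_cancel, one_mul, one_mul] at h2
  rw [h2, e1, sub_add_cancel]

/-- Multiplicativity of the cocycle on `L₃ × L₁`, read off from the product of operators. -/
theorem φ_add_add (h₁ : IsAdmissible W ε L₁) (h₂ : IsAdmissible W ε L₂)
    (h₃ : IsAdmissible W ε L₃) {x y x' y' : D.G} (hx : x ∈ L₃) (hy : y ∈ L₁) (hx' : x' ∈ L₃)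
    (hy' : y' ∈ L₁) (hxy : x + y ∈ L₂) (hxy' : x' + y' ∈ L₂) :
    φ W ε (x + x') (y + y') = φ W ε x y * φ W ε x' y' * D.B x (x' + y') := by
  have hρ₁ : ∀ f, ρ W ε (y + y') f = ρ W ε y' (ρ W ε y f) := fun f => by
    rw [ρ_ρ, h₁.φ_eq_one hy hy', one_smul]
  have hρ₃ : ∀ f, ρ W ε (x + x') f = ρ W ε x' (ρ W ε x f) := fun f => by
    rw [ρ_ρ, h₃.φ_eq_one hx hx', one_smul]
  have hρ₂ : ∀ f, ρ W ε (x' + y') (ρ W ε (x + y) f) = ρ W ε ((x + x') + (y + y')) f := fun f => by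
    rw [ρ_ρ, h₂.φ_eq_one hxy hxy', one_smul]
    congr 2
    abel
  have hB : D.B x (x' + y') = D.B x' y := by
    have h := h₂.B_eq_one hxy hxy'
    rw [B_add_left, B_add_right y, h₁.B_eq_one hy hy', mul_one, B_antisymm y,
      mul_inv_eq_one₀ (B_ne_zero _ _)] at h
    exact h
  refine smul_ρ_injective W ε (k := (x + x') + (y + y')) fun f => ?_
  rw [← ρ_ρ, hρ₁, hρ₃, ρ_comm W ε x' y, map_smul, ρ_ρ W ε x' y', ρ_ρ W ε x y,
    map_smul, hρ₂, smul_smul, smul_smul, hB]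
  congr 1
  ring

end Triple

namespace OrientedLL

variable {W : D.WuRefinement} {ε : D.ExtraStructure} (L₃ L₂ L₁ : OrientedLL W ε)

theorem exists_decomposition (k : S L₃ L₂ L₁) :
    ∃ p : D.G × D.G, p.1 ∈ L₁.L ∧ p.2 ∈ L₃.L ∧ (k : D.G) = p.1 + p.2 := by
  obtain ⟨y, hy, z, hz, h⟩ := Submodule.mem_sup.1 k.2.2
  exact ⟨(y, z), hy, hz, h.symm⟩

/-- The function `k₁ + k₃ ↦ φ(k₃, k₁)` on `S₂`, defined through a choice of decompositions. -/
def q (k : S L₃ L₂ L₁) : ℂ :=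
  φ W ε (exists_decomposition L₃ L₂ L₁ k).choose.2 (exists_decomposition L₃ L₂ L₁ k).choose.1

/-- The pairing `(k₁ + k₃, k') ↦ B(k₃, k')` on `S₂`, defined through a choice of decompositions. -/
def P (k k' : S L₃ L₂ L₁) : ℂ := D.B (exists_decomposition L₃ L₂ L₁ k).choose.2 k'

variable {L₃ L₂ L₁}

theorem q_eq {k : S L₃ L₂ L₁} {k₁ k₃ : D.G} (h₁ : k₁ ∈ L₁.L) (h₃ : k₃ ∈ L₃.L)
    (h : (k : D.G) = k₁ + k₃) : q L₃ L₂ L₁ k = φ W ε k₃ k₁ := by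
  have hc := (exists_decomposition L₃ L₂ L₁ k).choose_spec
  refine φ_eq_of_add_eq L₁.admissible L₃.admissible hc.2.1 hc.1 h₃ h₁ ?_
  rw [add_comm, add_comm k₃]
  exact hc.2.2.symm.trans h

theorem P_eq {k : S L₃ L₂ L₁} (k' : S L₃ L₂ L₁) {k₁ k₃ : D.G} (h₁ : k₁ ∈ L₁.L) (h₃ : k₃ ∈ L₃.L)
    (h : (k : D.G) = k₁ + k₃) : P L₃ L₂ L₁ k k' = D.B k₃ k' := by
  obtain ⟨hc₁, hc₃, hc⟩ := (exists_decomposition L₃ L₂ L₁ k).choose_spec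
  rw [P]
  set x := (exists_decomposition L₃ L₂ L₁ k).choose
  have e : x.2 - k₃ = k₁ - x.1 := by rw [sub_eq_sub_iff_add_eq_add, ← h, add_comm, hc]
  have m₃ : x.2 - k₃ ∈ L₃.L := sub_mem hc₃ h₃
  have m₁ : x.2 - k₃ ∈ L₁.L := by rw [e]; exact sub_mem h₁ hc₁
  obtain ⟨p, hp₁, hp₃, hp⟩ := exists_decomposition L₃ L₂ L₁ k'
  have hB : D.B (x.2 - k₃) k' = 1 := by
    rw [hp, B_add_right, L₁.admissible.B_eq_one m₁ hp₁, L₃.admissible.B_eq_one m₃ hp₃, mul_one]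
  rw [← sub_add_cancel x.2 k₃, B_add_left, hB, one_mul]

theorem P_add_right (k x y : S L₃ L₂ L₁) :
    P L₃ L₂ L₁ k (x + y) = P L₃ L₂ L₁ k x * P L₃ L₂ L₁ k y := B_add_right _ _ _

theorem P_add_left (x y k : S L₃ L₂ L₁) :
    P L₃ L₂ L₁ (x + y) k = P L₃ L₂ L₁ x k * P L₃ L₂ L₁ y k := by
  obtain ⟨p, hp₁, hp₃, hp⟩ := exists_decomposition L₃ L₂ L₁ x
  obtain ⟨p', hp₁', hp₃', hp'⟩ := exists_decomposition L₃ L₂ L₁ y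
  rw [P_eq k hp₁ hp₃ hp, P_eq k hp₁' hp₃' hp', P_eq k (add_mem hp₁ hp₁') (add_mem hp₃ hp₃'),
    B_add_left]
  rw [Submodule.coe_add, hp, hp']
  abel

/-- The symmetry of the pairing comes from the vanishing of `B` on `L₁`, `L₂` and `L₃`. -/
theorem P_comm (x y : S L₃ L₂ L₁) : P L₃ L₂ L₁ x y = P L₃ L₂ L₁ y x := by
  obtain ⟨p, hp₁, hp₃, hp⟩ := exists_decomposition L₃ L₂ L₁ x
  obtain ⟨p', hp₁', hp₃', hp'⟩ := exists_decomposition L₃ L₂ L₁ y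
  rw [P_eq y hp₁ hp₃ hp, P_eq x hp₁' hp₃' hp']
  have h := L₂.admissible.B_eq_one x.2.1 y.2.1
  have h1 : D.B x y = D.B p.1 p'.2 * D.B p.2 y := by
    nth_rewrite 1 [hp, B_add_left, hp']
    rw [B_add_right, L₁.admissible.B_eq_one hp₁ hp₁', one_mul]
  have h2 : D.B p'.2 x = (D.B p.1 p'.2)⁻¹ := by
    rw [hp, B_add_right, L₃.admissible.B_eq_one hp₃' hp₃, mul_one, B_antisymm]
  rw [h2]
  exact eq_inv_of_mul_eq_one_right (h1.symm.trans h)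

theorem q_add (x y : S L₃ L₂ L₁) :
    q L₃ L₂ L₁ (x + y) = q L₃ L₂ L₁ x * q L₃ L₂ L₁ y * P L₃ L₂ L₁ x y := by
  obtain ⟨p, hp₁, hp₃, hp⟩ := exists_decomposition L₃ L₂ L₁ x
  obtain ⟨p', hp₁', hp₃', hp'⟩ := exists_decomposition L₃ L₂ L₁ y
  rw [q_eq hp₁ hp₃ hp, q_eq hp₁' hp₃' hp', P_eq y hp₁ hp₃ hp,
    q_eq (add_mem hp₁ hp₁') (add_mem hp₃ hp₃'), φ_add_add L₁.admissible L₂.admissible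
      L₃.admissible hp₃ hp₁ hp₃' hp₁', hp', add_comm p'.2]
  · rw [add_comm, ← hp]; exact x.2.1
  · rw [add_comm, ← hp']; exact y.2.1
  · rw [Submodule.coe_add, hp, hp']
    abel

theorem q_neg (x : S L₃ L₂ L₁) : q L₃ L₂ L₁ (-x) = q L₃ L₂ L₁ x := by
  obtain ⟨p, hp₁, hp₃, hp⟩ := exists_decomposition L₃ L₂ L₁ x
  rw [q_eq hp₁ hp₃ hp, q_eq (neg_mem hp₁) (neg_mem hp₃)]
  · refine φ_neg_neg L₁.admissible L₂.admissible L₃.admissible hp₃ hp₁ ?_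
    rw [add_comm, ← hp]
    exact x.2.1
  · rw [Submodule.coe_neg, hp, neg_add]

theorem q_eq_one {k : S L₃ L₂ L₁} {k₁ k₃ : D.G} (h₁ : k₁ ∈ L₁.L) (h₃ : k₃ ∈ L₃.L)
    (h : (k : D.G) = k₁ + k₃) (h₂ : k₁ ∈ L₂.L) : q L₃ L₂ L₁ k = 1 := by
  rw [q_eq h₁ h₃ h]
  refine L₂.admissible.φ_eq_one ?_ h₂
  rw [← add_sub_cancel_left k₁ k₃, ← h]
  exact sub_mem k.2.1 h₂

theorem q_zero : q L₃ L₂ L₁ 0 = 1 :=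
  q_eq_one (zero_mem _) (zero_mem _) (by simp) (zero_mem _)

theorem P_zero_left (x : S L₃ L₂ L₁) : P L₃ L₂ L₁ 0 x = 1 := by
  rw [P_eq x (zero_mem _) (zero_mem _) (by simp), B_zero_left]

theorem P_ne_zero (x y : S L₃ L₂ L₁) : P L₃ L₂ L₁ x y ≠ 0 := B_ne_zero _ _

/-- The evenness of `q` makes it a square root of its diagonal pairing. -/
theorem q_mul_self (x : S L₃ L₂ L₁) : q L₃ L₂ L₁ x * q L₃ L₂ L₁ x = P L₃ L₂ L₁ x x := by
  have h := q_add x (-x)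
  have h2 := P_add_left x (-x) x
  rw [add_neg_cancel, q_zero, q_neg, P_comm] at h
  rw [add_neg_cancel, P_zero_left] at h2
  refine mul_right_cancel₀ (P_ne_zero (-x) x) (h.symm.trans h2)

theorem P_nsmul_left (n : ℕ) (x y : S L₃ L₂ L₁) :
    P L₃ L₂ L₁ (n • x) y = P L₃ L₂ L₁ x y ^ n := by
  induction n with
  | zero => rw [zero_smul, P_zero_left, pow_zero]
  | succ n ih => rw [succ_nsmul, P_add_left, ih, pow_succ]

theorem q_nsmul (n : ℕ) (x : S L₃ L₂ L₁) :
    q L₃ L₂ L₁ (n • x) = q L₃ L₂ L₁ x ^ (n ^ 2) := by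
  induction n with
  | zero => rw [zero_smul, q_zero, zero_pow two_ne_zero, pow_zero]
  | succ n ih =>
    rw [succ_nsmul, q_add, ih, P_nsmul_left, ← q_mul_self, ← sq, ← pow_mul, ← pow_succ, ← pow_add]
    congr 1
    ring

theorem isQuadraticRefinement_q :
    IsQuadraticRefinement (q L₃ L₂ L₁) (P L₃ L₂ L₁) :=
  ⟨P_add_left, P_add_right, q_add, q_nsmul⟩

/-- The radical of the pairing is `L₁₂ + L₂₃`, where `q` is trivial. -/
theorem exists_of_forall_P_eq_one {x : S L₃ L₂ L₁} (hx : ∀ y, P L₃ L₂ L₁ x y = 1) :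
    ∃ k₁ ∈ L₁.L ⊓ L₂.L, ∃ k₃ ∈ L₃.L ⊓ L₂.L, (x : D.G) = k₁ + k₃ := by
  obtain ⟨p, hp₁, hp₃, hp⟩ := exists_decomposition L₃ L₂ L₁ x
  have h := mem_sup_inf_of_forall_form_eq_zero L₁.admissible L₂.admissible L₃.admissible
    (x := p.2) fun y hy => by
      rw [form_eq_zero_iff]
      exact (P_eq ⟨y, hy⟩ hp₁ hp₃ hp).symm.trans (hx _)
  obtain ⟨l, hl, m, hm, hlm⟩ := Submodule.mem_sup.1 h
  have hl₃ : l ∈ L₃.L := by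
    rw [← add_sub_cancel_right l m, hlm]
    exact sub_mem hp₃ hm.2
  have e : (x : D.G) = (p.1 + m) + l := by
    rw [hp, ← hlm]
    abel
  refine ⟨p.1 + m, ⟨add_mem hp₁ hm.1, ?_⟩, l, ⟨hl₃, hl⟩, e⟩
  rw [← add_sub_cancel_right (p.1 + m) l, ← e]
  exact sub_mem x.2.1 hl

theorem isTame_q : IsTame (q L₃ L₂ L₁) (P L₃ L₂ L₁) := fun x hx => by
  obtain ⟨k₁, h₁, k₃, h₃, h⟩ := exists_of_forall_P_eq_one hx
  exact q_eq_one h₁.1 h₃.1 h h₁.2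

theorem P_pow_r (x y : S L₃ L₂ L₁) : P L₃ L₂ L₁ x y ^ D.r = 1 := by
  rw [P, ← B_nsmul_left, nsmul_r_eq_zero, B_zero_left]

/-- The values of `q` are `r`-th roots of unity; for `r` even this is where the quadratic refinement
`q_r` of the extra structure enters. -/
theorem q_pow_r (x : S L₃ L₂ L₁) : q L₃ L₂ L₁ x ^ D.r = 1 := by
  rcases Nat.even_or_odd D.r with he | ho
  · obtain ⟨p, hp₁, hp₃, hp⟩ := exists_decomposition L₃ L₂ L₁ x
    obtain ⟨P', hP', hPB⟩ := ε.q_refines he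
    have hr : D.r = 2 * (D.r / 2) := (Nat.two_mul_div_two_of_even he).symm
    have h1 : q L₃ L₂ L₁ x ^ D.r = D.B p.2 p.1 ^ (D.r / 2) := by
      nth_rewrite 1 [hr]
      rw [pow_mul, sq, q_mul_self, P_eq x hp₁ hp₃ hp, hp, B_add_right, B_self, mul_one]
    have hq : ∀ L : OrientedLL W ε, ∀ k ∈ L.L, ε.q (QuotientAddGroup.mk k) = 1 := fun L k hk => by
      obtain ⟨L', -, -, -, -, h⟩ := L.admissible
      exact h he k hk
    have h2 := hP'.map_add (QuotientAddGroup.mk p.2) (QuotientAddGroup.mk p.1)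
    rw [hPB, hq L₁ _ hp₁, hq L₃ _ hp₃, ← QuotientAddGroup.mk_add, add_comm, ← hp,
      hq L₂ _ x.2.1, one_mul, one_mul] at h2
    rw [h1, ← h2]
  -- for `r` odd, `q` has order dividing both `r²`, as `r x = 0`, and `2r`, as `q² = P`
  · have h1 : q L₃ L₂ L₁ x ^ (D.r * D.r) = 1 := by
      rw [← sq, ← q_nsmul]
      have : D.r • x = 0 := Subtype.ext (D.nsmul_r_eq_zero x)
      rw [this, q_zero]
    have h2 : q L₃ L₂ L₁ x ^ (D.r * 2) = 1 := by
      rw [mul_comm, pow_mul, sq, q_mul_self, P_pow_r]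
    have h3 := pow_gcd_eq_one.2 ⟨h1, h2⟩
    rwa [Nat.gcd_mul_left, (Nat.coprime_two_right.2 ho).gcd_eq_one, mul_one] at h3

/-! ### Composition of the intertwiners -/

variable (L₃ L₂ L₁)

/-- The Gauss sum by which the composition of two intertwiners differs from the third one. -/
def a : ℂ := gaussSum (q L₃ L₂ L₁)

theorem F_apply [Fintype L₁.L] (f : D.G → ℂ) : L₁.F f = ∑ k : L₁.L, ρ W ε (k : D.G) f := by
  rw [F, finsum_eq_sum_of_fintype, LinearMap.sum_apply]

theorem ρ_F {k : D.G} (hk : k ∈ L₁.L) (f : D.G → ℂ) : ρ W ε k (L₁.F f) = L₁.F f := by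
  have := Fintype.ofFinite L₁.L
  rw [F_apply, map_sum]
  refine Fintype.sum_equiv (Equiv.addRight (⟨k, hk⟩ : L₁.L)) _ _ fun l => ?_
  rw [ρ_ρ, L₁.admissible.φ_eq_one l.2 hk, one_smul]
  rfl

theorem F_ρ {k : D.G} (hk : k ∈ L₁.L) (f : D.G → ℂ) : L₁.F (ρ W ε k f) = L₁.F f := by
  have := Fintype.ofFinite L₁.L
  rw [F_apply, F_apply]
  refine Fintype.sum_equiv (Equiv.addLeft (⟨k, hk⟩ : L₁.L)) _ _ fun l => ?_
  rw [ρ_ρ, L₁.admissible.φ_eq_one hk l.2, one_smul]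
  rfl

theorem F_mem_I (f : D.G → ℂ) : L₁.F f ∈ L₁.I := fun _ hk => L₁.ρ_F hk f

theorem F_ρt (k : D.G) (f : D.G → ℂ) : L₁.F (ρt W ε k f) = ρt W ε k (L₁.F f) := by
  have := Fintype.ofFinite L₁.L
  rw [F_apply, F_apply, map_sum]
  exact Finset.sum_congr rfl fun l _ => ρ_ρt W ε _ _ _

variable {L₁}

/-- On vectors invariant under `L₁`, the operator of `k = k₁ + k₃` reduces after projection along `L₃`
to a scalar. -/
theorem F_ρ_of_mem {f : D.G → ℂ} (hf : f ∈ L₁.I) (k : S L₃ L₂ L₁) :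
    L₃.F (ρ W ε k f) = q L₃ L₂ L₁ k • L₃.F f := by
  obtain ⟨p, hp₁, hp₃, hp⟩ := exists_decomposition L₃ L₂ L₁ k
  have h := ρ_ρ W ε p.1 p.2 f
  rw [hf _ hp₁, ← hp] at h
  have h2 := congrArg L₃.F h
  rw [F_ρ L₃ hp₃, map_smul] at h2
  have h3 : q L₃ L₂ L₁ k * φ W ε p.1 p.2 = 1 := by
    have h4 := q_mul_self k
    rw [P_eq k hp₁ hp₃ hp, hp, B_add_right, B_self, mul_one] at h4
    nth_rewrite 1 [q_eq hp₁ hp₃ hp] at h4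
    rw [φ_comm, mul_assoc] at h4
    rw [mul_comm]
    exact mul_left_cancel₀ (B_ne_zero p.2 p.1) (h4.trans (mul_one _).symm)
  rw [h2, smul_smul, h3, one_smul]

/-- Outside `L₁ + L₃ = (L₁ ∩ L₃)^⊥` some `l ∈ L₁ ∩ L₃` has `B(l, k) ≠ 1`; it fixes the vector on both
sides, which forces the value to be zero. -/
theorem F_ρ_of_notMem {f : D.G → ℂ} (hf : f ∈ L₁.I) {k : D.G} (hk : k ∉ L₁.L ⊔ L₃.L) :
    L₃.F (ρ W ε k f) = 0 := by
  have h : ∃ l ∈ L₁.L ⊓ L₃.L, D.form l k ≠ 0 := by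
    by_contra! h
    exact hk (mem_sup_of_forall_form_eq_zero L₁.admissible L₃.admissible h)
  obtain ⟨l, hl, hlk⟩ := h
  have h1 := congrArg L₃.F (ρ_comm W ε l k f)
  rw [hf _ hl.1, map_smul, F_ρ L₃ hl.2] at h1
  by_contra h2
  refine hlk ((form_eq_zero_iff _ _).2 ?_)
  have h3 : (1 - D.B l k) • L₃.F (ρ W ε k f) = 0 := by
    rw [sub_smul, one_smul, ← h1, sub_self]
  exact (sub_eq_zero.1 ((smul_eq_zero.1 h3).resolve_right h2)).symm

/-- The composition of two intertwiners: the terms `k ∈ L₂` outside `L₁ + L₃` contribute nothing, and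
those in `S₂` contribute `q(k)`. -/
theorem F_F {f : D.G → ℂ} (hf : f ∈ L₁.I) : L₃.F (L₂.F f) = a L₃ L₂ L₁ • L₃.F f := by
  classical
  have := Fintype.ofFinite D.G
  have h1 : ∀ k : L₂.L, L₃.F (ρ W ε (k : D.G) f) =
      if h : (k : D.G) ∈ L₁.L ⊔ L₃.L then q L₃ L₂ L₁ ⟨k, k.2, h⟩ • L₃.F f else 0 := fun k => by
    split_ifs with h
    · exact F_ρ_of_mem L₃ L₂ hf ⟨k, k.2, h⟩
    · exact F_ρ_of_notMem L₃ hf h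
  rw [F_apply L₂, map_sum, Finset.sum_congr rfl fun k _ => h1 k, a, gaussSum,
    finsum_eq_sum_of_fintype, Finset.sum_smul]
  refine (Finset.sum_of_injOn (fun k : S L₃ L₂ L₁ => (⟨k, k.2.1⟩ : L₂.L)) ?_ ?_ ?_ ?_).symm
  · intro x _ y _ h
    exact Subtype.ext (congrArg (fun k : L₂.L => (k : D.G)) h)
  · exact fun _ _ => Finset.mem_coe.2 (Finset.mem_univ _)
  · intro k _ hk
    rw [dif_neg]
    intro h
    exact hk ⟨⟨k, k.2, h⟩, Finset.mem_coe.2 (Finset.mem_univ _), rfl⟩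
  · intro k _
    split_ifs with h
    · rfl
    · exact absurd (Submodule.mem_inf.1 k.2).2 h

variable (L₁)

/-- The intertwiners do not vanish: the value at `0` of the image of the projection of `δ₀` counts
`L₁ ∩ L₃`. -/
theorem exists_F_ne_zero : ∃ f ∈ L₁.I, L₃.F f ≠ 0 := by
  classical
  have := Fintype.ofFinite D.G
  refine ⟨_, L₁.F_mem_I (Pi.single 0 1), fun h => ?_⟩
  have h0 : ∀ (k₁ : L₁.L) (k₃ : L₃.L), ρ W ε (k₃ : D.G) (ρ W ε (k₁ : D.G) (Pi.single 0 1)) 0 =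
      if (k₁ : D.G) + k₃ = 0 then 1 else 0 := fun k₁ k₃ => by
    rw [ρ_ρ, Pi.smul_apply, ρ_single_zero_apply]
    simp only [eq_comm (a := (0 : D.G))]
    split_ifs with h0
    · have h1 : (k₁ : D.G) ∈ L₃.L := by rw [eq_neg_of_add_eq_zero_left h0]; exact neg_mem k₃.2
      rw [L₃.admissible.φ_eq_one h1 k₃.2, h0, L₃.admissible.φ_eq_one (zero_mem _) (zero_mem _),
        one_smul]
    · rw [smul_zero]
  have h1 := congrFun h 0
  rw [F_apply L₃, F_apply L₁, Finset.sum_apply] at h1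
  simp_rw [map_sum, Finset.sum_apply, h0] at h1
  rw [← Finset.sum_product', Finset.sum_boole, Pi.zero_apply, Nat.cast_eq_zero,
    Finset.card_eq_zero] at h1
  exact Finset.notMem_empty _ (h1 ▸ Finset.mem_filter.2 ⟨Finset.mem_univ ((0 : L₃.L), (0 : L₁.L)),
    by simp⟩)

theorem forall_F_F_eq_iff (c : ℂ) :
    (∀ f ∈ L₁.I, L₃.F (L₂.F f) = c • L₃.F f) ↔ c = a L₃ L₂ L₁ := by
  constructor
  · intro h
    obtain ⟨f, hf, hf0⟩ := exists_F_ne_zero L₃ L₁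
    have h1 := (h f hf).symm.trans (F_F L₃ L₂ hf)
    exact smul_left_injective ℂ hf0 h1
  · rintro rfl f hf
    exact F_F L₃ L₂ hf

/-- Associativity of the composition makes `a` a multiplicative cocycle. -/
theorem a_cocycle (L₀ : OrientedLL W ε) :
    a L₃ L₂ L₁ * a L₃ L₁ L₀ = a L₂ L₁ L₀ * a L₃ L₂ L₀ := by
  obtain ⟨f, hf, hf0⟩ := exists_F_ne_zero L₃ L₀
  refine smul_left_injective ℂ hf0 ?_
  change (a L₃ L₂ L₁ * a L₃ L₁ L₀) • L₃.F f = (a L₂ L₁ L₀ * a L₃ L₂ L₀) • L₃.F f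
  rw [mul_smul, mul_smul, ← F_F L₃ L₁ hf, ← F_F L₃ L₂ (L₁.F_mem_I f), F_F L₂ L₁ hf, map_smul,
    F_F L₃ L₂ hf]

end OrientedLL

end Background

end AbelianGauge

namespace AbelianGauge

/-! ### Bases adapted to Lagrangian subgroups -/

section Families

variable {R M ι κ : Type*} [CommRing R] [AddCommGroup M] [Module R M] [Fintype ι] [Fintype κ]

theorem linearIndependent_sumElim_iff (v : ι → M) (w : κ → M) :
    LinearIndependent R (Sum.elim v w) ↔ ∀ (a : ι → R) (b : κ → R),
      ∑ i, a i • v i + ∑ j, b j • w j = 0 → a = 0 ∧ b = 0 := by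
  rw [Fintype.linearIndependent_iff]
  constructor
  · intro h a b hab
    have h1 := h (Sum.elim a b) (by simpa [Fintype.sum_sum_type] using hab)
    exact ⟨funext fun i => h1 (.inl i), funext fun j => h1 (.inr j)⟩
  · intro h c hc
    obtain ⟨h1, h2⟩ := h (c ∘ .inl) (c ∘ .inr) (by simpa [Fintype.sum_sum_type] using hc)
    rintro (i | j)
    · exact congrFun h1 i
    · exact congrFun h2 j

theorem mem_span_range_sumElim_iff (v : ι → M) (w : κ → M) (x : M) :
    x ∈ Submodule.span R (Set.range (Sum.elim v w)) ↔
      ∃ (a : ι → R) (b : κ → R), ∑ i, a i • v i + ∑ j, b j • w j = x := by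
  rw [Submodule.mem_span_range_iff_exists_fun]
  constructor
  · rintro ⟨c, hc⟩
    exact ⟨c ∘ .inl, c ∘ .inr, by simpa [Fintype.sum_sum_type] using hc⟩
  · rintro ⟨a, b, hab⟩
    exact ⟨Sum.elim a b, by simpa [Fintype.sum_sum_type] using hab⟩

theorem eq_zero_of_sum_smul_eq_zero {v : ι → M} (hv : LinearIndependent R v) {a : ι → R}
    (h : ∑ i, a i • v i = 0) : a = 0 := funext (Fintype.linearIndependent_iff.1 hv a h)

theorem sum_smul_mem {N : Submodule R M} {v : ι → M} (hv : ∀ i, v i ∈ N) (a : ι → R) :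
    ∑ i, a i • v i ∈ N := N.sum_mem fun i _ => N.smul_mem _ (hv i)

/-- Two independent families extending a common one are jointly independent if their spans meet in
the span of the common part. -/
theorem linearIndependent_sumElim_sumElim {μ : Type*} [Fintype μ] {u : μ → M} {v : ι → M}
    {w : κ → M} (hv : LinearIndependent R (Sum.elim u v)) (hw : LinearIndependent R (Sum.elim u w))
    (h : ∀ x ∈ Submodule.span R (Set.range (Sum.elim u v)),
      x ∈ Submodule.span R (Set.range (Sum.elim u w)) → x ∈ Submodule.span R (Set.range u)) :
    LinearIndependent R (Sum.elim u (Sum.elim v w)) := by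
  rw [linearIndependent_sumElim_iff] at hv hw ⊢
  intro a c hc
  simp only [Fintype.sum_sum_type, Sum.elim_inl, Sum.elim_inr] at hc
  have h1 := h (∑ i, a i • u i + ∑ i, c (.inl i) • v i)
    ((mem_span_range_sumElim_iff _ _ _).2 ⟨_, _, rfl⟩)
    ((mem_span_range_sumElim_iff _ _ _).2 ⟨0, fun i => -c (.inr i), by
      simp only [Pi.zero_apply, zero_smul, Finset.sum_const_zero, zero_add, neg_smul,
        Finset.sum_neg_distrib]
      rw [← add_assoc] at hc
      exact (eq_neg_of_add_eq_zero_left hc).symm⟩)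
  obtain ⟨d, hd⟩ := (Submodule.mem_span_range_iff_exists_fun R).1 h1
  have h2 := (hv (a - d) (fun i => c (.inl i)) (by
    simp only [Pi.sub_apply, sub_smul, Finset.sum_sub_distrib]
    rw [hd]
    abel)).2
  have h3 := hw a (fun i => c (.inr i)) (by
    have h4 : ∑ i, c (.inl i) • v i = 0 :=
      Finset.sum_eq_zero fun i _ => by rw [show c (.inl i) = 0 from congrFun h2 i, zero_smul]
    rwa [h4, zero_add] at hc)
  refine ⟨h3.1, funext ?_⟩
  rintro (i | j)
  · exact congrFun h2 i
  · exact congrFun h3.2 j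

end Families

namespace Background

variable {D : Background.{u, v}}

theorem form_sum_right {ι : Type*} [Fintype ι] (x : D.G) (a : ι → ZMod D.r) (w : ι → D.G) :
    D.form x (∑ i, a i • w i) = ∑ i, a i * D.form x (w i) := by
  rw [map_sum]
  simp only [map_smul, smul_eq_mul]

theorem form_sum_left {ι : Type*} [Fintype ι] (x : D.G) (a : ι → ZMod D.r) (w : ι → D.G) :
    D.form (∑ i, a i • w i) x = ∑ i, a i * D.form (w i) x := by
  rw [map_sum, LinearMap.sum_apply]
  simp only [map_smul, LinearMap.smul_apply, smul_eq_mul]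

/-- Prescribing the values of the pairing with a family, for elements of a subgroup. -/
theorem exists_form_eq {ι : Type*} [Fintype ι] (M : Submodule (ZMod D.r) D.G) (w : ι → D.G)
    (hw : ∀ a : ι → ZMod D.r, (∀ x ∈ M, D.form x (∑ i, a i • w i) = 0) → a = 0)
    (c : ι → ZMod D.r) : ∃ x ∈ M, ∀ i, D.form x (w i) = c i := by
  let f : M →ₗ[ZMod D.r] (ι → ZMod D.r) := LinearMap.pi fun i => (D.form.flip (w i)).comp M.subtype
  obtain ⟨x, hx⟩ := surjective_of_forall_dotProduct f (fun a ha => hw a fun x hx => by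
    rw [form_sum_right, ← ha ⟨x, hx⟩]
    exact Finset.sum_congr rfl fun i _ => mul_comm _ _) c
  exact ⟨x, x.2, fun i => congrFun hx i⟩

/-- The common orthogonal, inside a free subgroup, of a family with a dual family is free. -/
theorem free_inf_of_dual {ι : Type*} [Fintype ι] [DecidableEq ι] (M N : Submodule (ZMod D.r) D.G)
    [Module.Free (ZMod D.r) M] (w g : ι → D.G) (hw : ∀ i, w i ∈ M)
    (hgw : ∀ i j, D.form (g i) (w j) = if i = j then 1 else 0)
    (hN : ∀ x, x ∈ N ↔ x ∈ M ∧ ∀ i, D.form (g i) x = 0) :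
    Module.Free (ZMod D.r) N ∧ ∀ x ∈ M, x - ∑ i, D.form (g i) x • w i ∈ N := by
  have h1 : ∀ x ∈ M, x - ∑ i, D.form (g i) x • w i ∈ N := fun x hx => by
    refine (hN _).2 ⟨sub_mem hx (sum_smul_mem hw _), fun i => ?_⟩
    rw [map_sub, form_sum_right, sub_eq_zero]
    simp only [hgw, mul_ite, mul_one, mul_zero]
    rw [Finset.sum_ite_eq, if_pos (Finset.mem_univ i)]
  refine ⟨?_, h1⟩
  let p : M →ₗ[ZMod D.r] N := LinearMap.codRestrict N
    (M.subtype - ∑ i, (((D.form (g i)).comp M.subtype).smulRight (w i))) (fun x => by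
      simpa using h1 x x.2)
  refine free_of_projection D.isPrimePow_r
    (Submodule.inclusion fun x hx => ((hN x).1 hx).1 : N →ₗ[ZMod D.r] M) p ?_
  ext x
  have hx := ((hN x).1 x.2).2
  simp [p, hx]

/-- An independent family in a free subgroup extends to a basis. -/
theorem exists_extend {ι : Type*} [Fintype ι] (M : Submodule (ZMod D.r) D.G)
    [Module.Free (ZMod D.r) M] {w : ι → D.G} (hw : LinearIndependent (ZMod D.r) w)
    (hwM : ∀ i, w i ∈ M) : ∃ (s : ℕ) (x : Fin s → D.G), (∀ i, x i ∈ M) ∧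
      LinearIndependent (ZMod D.r) (Sum.elim w x) ∧
      Submodule.span (ZMod D.r) (Set.range (Sum.elim w x)) = M := by
  classical
  have : Nontrivial (ZMod D.r) := ZMod.nontrivial_iff.2 D.isPrimePow_r.ne_one
  choose g _ hg using fun i : ι => exists_form_eq ⊤ w (fun a ha => eq_zero_of_sum_smul_eq_zero hw
    (form_nondegenerate fun y => by rw [form_antisymm, ha y trivial, neg_zero]))
    (fun j => if i = j then 1 else 0)
  let N : Submodule (ZMod D.r) D.G := M ⊓ ⨅ i, LinearMap.ker (D.form (g i))
  have hN : ∀ x, x ∈ N ↔ x ∈ M ∧ ∀ i, D.form (g i) x = 0 := fun x => by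
    simp [N, Submodule.mem_inf, Submodule.mem_iInf]
  obtain ⟨hfree, hp⟩ := free_inf_of_dual M N w g hwM hg hN
  have : Module.Finite (ZMod D.r) N := Module.Finite.of_finite
  let b := Module.finBasis (ZMod D.r) N
  have hbg : ∀ i j, D.form (g i) (b j : D.G) = 0 := fun i j => ((hN _).1 (b j).2).2 i
  have hbM : ∀ j, (b j : D.G) ∈ M := fun j => ((hN _).1 (b j).2).1
  refine ⟨_, fun i => b i, hbM, ?_, le_antisymm ?_ ?_⟩
  · rw [linearIndependent_sumElim_iff]
    intro a c hac
    have ha : a = 0 := by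
      ext i
      have h := congrArg (D.form (g i)) hac
      rw [map_add, form_sum_right, form_sum_right, map_zero] at h
      simpa [hg, hbg] using h
    refine ⟨ha, eq_zero_of_sum_smul_eq_zero b.linearIndependent (Subtype.ext ?_)⟩
    rw [ha] at hac
    simpa using hac
  · rw [Submodule.span_le]
    rintro _ ⟨i | j, rfl⟩
    · exact hwM i
    · exact hbM j
  · intro x hx
    rw [mem_span_range_sumElim_iff]
    have h := congrArg Subtype.val (b.sum_repr ⟨_, hp x hx⟩)
    rw [Submodule.coe_sum] at h
    refine ⟨_, _, (congrArg (∑ i, D.form (g i) x • w i + ·) h).trans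
      (add_sub_cancel _ _)⟩

section OneSide

variable {W : D.WuRefinement} {ε : D.ExtraStructure} {L₁ L₂ L₃ : Submodule (ZMod D.r) D.G}
  {k p q t s : ℕ} {e : Fin k → D.G} {α : Fin p → D.G} {β : Fin q → D.G} {γ : Fin t → D.G}
  {η : Fin q → D.G} {δ₁ δ₂ δ₃ : Fin s → D.G}

/-- A basis of `L₂ ∩ (L₁ + L₃)` adapted to the intersections determines a basis of `L₁`: the parts
in `L₁` of the elements `δ₂`, and elements dual to `β`, are added to the basis of
`L₁ ∩ L₂ + L₁ ∩ L₃`. -/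
theorem basis_of_decomposition (h₁ : IsAdmissible W ε L₁) (h₂ : IsAdmissible W ε L₂)
    (h₃ : IsAdmissible W ε L₃)
    (h₁₂ : Submodule.span (ZMod D.r) (Set.range (Sum.elim e α)) = L₁ ⊓ L₂)
    (h₂₃ : Submodule.span (ZMod D.r) (Set.range (Sum.elim e β)) = L₂ ⊓ L₃)
    (h₁₃ : Submodule.span (ZMod D.r) (Set.range (Sum.elim e γ)) = L₁ ⊓ L₃)
    (li₁₃ : LinearIndependent (ZMod D.r) (Sum.elim e γ))
    (li : LinearIndependent (ZMod D.r) (Sum.elim (Sum.elim e (Sum.elim α β)) δ₂))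
    (hS : Submodule.span (ZMod D.r) (Set.range (Sum.elim (Sum.elim e (Sum.elim α β)) δ₂)) =
      L₂ ⊓ (L₁ ⊔ L₃))
    (hη : ∀ i, η i ∈ L₁) (hηβ : ∀ i j, D.form (η i) (β j) = if i = j then 1 else 0)
    (hδ₁ : ∀ i, δ₁ i ∈ L₁) (hδ₃ : ∀ i, δ₃ i ∈ L₃) (hδ : ∀ i, δ₂ i = δ₁ i + δ₃ i) :
    LinearIndependent (ZMod D.r) (Sum.elim e (Sum.elim α (Sum.elim η (Sum.elim γ δ₁)))) ∧
    Submodule.span (ZMod D.r) (Set.range (Sum.elim e (Sum.elim α (Sum.elim η (Sum.elim γ δ₁))))) =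
      L₁ := by
  have he : ∀ i, e i ∈ L₁ ⊓ L₂ := fun i => h₁₂ ▸ Submodule.subset_span ⟨.inl i, rfl⟩
  have he' : ∀ i, e i ∈ L₁ ⊓ L₃ := fun i => h₁₃ ▸ Submodule.subset_span ⟨.inl i, rfl⟩
  have hα : ∀ i, α i ∈ L₁ ⊓ L₂ := fun i => h₁₂ ▸ Submodule.subset_span ⟨.inr i, rfl⟩
  have hβ : ∀ i, β i ∈ L₂ ⊓ L₃ := fun i => h₂₃ ▸ Submodule.subset_span ⟨.inr i, rfl⟩
  have hγ : ∀ i, γ i ∈ L₁ ⊓ L₃ := fun i => h₁₃ ▸ Submodule.subset_span ⟨.inr i, rfl⟩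
  have hδ₂ : ∀ i, δ₂ i ∈ L₂ ⊓ (L₁ ⊔ L₃) := fun i => hS ▸ Submodule.subset_span ⟨.inr i, rfl⟩
  have hβδ : ∀ i j, D.form (β i) (δ₁ j) = 0 := fun i j => by
    rw [eq_sub_of_add_eq (hδ j).symm, map_sub, h₂.form_eq_zero (hβ i).1 (hδ₂ j).1,
      h₃.form_eq_zero (hβ i).2 (hδ₃ j), sub_zero]
  have hβη : ∀ i j, D.form (β i) (η j) = if j = i then -1 else 0 := fun i j => by
    rw [form_antisymm, hηβ]
    split_ifs <;> simp
  have hsumδ : ∀ f : Fin s → ZMod D.r,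
      ∑ i, f i • δ₂ i = ∑ i, f i • δ₁ i + ∑ i, f i • δ₃ i := fun f => by
    simp only [hδ, smul_add, Finset.sum_add_distrib]
  constructor
  · rw [linearIndependent_sumElim_iff] at li li₁₃
    rw [Fintype.linearIndependent_iff]
    intro c hc
    simp only [Fintype.sum_sum_type, Sum.elim_inl, Sum.elim_inr] at hc li
    -- pairing with `β` isolates the coefficients of `η`
    have c₃ : ∀ i, c (.inr (.inr (.inl i))) = 0 := fun i => by
      have h := congrArg (D.form (β i)) hc
      simp only [map_add, form_sum_right, map_zero, hβδ, hβη,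
        fun j => h₂.form_eq_zero (hβ i).1 (he j).2, fun j => h₂.form_eq_zero (hβ i).1 (hα j).2,
        fun j => h₃.form_eq_zero (hβ i).2 (hγ j).2] at h
      simpa using h
    simp only [c₃, zero_smul, Finset.sum_const_zero, zero_add] at hc
    have hmem : ∑ i, c (.inl i) • e i + ∑ i, c (.inr (.inl i)) • α i +
        ∑ i, c (.inr (.inr (.inr (.inr i)))) • δ₂ i ∈ L₂ ⊓ L₃ := by
      refine ⟨add_mem (add_mem (sum_smul_mem (fun i => (he i).2) _)
        (sum_smul_mem (fun i => (hα i).2) _)) (sum_smul_mem (fun i => (hδ₂ i).1) _), ?_⟩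
      have h : ∑ i, c (.inl i) • e i + ∑ i, c (.inr (.inl i)) • α i +
          ∑ i, c (.inr (.inr (.inr (.inr i)))) • δ₂ i =
          ∑ i, c (.inr (.inr (.inr (.inr i)))) • δ₃ i -
            ∑ i, c (.inr (.inr (.inr (.inl i)))) • γ i := by
        rw [hsumδ, eq_sub_iff_add_eq, ← sub_eq_zero, ← hc]
        abel
      rw [h]
      exact sub_mem (sum_smul_mem hδ₃ _) (sum_smul_mem (fun i => (hγ i).2) _)
    rw [← h₂₃, mem_span_range_sumElim_iff] at hmem
    obtain ⟨a, b, hab⟩ := hmem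
    have h4 := li (Sum.elim (fun i => c (.inl i) - a i) (Sum.elim (fun i => c (.inr (.inl i)))
      (fun i => -b i))) (fun i => c (.inr (.inr (.inr (.inr i))))) (by
        simp only [Sum.elim_inl, Sum.elim_inr, sub_smul, neg_smul, Finset.sum_sub_distrib,
          Finset.sum_neg_distrib]
        rw [← sub_eq_zero] at hab
        rw [← neg_eq_zero, ← hab]
        abel)
    have c₂ : ∀ i, c (.inr (.inl i)) = 0 := fun i => congrFun h4.1 (.inr (.inl i))
    have c₅ : ∀ i, c (.inr (.inr (.inr (.inr i)))) = 0 := congrFun h4.2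
    simp only [c₂, c₅, zero_smul, Finset.sum_const_zero, zero_add, add_zero] at hc
    have h5 := li₁₃ (fun i => c (.inl i)) (fun i => c (.inr (.inr (.inr (.inl i))))) hc
    rintro (i | i | i | i | i)
    exacts [congrFun h5.1 i, c₂ i, c₃ i, congrFun h5.2 i, c₅ i]
  · refine le_antisymm ?_ fun x hx => ?_
    · rw [Submodule.span_le]
      rintro _ ⟨i | i | i | i | i, rfl⟩
      exacts [(he i).1, (hα i).1, hη i, (hγ i).1, hδ₁ i]
    -- after subtracting a combination of `η`, the element is orthogonal to `L₂ ∩ L₃`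
    set x' := x - ∑ i, D.form x (β i) • η i with hx'
    have hx₁ : x' ∈ L₁ := sub_mem hx (sum_smul_mem hη _)
    have hxβ : ∀ j, D.form x' (β j) = 0 := fun j => by
      rw [hx', map_sub, LinearMap.sub_apply, form_sum_left]
      simp [hηβ]
    have hx₂ : x' ∈ L₂ ⊔ L₃ := mem_sup_of_forall_form_eq_zero h₂ h₃ fun l hl => by
      rw [← h₂₃, mem_span_range_sumElim_iff] at hl
      obtain ⟨a, b, rfl⟩ := hl
      rw [form_antisymm, map_add, form_sum_right, form_sum_right]
      simp [hxβ, fun j => h₁.form_eq_zero hx₁ (he j).1]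
    obtain ⟨y, hy, z, hz, hyz⟩ := Submodule.mem_sup.1 hx₂
    have hyS : y ∈ L₂ ⊓ (L₁ ⊔ L₃) :=
      ⟨hy, by rw [← add_sub_cancel_right y z, hyz]
              exact sub_mem (Submodule.mem_sup_left hx₁) (Submodule.mem_sup_right hz)⟩
    rw [← hS, mem_span_range_sumElim_iff] at hyS
    obtain ⟨c, f, hcf⟩ := hyS
    simp only [Fintype.sum_sum_type, Sum.elim_inl, Sum.elim_inr] at hcf
    have hm : x' - (∑ i, c (.inl i) • e i + ∑ i, c (.inr (.inl i)) • α i + ∑ i, f i • δ₁ i) ∈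
        L₁ ⊓ L₃ := by
      refine ⟨sub_mem hx₁ (add_mem (add_mem (sum_smul_mem (fun i => (he i).1) _)
        (sum_smul_mem (fun i => (hα i).1) _)) (sum_smul_mem hδ₁ _)), ?_⟩
      have h : x' - (∑ i, c (.inl i) • e i + ∑ i, c (.inr (.inl i)) • α i + ∑ i, f i • δ₁ i) =
          ∑ i, c (.inr (.inr i)) • β i + ∑ i, f i • δ₃ i + z := by
        rw [← hyz, ← hcf, hsumδ]
        abel
      rw [h]
      exact add_mem (add_mem (sum_smul_mem (fun i => (hβ i).2) _) (sum_smul_mem hδ₃ _)) hz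
    rw [← h₁₃, mem_span_range_sumElim_iff] at hm
    obtain ⟨a, b, hab⟩ := hm
    rw [Submodule.mem_span_range_iff_exists_fun]
    refine ⟨Sum.elim (fun i => a i + c (.inl i)) (Sum.elim (fun i => c (.inr (.inl i)))
      (Sum.elim (fun i => D.form x (β i)) (Sum.elim b f))), ?_⟩
    simp only [Fintype.sum_sum_type, Sum.elim_inl, Sum.elim_inr, add_smul, Finset.sum_add_distrib]
    rw [hx', eq_sub_iff_add_eq, eq_sub_iff_add_eq] at hab
    refine Eq.trans ?_ hab
    abel

end OneSide

/-- Families adapted to three Lagrangian subgroups of `G`, indexed by five blocks: `e`, `α`, `β`,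
`γ` span the intersections, `η₁`, `η₂`, `η₃` are dual to `β`, `γ`, `α`, and `δ₂` completes
`e, α, β` to a basis of `L₂ ∩ (L₁ + L₃)`. -/
structure AdaptedBases (L₁ L₂ L₃ : Submodule (ZMod D.r) D.G) where
  {k p q t s : ℕ}
  e : Fin k → D.G
  α : Fin p → D.G
  β : Fin q → D.G
  γ : Fin t → D.G
  η₁ : Fin q → D.G
  η₂ : Fin t → D.G
  η₃ : Fin p → D.G
  δ₁ : Fin s → D.G
  δ₂ : Fin s → D.G
  δ₃ : Fin s → D.G
  span₁₂ : Submodule.span (ZMod D.r) (Set.range (Sum.elim e α)) = L₁ ⊓ L₂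
  span₂₃ : Submodule.span (ZMod D.r) (Set.range (Sum.elim e β)) = L₂ ⊓ L₃
  span₁₃ : Submodule.span (ZMod D.r) (Set.range (Sum.elim e γ)) = L₁ ⊓ L₃
  spanS : Submodule.span (ZMod D.r) (Set.range (Sum.elim (Sum.elim e (Sum.elim α β)) δ₂)) =
    L₂ ⊓ (L₁ ⊔ L₃)
  li₁ : LinearIndependent (ZMod D.r) (Sum.elim e (Sum.elim α (Sum.elim η₁ (Sum.elim γ δ₁))))
  span₁ : Submodule.span (ZMod D.r)
    (Set.range (Sum.elim e (Sum.elim α (Sum.elim η₁ (Sum.elim γ δ₁))))) = L₁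
  li₂ : LinearIndependent (ZMod D.r) (Sum.elim e (Sum.elim α (Sum.elim β (Sum.elim η₂ δ₂))))
  span₂ : Submodule.span (ZMod D.r)
    (Set.range (Sum.elim e (Sum.elim α (Sum.elim β (Sum.elim η₂ δ₂))))) = L₂
  li₃ : LinearIndependent (ZMod D.r) (Sum.elim e (Sum.elim η₃ (Sum.elim β (Sum.elim γ δ₃))))
  span₃ : Submodule.span (ZMod D.r)
    (Set.range (Sum.elim e (Sum.elim η₃ (Sum.elim β (Sum.elim γ δ₃))))) = L₃
  η₁_β : ∀ i j, D.form (η₁ i) (β j) = if i = j then 1 else 0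
  η₂_γ : ∀ i j, D.form (η₂ i) (γ j) = if i = j then 1 else 0
  η₃_α : ∀ i j, D.form (η₃ i) (α j) = if i = j then 1 else 0
  δ_eq : ∀ i, δ₂ i = δ₁ i + δ₃ i

theorem exists_basis_family (N : Submodule (ZMod D.r) D.G) [Module.Free (ZMod D.r) N] :
    ∃ (k : ℕ) (e : Fin k → D.G), LinearIndependent (ZMod D.r) e ∧
      Submodule.span (ZMod D.r) (Set.range e) = N := by
  have : Nontrivial (ZMod D.r) := ZMod.nontrivial_iff.2 D.isPrimePow_r.ne_one
  have : Module.Finite (ZMod D.r) N := Module.Finite.of_finite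
  let b := Module.finBasis (ZMod D.r) N
  refine ⟨_, fun i => b i, b.linearIndependent.map' N.subtype N.ker_subtype, ?_⟩
  change Submodule.span _ (Set.range (N.subtype ∘ b)) = N
  rw [Set.range_comp, ← Submodule.map_span, b.span_eq, Submodule.map_top, N.range_subtype]

theorem linearIndependent_and_span_of_equiv {ι κ : Type*} {v : ι → D.G} {w : κ → D.G}
    {N : Submodule (ZMod D.r) D.G} (E : κ ≃ ι) (hE : v ∘ E = w)
    (h : LinearIndependent (ZMod D.r) v ∧ Submodule.span (ZMod D.r) (Set.range v) = N) :
    LinearIndependent (ZMod D.r) w ∧ Submodule.span (ZMod D.r) (Set.range w) = N := by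
  subst hE
  rwa [linearIndependent_equiv, E.surjective.range_comp]

section Lagrangian

variable {W : D.WuRefinement} {ε : D.ExtraStructure} {L₁ L₂ L₃ : Submodule (ZMod D.r) D.G}

theorem IsAdmissible.nonempty_basis (h : IsAdmissible W ε L₁) :
    Nonempty (Module.Basis (Fin D.n) (ZMod D.r) L₁) := by
  obtain ⟨L', hL', rfl, -⟩ := h
  exact hL'.nonempty_basis

theorem IsAdmissible.free (h : IsAdmissible W ε L₁) : Module.Free (ZMod D.r) L₁ :=
  Module.Free.of_basis h.nonempty_basis.some

/-- A family which is independent modulo `L₁` has a dual family in `L₁`, as `L₁` is its own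
orthogonal. -/
theorem IsAdmissible.exists_dual (h : IsAdmissible W ε L₁) {k t : ℕ} {e : Fin k → D.G}
    {γ : Fin t → D.G} (li : LinearIndependent (ZMod D.r) (Sum.elim e γ))
    (hL : ∀ x ∈ Submodule.span (ZMod D.r) (Set.range (Sum.elim e γ)), x ∈ L₁ →
      x ∈ Submodule.span (ZMod D.r) (Set.range e)) :
    ∃ η : Fin t → D.G, (∀ i, η i ∈ L₁) ∧
      ∀ i j, D.form (η i) (γ j) = if i = j then 1 else 0 := by
  choose η hη hηγ using fun i : Fin t => exists_form_eq L₁ γ (fun a ha => by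
    have h1 : ∑ i, a i • γ i ∈ L₁ := h.mem fun y hy => by rw [form_antisymm, ha y hy, neg_zero]
    have h2 := hL _ ((mem_span_range_sumElim_iff _ _ _).2 ⟨0, a, by simp⟩) h1
    obtain ⟨c, hc⟩ := (Submodule.mem_span_range_iff_exists_fun _).1 h2
    exact ((linearIndependent_sumElim_iff _ _).1 li (-c) a (by simp [hc])).2)
    (fun j => if i = j then 1 else 0)
  exact ⟨η, hη, hηγ⟩

/-- Adapted bases exist as soon as the double and triple intersections are free. -/
theorem nonempty_adaptedBases (h₁ : IsAdmissible W ε L₁) (h₂ : IsAdmissible W ε L₂)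
    (h₃ : IsAdmissible W ε L₃) (f₁₂ : Module.Free (ZMod D.r) ↥(L₁ ⊓ L₂))
    (f₂₃ : Module.Free (ZMod D.r) ↥(L₂ ⊓ L₃)) (f₁₃ : Module.Free (ZMod D.r) ↥(L₁ ⊓ L₃))
    (f : Module.Free (ZMod D.r) ↥(L₁ ⊓ L₂ ⊓ L₃)) : Nonempty (AdaptedBases L₁ L₂ L₃) := by
  have := h₂.free
  obtain ⟨k, e, li_e, span_e⟩ := exists_basis_family (L₁ ⊓ L₂ ⊓ L₃)
  have he : ∀ i, e i ∈ L₁ ⊓ L₂ ⊓ L₃ := fun i => span_e ▸ Submodule.subset_span ⟨i, rfl⟩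
  obtain ⟨p, α, hα, li₁₂, span₁₂⟩ := exists_extend (L₁ ⊓ L₂) li_e fun i => (he i).1
  obtain ⟨q, β, hβ, li₂₃, span₂₃⟩ := exists_extend (L₂ ⊓ L₃) li_e fun i => ⟨(he i).1.2, (he i).2⟩
  obtain ⟨t, γ, hγ, li₁₃, span₁₃⟩ := exists_extend (L₁ ⊓ L₃) li_e fun i => ⟨(he i).1.1, (he i).2⟩
  have li : LinearIndependent (ZMod D.r) (Sum.elim e (Sum.elim α β)) := by
    refine linearIndependent_sumElim_sumElim li₁₂ li₂₃ fun x hx hx' => ?_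
    rw [span₁₂] at hx
    rw [span₂₃] at hx'
    rw [span_e]
    exact ⟨hx, hx'.2⟩
  obtain ⟨η₁, hη₁, hη₁β⟩ := h₁.exists_dual li₂₃ (fun x hx hx' => by
    rw [span₂₃] at hx
    rw [span_e]
    exact ⟨⟨hx', hx.1⟩, hx.2⟩)
  obtain ⟨η₂, hη₂, hη₂γ⟩ := h₂.exists_dual li₁₃ (fun x hx hx' => by
    rw [span₁₃] at hx
    rw [span_e]
    exact ⟨⟨hx.1, hx'⟩, hx.2⟩)
  obtain ⟨η₃, hη₃, hη₃α⟩ := h₃.exists_dual li₁₂ (fun x hx hx' => by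
    rw [span₁₂] at hx
    rw [span_e]
    exact ⟨hx, hx'⟩)
  -- `S₂` is the orthogonal of the family `-γ` inside `L₂`, where `η₂` is dual to it: hence `S₂` is free,
  -- and `L₂` is the sum of `S₂` and the span of `η₂`
  have hγη : ∀ i j, D.form (-γ i) (η₂ j) = if i = j then 1 else 0 := fun i j => by
    rw [map_neg, LinearMap.neg_apply, ← form_antisymm, hη₂γ]
    simp only [eq_comm]
  have hγS : ∀ i, ∀ x ∈ L₁ ⊔ L₃, D.form (-γ i) x = 0 := fun i x hx => by
    obtain ⟨y, hy, z, hz, rfl⟩ := Submodule.mem_sup.1 hx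
    rw [map_neg, LinearMap.neg_apply, map_add, h₁.form_eq_zero (hγ i).1 hy,
      h₃.form_eq_zero (hγ i).2 hz, add_zero, neg_zero]
  obtain ⟨fS, hS⟩ := free_inf_of_dual L₂ (L₂ ⊓ (L₁ ⊔ L₃)) η₂ (fun i => -γ i) hη₂ hγη fun x => by
    refine and_congr_right fun hx => ⟨fun h i => hγS i x h, fun h => ?_⟩
    refine mem_sup_of_forall_form_eq_zero h₁ h₃ fun l hl => ?_
    rw [← span₁₃, mem_span_range_sumElim_iff] at hl
    obtain ⟨a, b, rfl⟩ := hl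
    rw [map_add, LinearMap.add_apply, form_sum_left, form_sum_left]
    have h' : ∀ i, D.form (γ i) x = 0 := fun i => by simpa using h i
    simp [h', fun j => h₂.form_eq_zero (he j).1.2 hx]
  obtain ⟨s, δ₂, hδ₂, liS, spanS⟩ := exists_extend (L₂ ⊓ (L₁ ⊔ L₃)) li (by
    rintro (i | i | i)
    · exact ⟨(he i).1.2, Submodule.mem_sup_left (he i).1.1⟩
    · exact ⟨(hα i).2, Submodule.mem_sup_left (hα i).1⟩
    · exact ⟨(hβ i).1, Submodule.mem_sup_right (hβ i).2⟩)
  choose δ₁ hδ₁ δ₃ hδ₃ hδ using fun i => Submodule.mem_sup.1 (hδ₂ i).2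
  obtain ⟨li₁, span₁⟩ := basis_of_decomposition h₁ h₂ h₃ span₁₂ span₂₃ span₁₃ li₁₃ liS spanS hη₁
    hη₁β hδ₁ hδ₃ fun i => (hδ i).symm
  obtain ⟨liS', spanS'⟩ := linearIndependent_and_span_of_equiv
    (w := Sum.elim (Sum.elim e (Sum.elim β α)) δ₂)
    (((Equiv.refl _).sumCongr (Equiv.sumComm _ _)).sumCongr (Equiv.refl _))
    (by ext ((i | i | i) | i) <;> rfl) ⟨liS, spanS⟩
  -- the basis of `L₃` is found by exchanging the roles of `L₁` and `L₃`, hence those of `α` and `β`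
  have h₃' := basis_of_decomposition h₃ h₂ h₁ (span₂₃.trans (inf_comm _ _))
    (span₁₂.trans (inf_comm _ _)) (span₁₃.trans (inf_comm _ _)) li₁₃ liS' (spanS'.trans (by rw [sup_comm])) hη₃ hη₃α hδ₃ hδ₁
    fun i => by rw [add_comm, hδ]
  obtain ⟨li₃, span₃⟩ := linearIndependent_and_span_of_equiv
    (w := Sum.elim e (Sum.elim η₃ (Sum.elim β (Sum.elim γ δ₃))))
    ((Equiv.refl _).sumCongr ((Equiv.sumAssoc _ _ _).symm.trans
      (((Equiv.sumComm _ _).sumCongr (Equiv.refl _)).trans (Equiv.sumAssoc _ _ _))))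
    (by ext (i | i | i | i | i) <;> rfl) h₃'
  have hv₂ : LinearIndependent (ZMod D.r)
      (Sum.elim (Sum.elim (Sum.elim e (Sum.elim α β)) δ₂) η₂) ∧ Submodule.span (ZMod D.r)
      (Set.range (Sum.elim (Sum.elim (Sum.elim e (Sum.elim α β)) δ₂) η₂)) = L₂ := by
    have hm : ∀ i, Sum.elim (Sum.elim e (Sum.elim α β)) δ₂ i ∈ L₂ ⊓ (L₁ ⊔ L₃) := fun i =>
      spanS ▸ Submodule.subset_span ⟨i, rfl⟩
    refine ⟨(linearIndependent_sumElim_iff _ _).2 fun a b hab => ?_, le_antisymm ?_ fun x hx => ?_⟩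
    · have hb : b = 0 := by
        ext i
        have h := congrArg (D.form (-γ i)) hab
        rw [map_add, form_sum_right, form_sum_right, map_zero] at h
        simp only [hγη, fun j => hγS i _ (hm j).2] at h
        simpa using h
      rw [hb] at hab
      exact ⟨eq_zero_of_sum_smul_eq_zero liS (by simpa using hab), hb⟩
    · rw [Submodule.span_le]
      rintro _ ⟨i | i, rfl⟩
      exacts [(hm i).1, hη₂ i]
    · have h := hS x hx
      rw [← spanS, Submodule.mem_span_range_iff_exists_fun] at h
      obtain ⟨a, ha⟩ := h
      exact (mem_span_range_sumElim_iff _ _ _).2 ⟨a, _, eq_sub_iff_add_eq.1 ha⟩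
  obtain ⟨li₂, span₂⟩ := linearIndependent_and_span_of_equiv
    (w := Sum.elim e (Sum.elim α (Sum.elim β (Sum.elim η₂ δ₂))))
    (((Equiv.refl _).sumCongr (((Equiv.refl _).sumCongr
      (((Equiv.refl _).sumCongr (Equiv.sumComm _ _)).trans (Equiv.sumAssoc _ _ _).symm)).trans
        (Equiv.sumAssoc _ _ _).symm)).trans ((Equiv.sumAssoc _ _ _).symm.trans
          ((((Equiv.refl _).sumCongr (Equiv.sumAssoc _ _ _).symm).trans
            (Equiv.sumAssoc _ _ _).symm).sumCongr (Equiv.refl _))))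
    (by ext (i | i | i | i | i) <;> rfl) hv₂
  exact ⟨⟨e, α, β, γ, η₁, η₂, η₃, δ₁, δ₂, δ₃, span₁₂, span₂₃, span₁₃, spanS, li₁, span₁, li₂, span₂,
    li₃, span₃, hη₁β, hη₂γ, hη₃α, fun i => (hδ i).symm⟩⟩

end Lagrangian

/-! ### The Gauss sum in adapted bases -/

/-- The standard character reaches every `r`-th root of unity. -/
theorem exists_stdAddChar_eq {r : ℕ} [NeZero r] {z : ℂ} (h : z ^ r = 1) :
    ∃ c : ZMod r, ZMod.stdAddChar c = z := by
  obtain ⟨j, -, hj⟩ := (Complex.isPrimitiveRoot_exp r (NeZero.ne r)).eq_pow_of_pow_eq_one h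
  refine ⟨(j : ℤ), ?_⟩
  rw [ZMod.stdAddChar_coe, ← hj, ← Complex.exp_nat_mul]
  congr 1
  push_cast
  ring

theorem card_span_range {ι : Type*} [Fintype ι] {v : ι → D.G}
    (hv : LinearIndependent (ZMod D.r) v) {N : Submodule (ZMod D.r) D.G}
    (hN : Submodule.span (ZMod D.r) (Set.range v) = N) : Nat.card N = D.r ^ Fintype.card ι := by
  subst hN
  rw [Nat.card_congr (Module.Basis.span hv).equivFun.toEquiv, Nat.card_fun, Nat.card_zmod,
    Nat.card_eq_fintype_card]

namespace AdaptedBases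

variable {W : D.WuRefinement} {ε : D.ExtraStructure} {L₁ L₂ L₃ : OrientedLL W ε}
  (A : AdaptedBases L₁.L L₂.L L₃.L)

/-- The index type of the adapted bases. -/
abbrev I : Type := Fin A.k ⊕ (Fin A.p ⊕ (Fin A.q ⊕ (Fin A.t ⊕ Fin A.s)))

theorem e_mem₁₂ (i : Fin A.k) : A.e i ∈ L₁.L ⊓ L₂.L :=
  A.span₁₂ ▸ Submodule.subset_span ⟨.inl i, rfl⟩

theorem e_mem₃ (i : Fin A.k) : A.e i ∈ L₃.L :=
  (A.span₂₃.le (Submodule.subset_span ⟨.inl i, rfl⟩)).2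

theorem α_mem (i : Fin A.p) : A.α i ∈ L₁.L ⊓ L₂.L :=
  A.span₁₂ ▸ Submodule.subset_span ⟨.inr i, rfl⟩

theorem β_mem (i : Fin A.q) : A.β i ∈ L₂.L ⊓ L₃.L :=
  A.span₂₃ ▸ Submodule.subset_span ⟨.inr i, rfl⟩

theorem γ_mem (i : Fin A.t) : A.γ i ∈ L₁.L ⊓ L₃.L :=
  A.span₁₃ ▸ Submodule.subset_span ⟨.inr i, rfl⟩

theorem δ₁_mem (i : Fin A.s) : A.δ₁ i ∈ L₁.L :=
  A.span₁.le (Submodule.subset_span ⟨.inr (.inr (.inr (.inr i))), rfl⟩)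

theorem δ₂_mem (i : Fin A.s) : A.δ₂ i ∈ L₂.L :=
  A.span₂.le (Submodule.subset_span ⟨.inr (.inr (.inr (.inr i))), rfl⟩)

theorem δ₃_mem (i : Fin A.s) : A.δ₃ i ∈ L₃.L :=
  A.span₃.le (Submodule.subset_span ⟨.inr (.inr (.inr (.inr i))), rfl⟩)

theorem δ₂_memS (i : Fin A.s) : A.δ₂ i ∈ OrientedLL.S L₃ L₂ L₁ :=
  A.spanS.le (Submodule.subset_span ⟨.inr i, rfl⟩)

theorem liS : LinearIndependent (ZMod D.r)
    (Sum.elim (Sum.elim A.e (Sum.elim A.α A.β)) A.δ₂) := by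
  convert A.li₂.comp (Sum.elim (Sum.map id (Sum.map id .inl)) (.inr ∘ .inr ∘ .inr ∘ .inr)) (by
    rintro ((i | i | i) | i) ((j | j | j) | j) h <;> simp_all) using 1
  ext ((i | i | i) | i) <;> rfl

theorem li₁₂ : LinearIndependent (ZMod D.r) (Sum.elim A.e A.α) := by
  convert A.li₂.comp (Sum.map id .inl) (by rintro (i | i) (j | j) h <;> simp_all) using 1
  ext (i | i) <;> rfl

theorem li₂₃ : LinearIndependent (ZMod D.r) (Sum.elim A.e A.β) := by
  convert A.li₂.comp (Sum.map id (.inr ∘ .inl)) (by rintro (i | i) (j | j) h <;> simp_all) using 1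
  ext (i | i) <;> rfl

theorem li₁₃ : LinearIndependent (ZMod D.r) (Sum.elim A.e A.γ) := by
  convert A.li₁.comp (Sum.map id (.inr ∘ .inr ∘ .inl))
    (by rintro (i | i) (j | j) h <;> simp_all) using 1
  ext (i | i) <;> rfl

/-- The matrix of the pairing of `S₂` on the family `δ₂`. -/
def σ : Matrix (Fin A.s) (Fin A.s) (ZMod D.r) := Matrix.of fun i j => D.form (A.δ₃ i) (A.δ₂ j)

/-- The elements of `S₂` given by the family `δ₂`. -/
def d (i : Fin A.s) : OrientedLL.S L₃ L₂ L₁ := ⟨A.δ₂ i, A.δ₂_memS i⟩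

theorem stdAddChar_σ (i j : Fin A.s) :
    ZMod.stdAddChar (A.σ i j) = OrientedLL.P L₃ L₂ L₁ (A.d i) (A.d j) := by
  rw [OrientedLL.P_eq (A.d j) (A.δ₁_mem i) (A.δ₃_mem i) (A.δ_eq i)]
  exact stdAddChar_form _ _

theorem σ_symm (i j : Fin A.s) : A.σ i j = A.σ j i := by
  apply ZMod.injective_stdAddChar
  rw [stdAddChar_σ, stdAddChar_σ, OrientedLL.P_comm]

theorem form_δ₃_α (i : Fin A.s) (j : Fin A.p) : D.form (A.δ₃ i) (A.α j) = 0 := by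
  rw [eq_sub_of_add_eq' (A.δ_eq i).symm, map_sub, LinearMap.sub_apply,
    L₂.admissible.form_eq_zero (A.δ₂_mem i) (A.α_mem j).2,
    L₁.admissible.form_eq_zero (A.δ₁_mem i) (A.α_mem j).1, sub_zero]

/-- The pairing is nondegenerate on the span of `δ₂`, because this span is a complement of the radical
`L₁ ∩ L₂ + L₂ ∩ L₃` in `S₂`. -/
theorem isUnit_det_σ : IsUnit A.σ.det := by
  have hinj : Function.Injective A.σ.vecMulLinear := by
    rw [injective_iff_map_eq_zero]
    intro c hc
    have hc' : ∀ j, D.form (∑ i, c i • A.δ₃ i) (A.δ₂ j) = 0 := fun j => by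
      rw [form_sum_left]
      exact congrFun hc j
    set x : OrientedLL.S L₃ L₂ L₁ := ∑ i, c i • A.d i with hx
    have hx' : (x : D.G) = ∑ i, c i • A.δ₂ i := by
      rw [hx, Submodule.coe_sum]
      rfl
    have hx'' : (x : D.G) = ∑ i, c i • A.δ₁ i + ∑ i, c i • A.δ₃ i := by
      rw [hx', ← Finset.sum_add_distrib]
      simp only [A.δ_eq, smul_add]
    have h3 : ∑ i, c i • A.δ₃ i ∈ L₃.L := sum_smul_mem A.δ₃_mem c
    have hα : ∀ j, D.form (∑ i, c i • A.δ₃ i) (A.α j) = 0 := fun j => by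
      simp only [form_sum_left, form_δ₃_α, mul_zero, Finset.sum_const_zero]
    have hP : ∀ y, OrientedLL.P L₃ L₂ L₁ x y = 1 := fun y => by
      rw [OrientedLL.P_eq y (sum_smul_mem A.δ₁_mem c) h3 hx'', ← form_eq_zero_iff]
      obtain ⟨a, b, hab⟩ := (mem_span_range_sumElim_iff _ _ _).1 (A.spanS.ge y.2)
      rw [← hab, map_add, form_sum_right, form_sum_right]
      simp only [hc', Fintype.sum_sum_type, Sum.elim_inl, Sum.elim_inr,
        fun i => L₃.admissible.form_eq_zero h3 (A.e_mem₃ i),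
        fun i => L₃.admissible.form_eq_zero h3 (A.β_mem i).2, hα,
        mul_zero, Finset.sum_const_zero, add_zero]
    obtain ⟨k₁, h₁, k₃, h₃, h⟩ := OrientedLL.exists_of_forall_P_eq_one hP
    rw [← A.span₁₂, mem_span_range_sumElim_iff] at h₁
    rw [inf_comm, ← A.span₂₃, mem_span_range_sumElim_iff] at h₃
    obtain ⟨a, b, rfl⟩ := h₁
    obtain ⟨a', b', rfl⟩ := h₃
    refine ((linearIndependent_sumElim_iff _ _).1 A.liS (-Sum.elim (a + a') (Sum.elim b b'))
      c ?_).2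
    rw [← hx', h]
    simp only [Fintype.sum_sum_type, Pi.neg_apply, Sum.elim_inl, Sum.elim_inr, Pi.add_apply,
      add_smul, neg_smul, Finset.sum_add_distrib, Finset.sum_neg_distrib]
    abel
  have hsurj : Function.Surjective A.σ.vecMulLinear := Finite.surjective_of_injective hinj
  obtain ⟨B, hB⟩ := Matrix.vecMul_surjective_iff_exists_left_inverse.1 hsurj
  exact Matrix.isUnit_det_of_left_inverse hB

/-- On the span of `δ₂`, the function `q` is a Gaussian in the coordinates; the matrix of the
exponent is triangular, with the symmetric matrix `σ` as its polarisation. -/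
theorem exists_q_eq : ∃ T : Matrix (Fin A.s) (Fin A.s) (ZMod D.r), T + T.transpose = A.σ ∧
    ∀ v : Fin A.s → ZMod D.r, OrientedLL.q L₃ L₂ L₁ (∑ i, v i • A.d i) =
      ZMod.stdAddChar (v ⬝ᵥ T.mulVec v) := by
  choose c hc using fun i => exists_stdAddChar_eq (OrientedLL.q_pow_r (A.d i))
  let T : Matrix (Fin A.s) (Fin A.s) (ZMod D.r) := Matrix.of fun i j =>
    if i = j then c i else if i < j then A.σ i j else 0
  refine ⟨T, ?_, fun v => ?_⟩
  · ext i j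
    rw [Matrix.add_apply, Matrix.transpose_apply]
    rcases lt_trichotomy i j with h | h | h
    · simp [T, h.ne, h.ne', h, h.not_gt]
    · subst h
      apply ZMod.injective_stdAddChar
      rw [stdAddChar_σ, ← OrientedLL.q_mul_self, AddChar.map_add_eq_mul]
      simp [T, hc]
    · simp [T, h.ne, h.ne', h, h.not_gt, A.σ_symm i j]
  have hP : ∀ (x y : ZMod D.r) (i j : Fin A.s), OrientedLL.P L₃ L₂ L₁ (x • A.d i) (y • A.d j) =
      ZMod.stdAddChar (x * (A.σ i j * y)) := fun x y i j => by
    have e : ((x • A.d i : OrientedLL.S L₃ L₂ L₁) : D.G) = x • A.δ₁ i + x • A.δ₃ i := by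
      rw [← smul_add, ← A.δ_eq]
      rfl
    rw [OrientedLL.P_eq _ (L₁.L.smul_mem x (A.δ₁_mem i)) (L₃.L.smul_mem x (A.δ₃_mem i)) e,
      ← stdAddChar_form]
    change ZMod.stdAddChar (D.form (x • A.δ₃ i) (y • A.δ₂ j)) = _
    rw [LinearMap.map_smul, LinearMap.map_smul, LinearMap.smul_apply, smul_eq_mul, smul_eq_mul]
    congr 1
    change y * (x * A.σ i j) = _
    ring
  have hq : ∀ (x : ZMod D.r) (i : Fin A.s), OrientedLL.q L₃ L₂ L₁ (x • A.d i) =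
      ZMod.stdAddChar (x * (c i * x)) := fun x i => by
    obtain ⟨n, rfl⟩ := ZMod.natCast_zmod_surjective x
    rw [Nat.cast_smul_eq_nsmul, OrientedLL.q_nsmul, ← hc, ← AddChar.map_nsmul_eq_pow]
    congr 1
    rw [nsmul_eq_mul]
    push_cast
    ring
  have hPs : ∀ (s : Finset (Fin A.s)) (y : OrientedLL.S L₃ L₂ L₁)
      (f : Fin A.s → OrientedLL.S L₃ L₂ L₁),
      OrientedLL.P L₃ L₂ L₁ (∑ i ∈ s, f i) y = ∏ i ∈ s, OrientedLL.P L₃ L₂ L₁ (f i) y :=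
    fun s y f => by
      induction s using Finset.induction_on with
      | empty => rw [Finset.sum_empty, Finset.prod_empty, OrientedLL.P_zero_left]
      | insert i s hi ih =>
        rw [Finset.sum_insert hi, Finset.prod_insert hi, OrientedLL.P_add_left, ih]
  have key : ∀ s : Finset (Fin A.s), OrientedLL.q L₃ L₂ L₁ (∑ i ∈ s, v i • A.d i) =
      ZMod.stdAddChar (∑ i ∈ s, ∑ j ∈ s, v i * (T i j * v j)) := fun s => by
    induction s using Finset.induction_on_max with
    | empty => rw [Finset.sum_empty, Finset.sum_empty, OrientedLL.q_zero, AddChar.map_zero_eq_one]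
    | insert m s hm ih =>
      have hms : m ∉ s := fun h => lt_irrefl _ (hm m h)
      have e1 : ∀ j ∈ s, v m * (T m j * v j) = 0 := fun j hj => by
        simp [T, (hm j hj).ne', (hm j hj).not_gt]
      have e2 : ∀ i ∈ s, v i * (T i m * v m) = v i * (A.σ i m * v m) := fun i hi => by
        simp [T, (hm i hi).ne, hm i hi]
      rw [Finset.sum_insert hms, add_comm, OrientedLL.q_add, ih, hq, hPs, Finset.sum_insert hms,
        Finset.sum_insert hms, Finset.sum_eq_zero e1, add_zero]
      simp only [hP, Finset.sum_insert hms, Finset.sum_add_distrib, Finset.sum_congr rfl e2,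
        AddChar.map_add_eq_mul, QuadraticGauss.addChar_sum]
      simp only [T, Matrix.of_apply, if_true]
      ring
  rw [key Finset.univ]
  simp only [dotProduct, Matrix.mulVec, Finset.mul_sum]

/-- The radical of `q`, spanned by `e, α, β`, contributes its number of elements to the Gauss sum, which
leaves a Gauss sum of a quadratic form with unimodular polar form `σ`. -/
theorem a_eq : ∃ T : Matrix (Fin A.s) (Fin A.s) (ZMod D.r), T + T.transpose = A.σ ∧
    OrientedLL.a L₃ L₂ L₁ =
      D.r ^ (A.k + A.p + A.q) * QuadraticGauss.formSum (ZMod.stdAddChar (N := D.r)) T := by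
  obtain ⟨T, hT, hq⟩ := A.exists_q_eq
  refine ⟨T, hT, ?_⟩
  have hmem : ∀ i, Sum.elim A.e (Sum.elim A.α A.β) i ∈ OrientedLL.S L₃ L₂ L₁ := fun i =>
    A.spanS.le (Submodule.subset_span ⟨.inl i, rfl⟩)
  let f : ((Fin A.k ⊕ (Fin A.p ⊕ Fin A.q)) → ZMod D.r) × (Fin A.s → ZMod D.r) →
      OrientedLL.S L₃ L₂ L₁ := fun v => ∑ i, v.1 i • ⟨_, hmem i⟩ + ∑ i, v.2 i • A.d i
  have hf : ∀ v, (f v : D.G) = ∑ i, v.1 i • Sum.elim A.e (Sum.elim A.α A.β) i +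
      ∑ i, v.2 i • A.δ₂ i := fun v => by
    change ((∑ i, v.1 i • ⟨_, hmem i⟩ + ∑ i, v.2 i • A.d i : OrientedLL.S L₃ L₂ L₁) : D.G) = _
    rw [Submodule.coe_add, Submodule.coe_sum, Submodule.coe_sum]
    rfl
  have hbij : Function.Bijective f := by
    constructor
    · intro v w hvw
      have h1 := congrArg Subtype.val hvw
      rw [hf, hf] at h1
      obtain ⟨h2, h3⟩ := (linearIndependent_sumElim_iff _ _).1 A.liS (v.1 - w.1) (v.2 - w.2) (by
        simp only [Pi.sub_apply, sub_smul, Finset.sum_sub_distrib]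
        rw [← sub_eq_zero] at h1
        rw [← h1]
        abel)
      exact Prod.ext (sub_eq_zero.1 h2) (sub_eq_zero.1 h3)
    · intro x
      obtain ⟨a, b, hab⟩ := (mem_span_range_sumElim_iff _ _ _).1 (A.spanS.ge x.2)
      exact ⟨(a, b), Subtype.ext ((hf _).trans hab)⟩
  have hqf : ∀ v, OrientedLL.q L₃ L₂ L₁ (f v) =
      ZMod.stdAddChar (v.2 ⬝ᵥ T.mulVec v.2) := fun v => by
    set y : OrientedLL.S L₃ L₂ L₁ := ∑ i, v.1 i • ⟨_, hmem i⟩ with hy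
    have hy' : (y : D.G) = (∑ i, v.1 (.inl i) • A.e i + ∑ i, v.1 (.inr (.inl i)) • A.α i) +
        ∑ i, v.1 (.inr (.inr i)) • A.β i := by
      rw [hy, Submodule.coe_sum]
      change ∑ i, v.1 i • Sum.elim A.e (Sum.elim A.α A.β) i = _
      simp only [Fintype.sum_sum_type, Sum.elim_inl, Sum.elim_inr, add_assoc]
    have m12 : ∑ i, v.1 (.inl i) • A.e i + ∑ i, v.1 (.inr (.inl i)) • A.α i ∈ L₁.L ⊓ L₂.L :=
      add_mem (sum_smul_mem A.e_mem₁₂ _) (sum_smul_mem A.α_mem _)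
    have m23 : ∑ i, v.1 (.inr (.inr i)) • A.β i ∈ L₂.L ⊓ L₃.L := sum_smul_mem A.β_mem _
    change OrientedLL.q L₃ L₂ L₁ (y + ∑ i, v.2 i • A.d i) = _
    rw [OrientedLL.q_add, OrientedLL.q_eq_one m12.1 m23.2 hy' m12.2,
      OrientedLL.P_eq _ m12.1 m23.2 hy', hq, one_mul,
      L₂.admissible.B_eq_one m23.1 (Submodule.mem_inf.1 (Subtype.mem _)).1, mul_one]
  have := Fintype.ofFinite (OrientedLL.S L₃ L₂ L₁)
  rw [OrientedLL.a, gaussSum, finsum_eq_sum_of_fintype, ← hbij.sum_comp, QuadraticGauss.formSum]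
  simp only [hqf]
  rw [Fintype.sum_prod_type]
  dsimp only
  rw [Finset.sum_const, nsmul_eq_mul, Finset.card_univ]
  congr 1
  simp [add_assoc]

end AdaptedBases

end Background

end AbelianGauge

namespace AbelianGauge

/-! ### Orientations and determinants -/

section TopPower

variable {R M ι : Type*} [CommRing R] [AddCommGroup M] [Module R M] [Fintype ι] [DecidableEq ι]
  {n : ℕ}

/-- The coefficient of an element of the top exterior power with respect to the wedge product of a
basis, taken in the order given by an enumeration of its index type. -/
def topCoeff (b : Module.Basis ι R M) (τ : Fin n ≃ ι) : ⋀[R]^n M →ₗ[R] R :=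
  exteriorPower.alternatingMapLinearEquiv (b.reindex τ.symm).det

theorem topCoeff_ιMulti (b : Module.Basis ι R M) (τ : Fin n ≃ ι) (v : Fin n → M) :
    topCoeff b τ (exteriorPower.ιMulti R n v) = b.det (v ∘ τ.symm) := by
  rw [topCoeff, exteriorPower.alternatingMapLinearEquiv_apply_ιMulti, Module.Basis.det_reindex]

/-- The top exterior power is spanned by the wedge product of a basis. -/
theorem topCoeff_smul_ιMulti (b : Module.Basis ι R M) (τ : Fin n ≃ ι) (o : ⋀[R]^n M) :
    topCoeff b τ o • exteriorPower.ιMulti R n (b ∘ τ) = o := by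
  have h : (LinearMap.toSpanSingleton R _ (exteriorPower.ιMulti R n (b ∘ τ))) ∘ₗ topCoeff b τ =
      LinearMap.id := by
    refine exteriorPower.linearMap_ext (Module.Basis.ext_alternating (b.reindex τ.symm) ?_)
    intro v hv
    let π : Equiv.Perm (Fin n) := Equiv.ofBijective v (Finite.injective_iff_bijective.1 hv)
    have e : (fun i => b.reindex τ.symm (v i)) = (b ∘ τ) ∘ π := by
      ext i
      simp [π]
    rw [e, AlternatingMap.map_perm, AlternatingMap.map_perm]
    congr 1
    change topCoeff b τ (exteriorPower.ιMulti R n (b ∘ τ)) • exteriorPower.ιMulti R n (b ∘ τ) = _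
    rw [topCoeff_ιMulti, Function.comp_assoc, Equiv.self_comp_symm, Function.comp_id,
      Module.Basis.det_self, one_smul]
    rfl
  exact LinearMap.congr_fun h o

/-- An orientation is a unit multiple of the wedge product of any basis. -/
theorem isUnit_topCoeff (b : Module.Basis ι R M) (τ : Fin n ≃ ι) {o : ⋀[R]^n M}
    (ho : Submodule.span R {o} = ⊤) : IsUnit (topCoeff b τ o) := by
  obtain ⟨c, hc⟩ := Submodule.mem_span_singleton.1
    (ho.ge (Submodule.mem_top (x := exteriorPower.ιMulti R n (b ∘ τ))))
  have h := congrArg (topCoeff b τ) hc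
  rw [map_smul, topCoeff_ιMulti, Function.comp_assoc, Equiv.self_comp_symm, Function.comp_id,
    Module.Basis.det_self, smul_eq_mul] at h
  exact IsUnit.of_mul_eq_one_right c h

/-- The determinant of a family whose first part is a combination of the first part of the basis. -/
theorem det_sumElim {κ μ : Type*} [Fintype κ] [DecidableEq κ] [Fintype μ] [DecidableEq μ]
    (b : Module.Basis (κ ⊕ μ) R M) (e : κ → M) (x : μ → M) (g : Matrix κ κ R)
    (he : ∀ j, e j = ∑ i, g i j • b (.inl i)) :
    b.det (Sum.elim e x) = g.det * (Matrix.of fun i j => b.repr (x j) (.inr i)).det := by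
  rw [Module.Basis.det_apply, ← Matrix.det_fromBlocks_zero₂₁ g
    (Matrix.of fun i j => b.repr (x j) (.inl i))]
  congr 1
  ext (i | i) (j | j) <;> simp [Module.Basis.toMatrix_apply, he, Finsupp.single_apply]

end TopPower

namespace Background

variable {D : Background.{u, v}}

namespace OrientedLL

variable {W : D.WuRefinement} {ε : D.ExtraStructure} {L₂ L₁ : OrientedLL W ε}

/-- Base change to bases of `L₂` and `L₁` sharing a basis of the intersection: the common part is
changed by the same matrix on both sides. -/
theorem QuotientOrientations.exists_det_factors {n₁₂ s : ℕ} (f : QuotientOrientations L₂ L₁ n₁₂ s)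
    (b₂ : Module.Basis (Fin n₁₂ ⊕ Fin s) (ZMod D.r) L₂.L)
    (b₁ : Module.Basis (Fin n₁₂ ⊕ Fin s) (ZMod D.r) L₁.L)
    (hb : ∀ j, (b₂ (.inl j) : D.G) = b₁ (.inl j))
    (hspan : Submodule.span (ZMod D.r) (Set.range fun j => (b₂ (.inl j) : D.G)) = inter L₂ L₁) :
    ∃ w x y, b₂.det (Sum.elim (fun i => Submodule.inclusion inf_le_left (f.e i)) f.x) = w * x ∧
      b₁.det (Sum.elim (fun i => Submodule.inclusion inf_le_right (f.e i)) f.y) = w * y ∧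
      (Matrix.of fun i j => D.form (f.x i) (f.y j)).det =
        x * (Matrix.of fun i j => D.form (b₂ (.inr i)) (b₁ (.inr j))).det * y := by
  choose c hc using fun j : Fin n₁₂ => (Submodule.mem_span_range_iff_exists_fun _).1
    (hspan.ge (f.e j).2)
  let g : Matrix (Fin n₁₂) (Fin n₁₂) (ZMod D.r) := Matrix.of fun i j => c j i
  let X := Matrix.of fun i j : Fin s => b₂.repr (f.x j) (.inr i)
  let Y := Matrix.of fun i j : Fin s => b₁.repr (f.y j) (.inr i)
  refine ⟨g.det, X.det, Y.det, ?_, ?_, ?_⟩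
  · refine det_sumElim _ _ _ g fun j => Subtype.ext ?_
    rw [Submodule.coe_sum]
    exact (hc j).symm
  · refine det_sumElim _ _ _ g fun j => Subtype.ext ?_
    rw [Submodule.coe_sum]
    refine (hc j).symm.trans ?_
    simp only [hb]
    rfl
  have hx : ∀ j, ∃ m ∈ inter L₂ L₁, (f.x j : D.G) =
      m + ∑ i, X i j • (b₂ (.inr i) : D.G) := fun j => by
    have h := congrArg Subtype.val (b₂.sum_repr (f.x j))
    rw [Submodule.coe_sum, Fintype.sum_sum_type] at h
    refine ⟨∑ i, b₂.repr (f.x j) (.inl i) • (b₂ (.inl i) : D.G), sum_smul_mem (fun i => ?_) _,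
      h.symm⟩
    exact hspan.le (Submodule.subset_span ⟨i, rfl⟩)
  have hy : ∀ j, ∃ m ∈ inter L₂ L₁, (f.y j : D.G) =
      m + ∑ i, Y i j • (b₁ (.inr i) : D.G) := fun j => by
    have h := congrArg Subtype.val (b₁.sum_repr (f.y j))
    rw [Submodule.coe_sum, Fintype.sum_sum_type] at h
    refine ⟨∑ i, b₁.repr (f.y j) (.inl i) • (b₁ (.inl i) : D.G), sum_smul_mem (fun i => ?_) _,
      h.symm⟩
    rw [← hb]
    exact hspan.le (Submodule.subset_span ⟨i, rfl⟩)
  have hM : (Matrix.of fun i j => D.form (f.x i) (f.y j)) = X.transpose *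
      ((Matrix.of fun i j => D.form (b₂ (.inr i)) (b₁ (.inr j))) * Y) := by
    ext i j
    obtain ⟨m, hm, hxm⟩ := hx i
    obtain ⟨m', hm', hym⟩ := hy j
    have h2 : ∑ a, X a i • (b₂ (.inr a) : D.G) ∈ L₂.L := sum_smul_mem (fun a => (b₂ _).2) _
    have h1 : ∑ a, Y a j • (b₁ (.inr a) : D.G) ∈ L₁.L := sum_smul_mem (fun a => (b₁ _).2) _
    rw [Matrix.of_apply, hxm, hym, map_add, L₂.admissible.form_eq_zero (add_mem hm.1 h2) hm'.1,
      zero_add, map_add, LinearMap.add_apply, L₁.admissible.form_eq_zero hm.2 h1, zero_add,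
      form_sum_left]
    simp only [form_sum_right, Matrix.mul_apply]
    refine Finset.sum_congr rfl fun a _ => congrArg (X a i * ·) ?_
    exact Finset.sum_congr rfl fun b _ => mul_comm _ _
  rw [hM, Matrix.det_mul, Matrix.det_mul, Matrix.det_transpose, mul_assoc]

/-- The determinant of the pairing between quotient orientations, in terms of a pair of bases of
`L₂` and `L₁` which share a basis of `L₂ ∩ L₁`. The two agree up to the square of a unit, the
determinant of the change of basis of the intersection. -/
theorem QuotientOrientations.exists_det_eq {n₁₂ s : ℕ} (f : QuotientOrientations L₂ L₁ n₁₂ s)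
    {ι κ μ : Type} [Fintype ι] [DecidableEq ι] [Fintype κ] [DecidableEq κ] [Fintype μ]
    [DecidableEq μ] (b₂ : Module.Basis ι (ZMod D.r) L₂.L) (b₁ : Module.Basis ι (ZMod D.r) L₁.L)
    (τ : Fin D.n ≃ ι) (θ : κ ⊕ μ ≃ ι)
    (hb : ∀ j : κ, (b₂ (θ (.inl j)) : D.G) = b₁ (θ (.inl j)))
    (hspan : Submodule.span (ZMod D.r) (Set.range fun j : κ => (b₂ (θ (.inl j)) : D.G)) =
      inter L₂ L₁) :
    n₁₂ = Fintype.card κ ∧ s = Fintype.card μ ∧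
    ∃ w, IsUnit w ∧ f.u * f.v * (Matrix.of fun i j => D.form (f.x i) (f.y j)).det * w ^ 2 =
      topCoeff b₂ τ L₂.o * topCoeff b₁ τ L₁.o *
        (Matrix.of fun i j : μ => D.form (b₂ (θ (.inr i))) (b₁ (θ (.inr j)))).det := by
  have : Nontrivial (ZMod D.r) := ZMod.nontrivial_iff.2 D.isPrimePow_r.ne_one
  have hli : LinearIndependent (ZMod D.r) fun j : κ => (b₂ (θ (.inl j)) : D.G) :=
    (b₂.linearIndependent.map' L₂.L.subtype L₂.L.ker_subtype).comp (fun j => θ (.inl j))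
      (θ.injective.comp Sum.inl_injective)
  have ζκ : Fin n₁₂ ≃ κ := f.e.indexEquiv
    ((Module.Basis.span hli).map (LinearEquiv.ofEq _ _ hspan))
  have hκ : n₁₂ = Fintype.card κ := by rw [← Fintype.card_congr ζκ, Fintype.card_fin]
  have hμ : s = Fintype.card μ := by
    have h1 := Fintype.card_congr (τ.trans θ.symm)
    rw [Fintype.card_fin, Fintype.card_sum, ← f.rank_add, hκ] at h1
    omega
  have ζμ : Fin s ≃ μ := (finCongr hμ).trans (Fintype.equivFin μ).symm
  let ζ : Fin n₁₂ ⊕ Fin s ≃ ι := (ζκ.sumCongr ζμ).trans θ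
  let κ' : Fin n₁₂ ⊕ Fin s ≃ Fin D.n := finSumFinEquiv.trans (finCongr f.rank_add)
  let π : Equiv.Perm ι := (ζ.symm.trans κ').trans τ
  have hdet : ∀ {L : OrientedLL W ε} (b : Module.Basis ι (ZMod D.r) L.L) (E : Fin n₁₂ → L.L)
      (x : Fin s → L.L), (b.reindex ζ.symm).det (Sum.elim E x) = (Equiv.Perm.sign π : ℤ) *
        topCoeff b τ (exteriorPower.ιMulti (ZMod D.r) D.n
          (Fin.append E x ∘ Fin.cast f.rank_add.symm)) := fun b E x => by
    rw [topCoeff_ιMulti, Module.Basis.det_reindex]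
    have e1 : Sum.elim E x ∘ ζ.symm =
        ((Fin.append E x ∘ Fin.cast f.rank_add.symm) ∘ τ.symm) ∘ π := by
      ext i
      obtain ⟨i, rfl⟩ := ζ.surjective i
      rcases i with i | i <;> simp [π, κ']
    rw [e1, AlternatingMap.map_perm, Units.smul_def, ← Int.cast_smul_eq_zsmul (ZMod D.r),
      smul_eq_mul]
  -- the sign of the reordering occurs in both `L₂` and `L₁`, so that only its square matters
  have hsign : ((Equiv.Perm.sign π : ℤ) : ZMod D.r) ^ 2 = 1 := by
    rw [← Int.cast_pow, ← Units.val_pow_eq_pow_val, Int.units_sq, Units.val_one, Int.cast_one]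
  have hc₂ := hdet b₂ (fun i => Submodule.inclusion inf_le_left (f.e i)) f.x
  have hc₁ := hdet b₁ (fun i => Submodule.inclusion inf_le_right (f.e i)) f.y
  have ho₂ := congrArg (topCoeff b₂ τ) f.o₂_eq
  have ho₁ := congrArg (topCoeff b₁ τ) f.o₁_eq
  rw [map_smul, smul_eq_mul] at ho₂ ho₁
  obtain ⟨w, x, y, h₂, h₁, hM⟩ := f.exists_det_factors (b₂.reindex ζ.symm) (b₁.reindex ζ.symm)
    (fun j => by simpa [ζ] using hb (ζκ j)) (by
      have e1 : (fun j => ((b₂.reindex ζ.symm) (.inl j) : D.G)) =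
          (fun j => (b₂ (θ (.inl j)) : D.G)) ∘ ζκ := by
        ext j
        simp [ζ]
      rw [e1, ζκ.surjective.range_comp, hspan])
  have hu : IsUnit w := by
    have h := isUnit_topCoeff b₂ τ L₂.o_generates
    rw [ho₂] at h
    have h3 := (IsUnit.of_pow_eq_one hsign two_ne_zero).mul (isUnit_of_mul_isUnit_right h)
    rw [← hc₂, h₂] at h3
    exact isUnit_of_mul_isUnit_left h3
  have hΩ : (Matrix.of fun i j => D.form ((b₂.reindex ζ.symm) (.inr i))
      ((b₁.reindex ζ.symm) (.inr j))).det =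
      (Matrix.of fun i j : μ => D.form (b₂ (θ (.inr i))) (b₁ (θ (.inr j)))).det := by
    rw [← Matrix.det_submatrix_equiv_self ζμ]
    congr 1
    ext i j
    simp [ζ]
  refine ⟨hκ, hμ, w, hu, ?_⟩
  rw [h₂] at hc₂
  rw [h₁] at hc₁
  rw [hM, hΩ, ho₂, ho₁]
  generalize (Matrix.of fun i j : μ => D.form (b₂ (θ (.inr i))) (b₁ (θ (.inr j)))).det = Ω
  generalize topCoeff b₂ τ _ = c₂ at hc₂ ⊢
  generalize topCoeff b₁ τ _ = c₁ at hc₁ ⊢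
  generalize ((Equiv.Perm.sign π : ℤ) : ZMod D.r) = z at hc₂ hc₁ hsign
  linear_combination (f.u * f.v * Ω * w * y) * hc₂ + (f.u * f.v * Ω * z * c₂) * hc₁ +
    (f.u * f.v * Ω * c₂ * c₁) * hsign

end OrientedLL

end Background

end AbelianGauge

namespace AbelianGauge

/-! ### The symbols of the quotient orientations -/

section BlockDeterminants

variable {R a b : Type*} [CommRing R] [DecidableEq a] {M : Matrix (a ⊕ b) (a ⊕ b) R} {x : R}

theorem toBlocks₁₁_eq_diagonal (h : ∀ i j, M (.inl i) (.inl j) = if i = j then x else 0) :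
    M.toBlocks₁₁ = Matrix.diagonal fun _ => x := by
  ext i j
  rw [Matrix.diagonal_apply]
  exact h i j

variable [Fintype a] [Fintype b] [DecidableEq b]

theorem det_of_scalar_of_zero₁₂ (h : ∀ i j, M (.inl i) (.inl j) = if i = j then x else 0)
    (h0 : ∀ i j, M (.inl i) (.inr j) = 0) :
    M.det = x ^ Fintype.card a * M.toBlocks₂₂.det := by
  have h12 : M.toBlocks₁₂ = 0 := Matrix.ext h0
  rw [← M.fromBlocks_toBlocks, h12, Matrix.det_fromBlocks_zero₁₂, toBlocks₁₁_eq_diagonal h,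
    Matrix.det_diagonal, Finset.prod_const, Finset.card_univ, Matrix.toBlocks_fromBlocks₂₂]

theorem det_of_scalar_of_zero₂₁ (h : ∀ i j, M (.inl i) (.inl j) = if i = j then x else 0)
    (h0 : ∀ i j, M (.inr i) (.inl j) = 0) :
    M.det = x ^ Fintype.card a * M.toBlocks₂₂.det := by
  have h21 : M.toBlocks₂₁ = 0 := Matrix.ext h0
  rw [← M.fromBlocks_toBlocks, h21, Matrix.det_fromBlocks_zero₂₁, toBlocks₁₁_eq_diagonal h,
    Matrix.det_diagonal, Finset.prod_const, Finset.card_univ, Matrix.toBlocks_fromBlocks₂₂]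

end BlockDeterminants

namespace Background

variable {D : Background.{u, v}}

/-- The basis of a submodule given by a linearly independent family spanning it. -/
def basisOfSpan {ι : Type*} {v : ι → D.G} {N : Submodule (ZMod D.r) D.G}
    (hv : LinearIndependent (ZMod D.r) v) (hN : Submodule.span (ZMod D.r) (Set.range v) = N) :
    Module.Basis ι (ZMod D.r) N :=
  (Module.Basis.span hv).map (LinearEquiv.ofEq _ _ hN)

@[simp]
theorem coe_basisOfSpan {ι : Type*} {v : ι → D.G} {N : Submodule (ZMod D.r) D.G}
    (hv : LinearIndependent (ZMod D.r) v) (hN : Submodule.span (ZMod D.r) (Set.range v) = N)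
    (i : ι) : (basisOfSpan hv hN i : D.G) = v i := by
  rw [basisOfSpan, Module.Basis.map_apply]
  exact congrArg Subtype.val (Module.Basis.span_apply hv i)

namespace OrientedLL

variable {W : D.WuRefinement} {ε : D.ExtraStructure} {L₂ L₁ : OrientedLL W ε}

/-- Two bases sharing a basis of the intersection give a presentation of the induced
orientations. -/
theorem nonempty_quotientOrientations {ι κ μ : Type} [Fintype ι] [DecidableEq ι] [Fintype κ]
    [Fintype μ]
    (b₂ : Module.Basis ι (ZMod D.r) L₂.L) (b₁ : Module.Basis ι (ZMod D.r) L₁.L)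
    (τ : Fin D.n ≃ ι) (θ : κ ⊕ μ ≃ ι)
    (hb : ∀ j : κ, (b₂ (θ (.inl j)) : D.G) = b₁ (θ (.inl j)))
    (hspan : Submodule.span (ZMod D.r) (Set.range fun j : κ => (b₂ (θ (.inl j)) : D.G)) =
      inter L₂ L₁) :
    Nonempty (QuotientOrientations L₂ L₁ (Fintype.card κ) (Fintype.card μ)) := by
  have hli : LinearIndependent (ZMod D.r) fun j : κ => (b₂ (θ (.inl j)) : D.G) :=
    (b₂.linearIndependent.map' L₂.L.subtype L₂.L.ker_subtype).comp (fun j => θ (.inl j))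
      (θ.injective.comp Sum.inl_injective)
  have hn : Fintype.card κ + Fintype.card μ = D.n := by
    rw [← Fintype.card_sum, Fintype.card_congr θ, ← Fintype.card_congr τ, Fintype.card_fin]
  let e₁ := (Fintype.equivFin κ).symm
  let e₂ := (Fintype.equivFin μ).symm
  let τ' : Fin D.n ≃ ι :=
    (finCongr hn.symm).trans (finSumFinEquiv.symm.trans ((e₁.sumCongr e₂).trans θ))
  let e := (basisOfSpan hli hspan).reindex e₁.symm
  have he : ∀ i, (e i : D.G) = b₂ (θ (.inl (e₁ i))) := fun i => by
    rw [Module.Basis.reindex_apply, coe_basisOfSpan, Equiv.symm_symm]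
  have key : ∀ {L : OrientedLL W ε} (b : Module.Basis ι (ZMod D.r) L.L)
      (f : Fin (Fintype.card κ) → L.L) (_ : ∀ i, f i = b (θ (.inl (e₁ i)))),
      Fin.append f (fun i => b (θ (.inr (e₂ i)))) ∘ Fin.cast hn.symm = b ∘ τ' :=
    fun b f hf => by
      ext i
      obtain ⟨i, rfl⟩ := (finCongr hn).surjective i
      obtain ⟨i, rfl⟩ := finSumFinEquiv.surjective i
      rcases i with i | i <;> simp [τ', hf]
  refine ⟨⟨hn, e, fun i => b₂ (θ (.inr (e₂ i))), fun i => b₁ (θ (.inr (e₂ i))),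
    topCoeff b₂ τ' L₂.o, topCoeff b₁ τ' L₁.o, ?_, ?_⟩⟩
  · rw [key b₂ _ fun i => Subtype.ext (he i), topCoeff_smul_ιMulti]
  · rw [key b₁ _ fun i => Subtype.ext ((he i).trans (hb _)), topCoeff_smul_ιMulti]

/-- The symbol `E` of a presentation, in terms of a pair of bases sharing a basis of the
intersection: it changes by the symbol of a square. -/
theorem QuotientOrientations.E_eq (h2 : D.r ≠ 2) {n₁₂ s : ℕ} (f : QuotientOrientations L₂ L₁ n₁₂ s)
    {ι κ μ : Type} [Fintype ι] [DecidableEq ι] [Fintype κ] [DecidableEq κ] [Fintype μ]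
    [DecidableEq μ] (b₂ : Module.Basis ι (ZMod D.r) L₂.L) (b₁ : Module.Basis ι (ZMod D.r) L₁.L)
    (τ : Fin D.n ≃ ι) (θ : κ ⊕ μ ≃ ι)
    (hb : ∀ j : κ, (b₂ (θ (.inl j)) : D.G) = b₁ (θ (.inl j)))
    (hspan : Submodule.span (ZMod D.r) (Set.range fun j : κ => (b₂ (θ (.inl j)) : D.G)) =
      inter L₂ L₁)
    (hΩ : IsUnit (Matrix.of fun i j : μ => D.form (b₂ (θ (.inr i))) (b₁ (θ (.inr j)))).det) :
    n₁₂ = Fintype.card κ ∧ f.E = QuadraticGauss.kron D.r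
      (QuadraticGauss.halfUnit D.r ^ Fintype.card μ * (topCoeff b₂ τ L₂.o * topCoeff b₁ τ L₁.o *
        (Matrix.of fun i j : μ => D.form (b₂ (θ (.inr i))) (b₁ (θ (.inr j)))).det)) := by
  obtain ⟨hκ, hμ, w, hw, h⟩ := f.exists_det_eq b₂ b₁ τ θ hb hspan
  refine ⟨hκ, ?_⟩
  have hC := ((isUnit_topCoeff b₂ τ L₂.o_generates).mul
    (isUnit_topCoeff b₁ τ L₁.o_generates)).mul hΩ
  rw [← h] at hC ⊢
  have hd : (Matrix.of fun i k => (if Odd D.r then (2 : ZMod D.r)⁻¹ else 1) *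
      D.logB (f.x i) (f.y k)).det = QuadraticGauss.halfUnit D.r ^ s *
      (Matrix.of fun i j => D.form (f.x i) (f.y j)).det := by
    have e := Matrix.det_smul (Matrix.of fun i j => D.form (f.x i) (f.y j))
      (QuadraticGauss.halfUnit D.r)
    rw [Fintype.card_fin] at e
    exact e
  change QuadraticGauss.kron D.r _ = _
  rw [hd, ← mul_assoc (_ ^ _) _ (w ^ 2), QuadraticGauss.kron_mul_sq D.isPrimePow_r h2
    ((QuadraticGauss.isUnit_halfUnit.pow _).mul (isUnit_of_mul_isUnit_left hC)) hw, ← hμ]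
  congr 1
  ring

end OrientedLL

namespace AdaptedBases

variable {W : D.WuRefinement} {ε : D.ExtraStructure} {L₁ L₂ L₃ : OrientedLL W ε}
  (A : AdaptedBases L₁.L L₂.L L₃.L)

/-- The basis `e, α, η₁, γ, δ₁` of `L₁`. -/
def basis₁ : Module.Basis A.I (ZMod D.r) L₁.L := basisOfSpan A.li₁ A.span₁

/-- The basis `e, α, β, η₂, δ₂` of `L₂`. -/
def basis₂ : Module.Basis A.I (ZMod D.r) L₂.L := basisOfSpan A.li₂ A.span₂

/-- The basis `e, η₃, β, γ, δ₃` of `L₃`. -/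
def basis₃ : Module.Basis A.I (ZMod D.r) L₃.L := basisOfSpan A.li₃ A.span₃

theorem nonempty_enumeration : Nonempty (Fin D.n ≃ A.I) := by
  have : Nontrivial (ZMod D.r) := ZMod.nontrivial_iff.2 D.isPrimePow_r.ne_one
  obtain ⟨b⟩ := L₁.admissible.nonempty_basis
  exact ⟨b.indexEquiv A.basis₁⟩

theorem n_eq : D.n = A.k + (A.p + (A.q + (A.t + A.s))) := by
  obtain ⟨τ⟩ := A.nonempty_enumeration
  simpa using Fintype.card_congr τ

/-- The splitting of the index type for `L₁ ∩ L₂`. -/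
def θ₂₁ : (Fin A.k ⊕ Fin A.p) ⊕ (Fin A.q ⊕ (Fin A.t ⊕ Fin A.s)) ≃ A.I := Equiv.sumAssoc _ _ _

/-- The splitting of the index type for `L₂ ∩ L₃`. -/
def θ₃₂ : (Fin A.k ⊕ Fin A.q) ⊕ (Fin A.p ⊕ (Fin A.t ⊕ Fin A.s)) ≃ A.I where
  toFun := Sum.elim (Sum.elim .inl (.inr ∘ .inr ∘ .inl))
    (Sum.elim (.inr ∘ .inl) (.inr ∘ .inr ∘ .inr))
  invFun := Sum.elim (.inl ∘ .inl) (Sum.elim (.inr ∘ .inl)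
    (Sum.elim (.inl ∘ .inr) (.inr ∘ .inr)))
  left_inv := by rintro ((i | i) | (i | i | i)) <;> rfl
  right_inv := by rintro (i | i | i | i | i) <;> rfl

/-- The splitting of the index type for `L₁ ∩ L₃`. -/
def θ₃₁ : (Fin A.k ⊕ Fin A.t) ⊕ (Fin A.p ⊕ (Fin A.q ⊕ Fin A.s)) ≃ A.I where
  toFun := Sum.elim (Sum.elim .inl (.inr ∘ .inr ∘ .inr ∘ .inl))
    (Sum.elim (.inr ∘ .inl) (Sum.elim (.inr ∘ .inr ∘ .inl) (.inr ∘ .inr ∘ .inr ∘ .inr)))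
  invFun := Sum.elim (.inl ∘ .inl) (Sum.elim (.inr ∘ .inl)
    (Sum.elim (.inr ∘ .inr ∘ .inl) (Sum.elim (.inl ∘ .inr) (.inr ∘ .inr ∘ .inr))))
  left_inv := by rintro ((i | i) | (i | i | i)) <;> rfl
  right_inv := by rintro (i | i | i | i | i) <;> rfl

theorem coe_basis₂_θ₂₁ (j : Fin A.k ⊕ Fin A.p) :
    (A.basis₂ (A.θ₂₁ (.inl j)) : D.G) = Sum.elim A.e A.α j := by
  rw [basis₂, coe_basisOfSpan]
  rcases j with j | j <;> rfl

theorem coe_basis₁_θ₂₁ (j : Fin A.k ⊕ Fin A.p) :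
    (A.basis₁ (A.θ₂₁ (.inl j)) : D.G) = Sum.elim A.e A.α j := by
  rw [basis₁, coe_basisOfSpan]
  rcases j with j | j <;> rfl

theorem coe_basis₃_θ₃₂ (j : Fin A.k ⊕ Fin A.q) :
    (A.basis₃ (A.θ₃₂ (.inl j)) : D.G) = Sum.elim A.e A.β j := by
  rw [basis₃, coe_basisOfSpan]
  rcases j with j | j <;> rfl

theorem coe_basis₂_θ₃₂ (j : Fin A.k ⊕ Fin A.q) :
    (A.basis₂ (A.θ₃₂ (.inl j)) : D.G) = Sum.elim A.e A.β j := by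
  rw [basis₂, coe_basisOfSpan]
  rcases j with j | j <;> rfl

theorem coe_basis₃_θ₃₁ (j : Fin A.k ⊕ Fin A.t) :
    (A.basis₃ (A.θ₃₁ (.inl j)) : D.G) = Sum.elim A.e A.γ j := by
  rw [basis₃, coe_basisOfSpan]
  rcases j with j | j <;> rfl

theorem coe_basis₁_θ₃₁ (j : Fin A.k ⊕ Fin A.t) :
    (A.basis₁ (A.θ₃₁ (.inl j)) : D.G) = Sum.elim A.e A.γ j := by
  rw [basis₁, coe_basisOfSpan]
  rcases j with j | j <;> rfl

theorem span_basis₂_θ₂₁ : Submodule.span (ZMod D.r)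
    (Set.range fun j => (A.basis₂ (A.θ₂₁ (.inl j)) : D.G)) = OrientedLL.inter L₂ L₁ := by
  simp only [coe_basis₂_θ₂₁]
  exact A.span₁₂.trans (inf_comm _ _)

theorem span_basis₃_θ₃₂ : Submodule.span (ZMod D.r)
    (Set.range fun j => (A.basis₃ (A.θ₃₂ (.inl j)) : D.G)) = OrientedLL.inter L₃ L₂ := by
  simp only [coe_basis₃_θ₃₂]
  exact A.span₂₃.trans (inf_comm _ _)

theorem span_basis₃_θ₃₁ : Submodule.span (ZMod D.r)
    (Set.range fun j => (A.basis₃ (A.θ₃₁ (.inl j)) : D.G)) = OrientedLL.inter L₃ L₁ := by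
  simp only [coe_basis₃_θ₃₁]
  exact A.span₁₃.trans (inf_comm _ _)

theorem free_inter (A : AdaptedBases L₁.L L₂.L L₃.L) :
    Module.Free (ZMod D.r) (OrientedLL.inter L₂ L₁) ∧
    Module.Free (ZMod D.r) (OrientedLL.inter L₃ L₂) ∧
    Module.Free (ZMod D.r) (OrientedLL.inter L₃ L₁) :=
  ⟨Module.Free.of_basis (basisOfSpan A.li₁₂ (A.span₁₂.trans (inf_comm _ _))),
    Module.Free.of_basis (basisOfSpan A.li₂₃ (A.span₂₃.trans (inf_comm _ _))),
    Module.Free.of_basis (basisOfSpan A.li₁₃ (A.span₁₃.trans (inf_comm _ _)))⟩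

/-- In the bases `β, η₂, δ₂` of `L₂` and `η₁, γ, δ₁` of `L₁` modulo the intersection, the matrix of the
pairing is block triangular, with diagonal blocks `-1`, `1` and the transpose of `σ`. -/
theorem det_form₂₁ : (Matrix.of fun i j => D.form (A.basis₂ (A.θ₂₁ (.inr i)))
    (A.basis₁ (A.θ₂₁ (.inr j)))).det = (-1) ^ A.q * A.σ.det := by
  have hβ : ∀ i j, D.form (A.β i) (A.δ₁ j) = 0 := fun i j => by
    rw [eq_sub_of_add_eq (A.δ_eq j).symm, map_sub,
      L₂.admissible.form_eq_zero (A.β_mem i).1 (A.δ₂_mem j),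
      L₃.admissible.form_eq_zero (A.β_mem i).2 (A.δ₃_mem j), sub_zero]
  have hδ : ∀ i j, D.form (A.δ₂ i) (A.δ₁ j) = A.σ j i := fun i j => by
    rw [eq_sub_of_add_eq (A.δ_eq j).symm, map_sub,
      L₂.admissible.form_eq_zero (A.δ₂_mem i) (A.δ₂_mem j), zero_sub, form_antisymm, neg_neg]
    rfl
  have hδγ : ∀ i j, D.form (A.δ₂ i) (A.γ j) = 0 := fun i j => by
    rw [A.δ_eq, map_add, LinearMap.add_apply,
      L₁.admissible.form_eq_zero (A.δ₁_mem i) (A.γ_mem j).1,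
      L₃.admissible.form_eq_zero (A.δ₃_mem i) (A.γ_mem j).2, add_zero]
  simp only [basis₁, basis₂, coe_basisOfSpan]
  rw [det_of_scalar_of_zero₁₂ (x := -1), det_of_scalar_of_zero₂₁ (x := 1), one_pow, one_mul,
    Fintype.card_fin]
  · congr 1
    rw [← Matrix.det_transpose]
    congr 1
    ext i j
    exact hδ j i
  · exact fun i j => A.η₂_γ i j
  · exact fun i j => hδγ i j
  · intro i j
    refine (form_antisymm _ _).trans ?_
    refine (congrArg Neg.neg (A.η₁_β j i)).trans ?_
    rcases eq_or_ne i j with rfl | h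
    · rw [if_pos rfl, if_pos rfl]
    · rw [if_neg h, if_neg h.symm, neg_zero]
  · rintro i (j | j)
    · exact L₃.admissible.form_eq_zero (A.β_mem i).2 (A.γ_mem j).2
    · exact hβ i j

/-- In the bases `η₃, γ, δ₃` of `L₃` and `α, η₂, δ₂` of `L₂` modulo the intersection, the matrix of the
pairing is block triangular, with diagonal blocks `1`, `-1` and `σ`. -/
theorem det_form₃₂ : (Matrix.of fun i j => D.form (A.basis₃ (A.θ₃₂ (.inr i)))
    (A.basis₂ (A.θ₃₂ (.inr j)))).det = (-1) ^ A.t * A.σ.det := by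
  have hγ : ∀ i j, D.form (A.γ i) (A.δ₂ j) = 0 := fun i j => by
    rw [A.δ_eq, map_add, L₁.admissible.form_eq_zero (A.γ_mem i).1 (A.δ₁_mem j),
      L₃.admissible.form_eq_zero (A.γ_mem i).2 (A.δ₃_mem j), add_zero]
  simp only [basis₃, basis₂, coe_basisOfSpan]
  rw [det_of_scalar_of_zero₂₁ (x := 1), det_of_scalar_of_zero₁₂ (x := -1), one_pow, one_mul,
    Fintype.card_fin]
  · rfl
  · intro i j
    refine (form_antisymm _ _).trans ?_
    refine (congrArg Neg.neg (A.η₂_γ j i)).trans ?_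
    rcases eq_or_ne i j with rfl | h
    · rw [if_pos rfl, if_pos rfl]
    · rw [if_neg h, if_neg h.symm, neg_zero]
  · exact fun i j => hγ i j
  · exact fun i j => A.η₃_α i j
  · rintro (i | i) j
    · exact L₁.admissible.form_eq_zero (A.γ_mem i).1 (A.α_mem j).1
    · exact A.form_δ₃_α i j

/-- In the bases `η₃, β, δ₃` of `L₃` and `α, η₁, δ₁` of `L₁` modulo the intersection, the matrix of the
pairing is block triangular, with diagonal blocks `1`, `-1` and `σ`. -/
theorem det_form₃₁ : (Matrix.of fun i j => D.form (A.basis₃ (A.θ₃₁ (.inr i)))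
    (A.basis₁ (A.θ₃₁ (.inr j)))).det = (-1) ^ A.q * A.σ.det := by
  have hβ : ∀ i j, D.form (A.β i) (A.δ₁ j) = 0 := fun i j => by
    rw [eq_sub_of_add_eq (A.δ_eq j).symm, map_sub,
      L₂.admissible.form_eq_zero (A.β_mem i).1 (A.δ₂_mem j),
      L₃.admissible.form_eq_zero (A.β_mem i).2 (A.δ₃_mem j), sub_zero]
  have hδ : ∀ i j, D.form (A.δ₃ i) (A.δ₁ j) = A.σ i j := fun i j => by
    rw [eq_sub_of_add_eq (A.δ_eq j).symm, map_sub,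
      L₃.admissible.form_eq_zero (A.δ₃_mem i) (A.δ₃_mem j), sub_zero]
    rfl
  simp only [basis₃, basis₁, coe_basisOfSpan]
  rw [det_of_scalar_of_zero₂₁ (x := 1), det_of_scalar_of_zero₁₂ (x := -1), one_pow, one_mul,
    Fintype.card_fin]
  · congr 2
    ext i j
    exact hδ i j
  · intro i j
    refine (form_antisymm _ _).trans ?_
    refine (congrArg Neg.neg (A.η₁_β j i)).trans ?_
    rcases eq_or_ne i j with rfl | h
    · rw [if_pos rfl, if_pos rfl]
    · rw [if_neg h, if_neg h.symm, neg_zero]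
  · exact fun i j => hβ i j
  · exact fun i j => A.η₃_α i j
  · rintro (i | i) j
    · exact L₂.admissible.form_eq_zero (A.β_mem i).1 (A.α_mem j).2
    · exact A.form_δ₃_α i j

theorem isUnit_neg_one_pow_mul_det_σ (m : ℕ) : IsUnit ((-1) ^ m * A.σ.det) :=
  (isUnit_one.neg.pow m).mul A.isUnit_det_σ

theorem nonempty_quotientOrientations (A : AdaptedBases L₁.L L₂.L L₃.L) :
    ∃ n₁₂ s, Nonempty (OrientedLL.QuotientOrientations L₂ L₁ n₁₂ s) := by
  obtain ⟨τ⟩ := A.nonempty_enumeration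
  exact ⟨_, _, OrientedLL.nonempty_quotientOrientations A.basis₂ A.basis₁ τ A.θ₂₁
    (fun j => (A.coe_basis₂_θ₂₁ j).trans (A.coe_basis₁_θ₂₁ j).symm) A.span_basis₂_θ₂₁⟩

theorem E₂₁_eq (h2 : D.r ≠ 2) (τ : Fin D.n ≃ A.I) {n₁₂ s : ℕ}
    (f : OrientedLL.QuotientOrientations L₂ L₁ n₁₂ s) :
    n₁₂ = A.k + A.p ∧ f.E = QuadraticGauss.kron D.r
      (QuadraticGauss.halfUnit D.r ^ (A.q + (A.t + A.s)) * (topCoeff A.basis₂ τ L₂.o *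
        topCoeff A.basis₁ τ L₁.o * ((-1) ^ A.q * A.σ.det))) := by
  have h := f.E_eq h2 A.basis₂ A.basis₁ τ A.θ₂₁
    (fun j => (A.coe_basis₂_θ₂₁ j).trans (A.coe_basis₁_θ₂₁ j).symm) A.span_basis₂_θ₂₁
    (A.det_form₂₁ ▸ A.isUnit_neg_one_pow_mul_det_σ _)
  simpa [A.det_form₂₁] using h

theorem E₃₂_eq (h2 : D.r ≠ 2) (τ : Fin D.n ≃ A.I) {n₁₂ s : ℕ}
    (f : OrientedLL.QuotientOrientations L₃ L₂ n₁₂ s) :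
    n₁₂ = A.k + A.q ∧ f.E = QuadraticGauss.kron D.r
      (QuadraticGauss.halfUnit D.r ^ (A.p + (A.t + A.s)) * (topCoeff A.basis₃ τ L₃.o *
        topCoeff A.basis₂ τ L₂.o * ((-1) ^ A.t * A.σ.det))) := by
  have h := f.E_eq h2 A.basis₃ A.basis₂ τ A.θ₃₂
    (fun j => (A.coe_basis₃_θ₃₂ j).trans (A.coe_basis₂_θ₃₂ j).symm) A.span_basis₃_θ₃₂
    (A.det_form₃₂ ▸ A.isUnit_neg_one_pow_mul_det_σ _)
  simpa [A.det_form₃₂] using h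

theorem E₃₁_eq (h2 : D.r ≠ 2) (τ : Fin D.n ≃ A.I) {n₁₂ s : ℕ}
    (f : OrientedLL.QuotientOrientations L₃ L₁ n₁₂ s) :
    n₁₂ = A.k + A.t ∧ f.E = QuadraticGauss.kron D.r
      (QuadraticGauss.halfUnit D.r ^ (A.p + (A.q + A.s)) * (topCoeff A.basis₃ τ L₃.o *
        topCoeff A.basis₁ τ L₁.o * ((-1) ^ A.q * A.σ.det))) := by
  have h := f.E_eq h2 A.basis₃ A.basis₁ τ A.θ₃₁
    (fun j => (A.coe_basis₃_θ₃₁ j).trans (A.coe_basis₁_θ₃₁ j).symm) A.span_basis₃_θ₃₁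
    (A.det_form₃₁ ▸ A.isUnit_neg_one_pow_mul_det_σ _)
  simpa [A.det_form₃₁] using h

end AdaptedBases

end Background

end AbelianGauge

/-! ### The cocycle as a coboundary -/

namespace QuadraticGauss

/-- The phase of the quadratic Gauss sum in one variable: `i` for `r = -1 mod 4`, and `1` for the
other `r ≠ 2`. -/
def unitPhase (r : ℕ) : ℂ := if r % 4 = 3 then Complex.I else 1

theorem unitPhase_ne_zero (r : ℕ) : unitPhase r ≠ 0 := by
  rw [unitPhase]
  split_ifs
  · exact Complex.I_ne_zero
  · exact one_ne_zero

theorem unitPhase_pow (r m : ℕ) :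
    unitPhase r ^ m = if r % 4 = 3 then Complex.I ^ m else 1 := by
  rw [unitPhase, ite_pow, one_pow]

/-- The phase `i` occurs exactly when `-1` has symbol `-1`; signs of determinants are absorbed by it. -/
theorem unitPhase_sq {r : ℕ} (hr : IsPrimePow r) (h2 : r ≠ 2) :
    unitPhase r ^ 2 = kron r (-1) := by
  rw [kron_neg_one hr h2, unitPhase_pow]
  split_ifs <;> simp

theorem kron_pow {r : ℕ} (hr : IsPrimePow r) (h2 : r ≠ 2) {x : ZMod r} (hx : IsUnit x) (m : ℕ) :
    kron r (x ^ m) = kron r x ^ m := by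
  induction m with
  | zero =>
    have h := kron_mul hr h2 (isUnit_one (M := ZMod r)) isUnit_one
    rw [kron_mul_self hr h2 isUnit_one, mul_one] at h
    rw [pow_zero, pow_zero, h]
  | succ m ih => rw [pow_succ, kron_mul hr h2 (hx.pow m) hx, ih, pow_succ]

end QuadraticGauss

namespace AbelianGauge

namespace Background

variable {D : Background.{u, v}}

namespace OrientedLL

variable {W : D.WuRefinement} {ε : D.ExtraStructure}

theorem modulus_pos (L₂ L₁ : OrientedLL W ε) : 0 < modulus L₂ L₁ :=
  mul_pos (Real.sqrt_pos.2 (Nat.cast_pos.2 Nat.card_pos))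
    (Real.sqrt_pos.2 (Nat.cast_pos.2 Nat.card_pos))

end OrientedLL

namespace AdaptedBases

open OrientedLL QuadraticGauss

variable {W : D.WuRefinement} {ε : D.ExtraStructure} {L₁ L₂ L₃ : OrientedLL W ε}
  (A : AdaptedBases L₁.L L₂.L L₃.L)

theorem sqrt_natCast_pow (m : ℕ) : √((D.r ^ m : ℕ) : ℝ) = √D.r ^ m := by
  refine (Real.sqrt_eq_iff_eq_sq (by positivity) (by positivity)).2 ?_
  rw [← pow_mul, mul_comm, pow_mul, Real.sq_sqrt (Nat.cast_nonneg _), Nat.cast_pow]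

theorem card_L (A : AdaptedBases L₁.L L₂.L L₃.L) :
    Nat.card L₁.L = D.r ^ D.n ∧ Nat.card L₂.L = D.r ^ D.n ∧
    Nat.card L₃.L = D.r ^ D.n := by
  have hI : Fintype.card A.I = D.n := by
    obtain ⟨τ⟩ := A.nonempty_enumeration
    rw [← Fintype.card_congr τ, Fintype.card_fin]
  exact ⟨hI ▸ card_span_range A.li₁ A.span₁, hI ▸ card_span_range A.li₂ A.span₂,
    hI ▸ card_span_range A.li₃ A.span₃⟩

theorem modulus₂₁ : modulus L₂ L₁ = √D.r ^ (A.k + A.p) * √D.r ^ D.n := by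
  have h := card_span_range A.li₁₂ (A.span₁₂.trans (inf_comm _ _))
  rw [modulus, h, A.card_L.2.1, sqrt_natCast_pow, sqrt_natCast_pow, Fintype.card_sum,
    Fintype.card_fin, Fintype.card_fin]

theorem modulus₃₂ : modulus L₃ L₂ = √D.r ^ (A.k + A.q) * √D.r ^ D.n := by
  have h := card_span_range A.li₂₃ (A.span₂₃.trans (inf_comm _ _))
  rw [modulus, h, A.card_L.2.2, sqrt_natCast_pow, sqrt_natCast_pow, Fintype.card_sum,
    Fintype.card_fin, Fintype.card_fin]

theorem modulus₃₁ : modulus L₃ L₁ = √D.r ^ (A.k + A.t) * √D.r ^ D.n := by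
  have h := card_span_range A.li₁₃ (A.span₁₃.trans (inf_comm _ _))
  rw [modulus, h, A.card_L.2.2, sqrt_natCast_pow, sqrt_natCast_pow, Fintype.card_sum,
    Fintype.card_fin, Fintype.card_fin]

/-- For every prime power `r`, including `2`, the modulus of `a` is the coboundary of `modulus`. -/
theorem norm_a (A : AdaptedBases L₁.L L₂.L L₃.L) :
    ‖a L₃ L₂ L₁‖ * modulus L₃ L₁ = modulus L₃ L₂ * modulus L₂ L₁ := by
  obtain ⟨T, hT, ha⟩ := A.a_eq
  rw [ha, norm_mul, norm_formSum (ZMod.isPrimitive_stdAddChar D.r) T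
    (by rw [hT]; exact A.isUnit_det_σ), norm_pow, Complex.norm_natCast, ZMod.card,
    Fintype.card_fin, A.modulus₂₁, A.modulus₃₂, A.modulus₃₁, A.n_eq]
  have h : (D.r : ℝ) = √D.r ^ 2 := (Real.sq_sqrt (Nat.cast_nonneg _)).symm
  nth_rw 1 [h]
  ring

/-- The value of `a` for `r ≠ 2`. -/
theorem a_eq_kron (A : AdaptedBases L₁.L L₂.L L₃.L) (h2 : D.r ≠ 2) :
    a L₃ L₂ L₁ = (√D.r : ℂ) ^ (2 * (A.k + A.p + A.q) + A.s) *
    (unitPhase D.r ^ A.s * ((kron D.r (halfUnit D.r) : ℂ) ^ A.s * kron D.r A.σ.det)) := by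
  obtain ⟨T, hT, ha⟩ := A.a_eq
  have h : (D.r : ℂ) = (√D.r : ℂ) ^ 2 := by
    rw [← Complex.ofReal_pow, Real.sq_sqrt (Nat.cast_nonneg _), Complex.ofReal_natCast]
  rw [ha, formSum_eq D.isPrimePow_r h2 T (by rw [hT]; exact A.isUnit_det_σ), hT,
    Matrix.det_smul, Fintype.card_fin, kron_mul D.isPrimePow_r h2 (isUnit_halfUnit.pow _)
    A.isUnit_det_σ, kron_pow D.isPrimePow_r h2 isUnit_halfUnit, ← unitPhase]
  push_cast
  nth_rw 1 [h]
  ring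

end AdaptedBases

namespace OrientedLL

open QuadraticGauss

variable {W : D.WuRefinement} {ε : D.ExtraStructure}

/-- For a pair of subgroups, adapted bases of the triple `(L₁, L₂, L₁)` are used. -/
theorem nonempty_adaptedBases_pair {L₂ L₁ : OrientedLL W ε}
    (hf : Module.Free (ZMod D.r) (inter L₂ L₁)) : Nonempty (AdaptedBases L₁.L L₂.L L₁.L) := by
  have h12 : Module.Free (ZMod D.r) ↥(L₁.L ⊓ L₂.L) := inf_comm L₂.L L₁.L ▸ hf
  refine nonempty_adaptedBases L₁.admissible L₂.admissible L₁.admissible h12 hf ?_ ?_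
  · rw [inf_idem]
    exact L₁.admissible.free
  · rwa [inf_assoc, inf_comm L₂.L, ← inf_assoc, inf_idem]

/-- The intersections are free for `r` prime, as vector spaces, and for `r` even, by admissibility; for
the other `r` this is assumed. -/
theorem nonempty_adaptedBases {L₃ L₂ L₁ : OrientedLL W ε}
    (h : Odd D.r ∧ ¬ D.r.Prime → Module.Free (ZMod D.r) (inter L₂ L₁) ∧
      Module.Free (ZMod D.r) (inter L₃ L₂) ∧ Module.Free (ZMod D.r) (inter L₃ L₁) ∧
      Module.Free (ZMod D.r) ↥(L₁.L ⊓ L₂.L ⊓ L₃.L)) :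
    Nonempty (AdaptedBases L₁.L L₂.L L₃.L) := by
  have key : Module.Free (ZMod D.r) (inter L₂ L₁) ∧
      Module.Free (ZMod D.r) (inter L₃ L₂) ∧ Module.Free (ZMod D.r) (inter L₃ L₁) ∧
      Module.Free (ZMod D.r) ↥(L₁.L ⊓ L₂.L ⊓ L₃.L) := by
    by_cases hp : D.r.Prime
    · have := Fact.mk hp
      exact ⟨Module.Free.of_divisionRing _ _, Module.Free.of_divisionRing _ _,
        Module.Free.of_divisionRing _ _, Module.Free.of_divisionRing _ _⟩
    rcases Nat.even_or_odd D.r with he | ho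
    · have h2 : ∀ L L' : OrientedLL W ε, Module.Free (ZMod D.r) (inter L L') := fun L L' =>
        free_of_forall_mem_iff (W := W) (ε := ε) he ![L.L, L'.L]
          (by intro i; fin_cases i; exacts [L.admissible, L'.admissible]) _
          (fun x => by rw [Fin.forall_fin_two]; rfl)
      refine ⟨h2 _ _, h2 _ _, h2 _ _, free_of_forall_mem_iff (W := W) (ε := ε) he
        ![L₁.L, L₂.L, L₃.L] ?_ _ fun x => ?_⟩
      · intro i
        fin_cases i
        exacts [L₁.admissible, L₂.admissible, L₃.admissible]
      · simp [Fin.forall_fin_succ, and_assoc]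
    · exact h ⟨ho, hp⟩
  obtain ⟨f21, f32, f31, f⟩ := key
  exact Background.nonempty_adaptedBases L₁.admissible L₂.admissible L₃.admissible
    (inf_comm L₂.L L₁.L ▸ f21) (inf_comm L₃.L L₂.L ▸ f32) (inf_comm L₃.L L₁.L ▸ f31) f

theorem exists_quotientOrientations {L₂ L₁ : OrientedLL W ε}
    (hf : Module.Free (ZMod D.r) (inter L₂ L₁)) :
    ∃ n₁₂ s, Nonempty (QuotientOrientations L₂ L₁ n₁₂ s) :=
  (nonempty_adaptedBases_pair hf).some.nonempty_quotientOrientations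

/-- The value `|L₁₂|^{1/2} |L|^{1/2} i^{n - n₁₂} E` (with `i` replaced by `1` unless
`r = -1 mod 4`) attached to a presentation of the quotient orientations. -/
def QuotientOrientations.value {L₂ L₁ : OrientedLL W ε} {n₁₂ s : ℕ}
    (f : QuotientOrientations L₂ L₁ n₁₂ s) : ℂ :=
  modulus L₂ L₁ * unitPhase D.r ^ (D.n - n₁₂) * f.E

/-- The value does not depend on the presentation: a common pair of bases determines it. -/
theorem QuotientOrientations.value_eq_value (h2 : D.r ≠ 2) {L₂ L₁ : OrientedLL W ε}
    {n₁₂ s n₁₂' s' : ℕ} (f : QuotientOrientations L₂ L₁ n₁₂ s)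
    (f' : QuotientOrientations L₂ L₁ n₁₂' s') : f.value = f'.value := by
  obtain ⟨A⟩ := nonempty_adaptedBases_pair (Module.Free.of_basis f.e)
  obtain ⟨τ⟩ := A.nonempty_enumeration
  obtain ⟨h, hE⟩ := A.E₂₁_eq h2 τ f
  obtain ⟨h', hE'⟩ := A.E₂₁_eq h2 τ f'
  rw [value, value, hE, hE', h, h']

theorem QuotientOrientations.value_ne_zero (h2 : D.r ≠ 2) {L₂ L₁ : OrientedLL W ε}
    {n₁₂ s : ℕ} (f : QuotientOrientations L₂ L₁ n₁₂ s) : f.value ≠ 0 := by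
  obtain ⟨A⟩ := nonempty_adaptedBases_pair (Module.Free.of_basis f.e)
  obtain ⟨τ⟩ := A.nonempty_enumeration
  refine mul_ne_zero (mul_ne_zero ?_ (pow_ne_zero _ (unitPhase_ne_zero _))) ?_
  · exact Complex.ofReal_ne_zero.2 (modulus_pos _ _).ne'
  · rw [(A.E₂₁_eq h2 τ f).2]
    refine Int.cast_ne_zero.2 (left_ne_zero_of_mul_eq_one (kron_mul_self D.isPrimePow_r h2 ?_))
    exact (isUnit_halfUnit.pow _).mul (((isUnit_topCoeff _ τ L₂.o_generates).mul
      (isUnit_topCoeff _ τ L₁.o_generates)).mul (A.isUnit_neg_one_pow_mul_det_σ _))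

/-- For `r ≠ 2`, adapted bases exhibit `a` as the coboundary of the values of presentations. -/
theorem a_mul_value (h2 : D.r ≠ 2) {L₃ L₂ L₁ : OrientedLL W ε}
    (A : AdaptedBases L₁.L L₂.L L₃.L) {n₁₂ s₁₂ n₂₃ s₂₃ n₁₃ s₁₃ : ℕ}
    (f₂₁ : QuotientOrientations L₂ L₁ n₁₂ s₁₂) (f₃₂ : QuotientOrientations L₃ L₂ n₂₃ s₂₃)
    (f₃₁ : QuotientOrientations L₃ L₁ n₁₃ s₁₃) :
    a L₃ L₂ L₁ * f₃₁.value = f₃₂.value * f₂₁.value := by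
  have hr := D.isPrimePow_r
  obtain ⟨τ⟩ := A.nonempty_enumeration
  obtain ⟨h₂₁, E₂₁⟩ := A.E₂₁_eq h2 τ f₂₁
  obtain ⟨h₃₂, E₃₂⟩ := A.E₃₂_eq h2 τ f₃₂
  obtain ⟨h₃₁, E₃₁⟩ := A.E₃₁_eq h2 τ f₃₁
  have u₁ := isUnit_topCoeff A.basis₁ τ L₁.o_generates
  have u₂ := isUnit_topCoeff A.basis₂ τ L₂.o_generates
  have u₃ := isUnit_topCoeff A.basis₃ τ L₃.o_generates
  have uσ := A.isUnit_det_σ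
  have un : IsUnit (-1 : ZMod D.r) := isUnit_one.neg
  have uh := isUnit_halfUnit (r := D.r)
  have hexp : ∀ {c d : ZMod D.r} (m m' : ℕ), IsUnit c → IsUnit d →
      kron D.r (halfUnit D.r ^ m * (c * d * ((-1) ^ m' * A.σ.det))) =
      kron D.r (halfUnit D.r) ^ m * (kron D.r c * kron D.r d *
        (kron D.r (-1) ^ m' * kron D.r A.σ.det)) := fun m m' hc hd => by
    rw [kron_mul hr h2 (uh.pow m) ((hc.mul hd).mul ((un.pow m').mul uσ)),
      kron_mul hr h2 (hc.mul hd) ((un.pow m').mul uσ), kron_mul hr h2 hc hd,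
      kron_mul hr h2 (un.pow m') uσ, kron_pow hr h2 uh, kron_pow hr h2 un]
  rw [hexp _ _ u₂ u₁] at E₂₁
  rw [hexp _ _ u₃ u₂] at E₃₂
  rw [hexp _ _ u₃ u₁] at E₃₁
  have n₁ : D.n - n₁₂ = A.q + (A.t + A.s) := by rw [h₂₁, A.n_eq]; omega
  have n₂ : D.n - n₂₃ = A.p + (A.t + A.s) := by rw [h₃₂, A.n_eq]; omega
  have n₃ : D.n - n₁₃ = A.p + (A.q + A.s) := by rw [h₃₁, A.n_eq]; omega
  rw [A.a_eq_kron h2, QuotientOrientations.value, QuotientOrientations.value,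
    QuotientOrientations.value, n₁, n₂, n₃, E₂₁, E₃₂, E₃₁, A.modulus₂₁, A.modulus₃₂, A.modulus₃₁]
  have hι := unitPhase_sq hr h2
  have hsq : ∀ {x : ZMod D.r}, IsUnit x → (kron D.r x : ℂ) * kron D.r x = 1 := fun hx => by
    exact_mod_cast kron_mul_self hr h2 hx
  have s₂ := hsq u₂
  have sσ := hsq uσ
  have sn := hsq un
  have sh := hsq uh
  push_cast
  generalize (kron D.r (topCoeff A.basis₁ τ L₁.o) : ℂ) = C₁
  generalize (kron D.r (topCoeff A.basis₂ τ L₂.o) : ℂ) = C₂ at s₂ ⊢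
  generalize (kron D.r (topCoeff A.basis₃ τ L₃.o) : ℂ) = C₃
  generalize (kron D.r A.σ.det : ℂ) = S at sσ ⊢
  generalize (kron D.r (-1) : ℂ) = N at sn hι ⊢
  generalize (kron D.r (halfUnit D.r) : ℂ) = H at sh ⊢
  generalize unitPhase D.r = ι at hι ⊢
  generalize (√D.r : ℂ) = X
  rw [A.n_eq]
  have hH : (H * H) ^ A.t = 1 := by rw [sh, one_pow]
  -- the exponents of the phase on the two sides differ by `2t`, and its square is the symbol of `-1`,
  -- which `det_form₃₂` provides `t` times
  have hN : (ι ^ 2) ^ A.t * N ^ A.t = 1 := by rw [hι, ← mul_pow, sn, one_pow]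
  generalize A.k = k
  generalize A.p = p
  generalize A.q = q
  generalize A.t = t at *
  generalize A.s = s
  have e : X ^ (k + q) * X ^ (k + (p + (q + (t + s)))) * ι ^ (p + (t + s)) *
      (H ^ (p + (t + s)) * (C₃ * C₂ * (N ^ t * S))) *
      (X ^ (k + p) * X ^ (k + (p + (q + (t + s)))) * ι ^ (q + (t + s)) *
        (H ^ (q + (t + s)) * (C₂ * C₁ * (N ^ q * S)))) =
      X ^ (2 * (k + p + q) + s) * (ι ^ s * (H ^ s * S)) *
      (X ^ (k + t) * X ^ (k + (p + (q + (t + s)))) * ι ^ (p + (q + s)) *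
        (H ^ (p + (q + s)) * (C₃ * C₁ * (N ^ q * S)))) *
      ((C₂ * C₂) * (H * H) ^ t * ((ι ^ 2) ^ t * N ^ t)) := by ring
  rw [e, s₂, hH, hN, one_mul, one_mul, mul_one]

open Classical in
/-- The function `b` for `r ≠ 2`: the value of any presentation of the quotient orientations, and
`1` if the intersection is not free. -/
def valueOrOne (L₂ L₁ : OrientedLL W ε) : ℂ :=
  if h : ∃ z : ℂ, ∃ n₁₂ s, ∃ f : QuotientOrientations L₂ L₁ n₁₂ s, f.value = z then h.choose else 1

theorem valueOrOne_eq (h2 : D.r ≠ 2) {L₂ L₁ : OrientedLL W ε} {n₁₂ s : ℕ}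
    (f : QuotientOrientations L₂ L₁ n₁₂ s) : valueOrOne L₂ L₁ = f.value := by
  have h : ∃ z : ℂ, ∃ n₁₂ s, ∃ f : QuotientOrientations L₂ L₁ n₁₂ s, f.value = z :=
    ⟨_, _, _, f, rfl⟩
  rw [valueOrOne, dif_pos h]
  obtain ⟨n, s, f', hf'⟩ := h.choose_spec
  rw [← hf', f'.value_eq_value h2 f]

theorem valueOrOne_ne_zero (h2 : D.r ≠ 2) (L₂ L₁ : OrientedLL W ε) : valueOrOne L₂ L₁ ≠ 0 := by
  by_cases h : ∃ z : ℂ, ∃ n₁₂ s, ∃ f : QuotientOrientations L₂ L₁ n₁₂ s, f.value = z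
  · obtain ⟨z, n, s, f, hf⟩ := h
    rw [valueOrOne_eq h2 f]
    exact f.value_ne_zero h2
  · rw [valueOrOne, dif_neg h]
    exact one_ne_zero

/-- For `r = 2` the numbers `a` are real, since `q` takes the values `1` and `-1`. -/
theorem a_real (h2 : D.r = 2) (L₃ L₂ L₁ : OrientedLL W ε) : ((a L₃ L₂ L₁).re : ℂ) = a L₃ L₂ L₁ := by
  have := Fintype.ofFinite (S L₃ L₂ L₁)
  rw [← Complex.conj_eq_iff_re, a, gaussSum, finsum_eq_sum_of_fintype, map_sum]
  refine Finset.sum_congr rfl fun x _ => ?_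
  have hq := q_pow_r x
  rw [h2, sq_eq_one_iff] at hq
  rcases hq with hq | hq <;> rw [hq] <;> simp

/-- For `r = 2`, the sign of `a(L₂, L₁, L₀)`. -/
def signWith (L₀ L₂ L₁ : OrientedLL W ε) : ℂ := a L₂ L₁ L₀ / ‖a L₂ L₁ L₀‖

theorem a_ne_zero {L₃ L₂ L₁ : OrientedLL W ε} (A : AdaptedBases L₁.L L₂.L L₃.L) :
    a L₃ L₂ L₁ ≠ 0 := by
  intro h
  have h1 := A.norm_a
  rw [h, norm_zero, zero_mul] at h1
  exact (mul_pos (modulus_pos L₃ L₂) (modulus_pos L₂ L₁)).ne h1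

theorem signWith_eq (h2 : D.r = 2) {L₀ L₂ L₁ : OrientedLL W ε}
    (A : AdaptedBases L₀.L L₁.L L₂.L) : signWith L₀ L₂ L₁ = 1 ∨ signWith L₀ L₂ L₁ = -1 := by
  have h0 := a_ne_zero A
  rw [signWith, ← a_real h2] at *
  generalize (a L₂ L₁ L₀).re = x at *
  have hx : x ≠ 0 := Complex.ofReal_ne_zero.1 h0
  rw [Complex.norm_real, Real.norm_eq_abs]
  rcases abs_choice x with h | h <;> rw [h]
  · exact .inl (div_self h0)
  · right
    rw [Complex.ofReal_neg, div_neg, div_self h0]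

/-- For a fixed `L₀`, the cocycle relation `a_cocycle` expresses the sign of `a(L₃, L₂, L₁)` by the signs
with `L₀`. -/
theorem signWith_cocycle {L₀ L₃ L₂ L₁ : OrientedLL W ε} (A : AdaptedBases L₁.L L₂.L L₃.L)
    (A₂₁ : AdaptedBases L₀.L L₁.L L₂.L)
    (A₃₂ : AdaptedBases L₀.L L₂.L L₃.L) (A₃₁ : AdaptedBases L₀.L L₁.L L₃.L) :
    a L₃ L₂ L₁ = (signWith L₀ L₃ L₂ * modulus L₃ L₂) * (signWith L₀ L₂ L₁ * modulus L₂ L₁) *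
      (signWith L₀ L₃ L₁ * modulus L₃ L₁)⁻¹ := by
  have h := a_cocycle L₃ L₂ L₁ L₀
  have hn := congrArg (fun z : ℂ => (‖z‖ : ℂ)) h
  simp only [norm_mul, Complex.ofReal_mul] at hn
  have hm : (‖a L₃ L₂ L₁‖ : ℂ) * modulus L₃ L₁ = modulus L₃ L₂ * modulus L₂ L₁ := by
    rw [← Complex.ofReal_mul, A.norm_a, Complex.ofReal_mul]
  have m₃₁ : (modulus L₃ L₁ : ℂ) ≠ 0 := Complex.ofReal_ne_zero.2 (modulus_pos _ _).ne'
  have n0 := a_ne_zero A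
  have n1 := a_ne_zero A₂₁
  have n2 := a_ne_zero A₃₂
  have n3 := a_ne_zero A₃₁
  have nn : ∀ {z : ℂ}, z ≠ 0 → (‖z‖ : ℂ) ≠ 0 := fun hz =>
    Complex.ofReal_ne_zero.2 (norm_ne_zero_iff.2 hz)
  have nn0 := nn n0
  have nn1 := nn n1
  have nn2 := nn n2
  have nn3 := nn n3
  simp only [signWith]
  rw [eq_mul_inv_iff_mul_eq₀ (mul_ne_zero (div_ne_zero n3 nn3) m₃₁)]
  have e1 : a L₃ L₁ L₀ / ‖a L₃ L₁ L₀‖ * a L₃ L₂ L₁ =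
      a L₃ L₂ L₀ / ‖a L₃ L₂ L₀‖ * (a L₂ L₁ L₀ / ‖a L₂ L₁ L₀‖) * ‖a L₃ L₂ L₁‖ := by
    field_simp
    linear_combination (‖a L₂ L₁ L₀‖ * ‖a L₃ L₂ L₀‖ : ℂ) * h - a L₃ L₂ L₀ * a L₂ L₁ L₀ * hn
  calc _ = a L₃ L₁ L₀ / ‖a L₃ L₁ L₀‖ * a L₃ L₂ L₁ * modulus L₃ L₁ := by ring
    _ = _ := by rw [e1, mul_assoc _ _ (modulus L₃ L₁ : ℂ), hm]; ring

end OrientedLL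

end Background

end AbelianGauge

end

theorem mainTheorem10 (D : Background.{u, v}) (W : D.WuRefinement) (ε : D.ExtraStructure) :
    (∀ L₂ L₁ : OrientedLL W ε,
      (∀ w ∈ L₁.I, L₂.F w ∈ L₂.I) ∧
      ∀ (k : D.G) (w : D.G → ℂ), L₂.F (ρt W ε k w) = ρt W ε k (L₂.F w)) ∧
    ∃ b : OrientedLL W ε → OrientedLL W ε → ℂ,
      (∀ L₂ L₁ : OrientedLL W ε, b L₂ L₁ ≠ 0) ∧
      (∀ L₂ L₁ : OrientedLL W ε, Module.Free (ZMod D.r) (OrientedLL.inter L₂ L₁) →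
        ∃ n₁₂ s, Nonempty (OrientedLL.QuotientOrientations L₂ L₁ n₁₂ s)) ∧
      (D.r ≠ 2 → ∀ (L₂ L₁ : OrientedLL W ε) (n₁₂ s : ℕ)
        (f : OrientedLL.QuotientOrientations L₂ L₁ n₁₂ s),
        b L₂ L₁ = OrientedLL.modulus L₂ L₁ *
          (if D.r % 4 = 3 then Complex.I ^ (D.n - n₁₂) else 1) * f.E) ∧
      (D.r = 2 → ∀ L₂ L₁ : OrientedLL W ε,
        b L₂ L₁ = OrientedLL.modulus L₂ L₁ ∨ b L₂ L₁ = -OrientedLL.modulus L₂ L₁) ∧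
      ∀ L₃ L₂ L₁ : OrientedLL W ε,
        ∃ a : ℂ,
          (∀ c : ℂ, (∀ w ∈ L₁.I, L₃.F (L₂.F w) = c • L₃.F w) ↔ c = a) ∧
          (∃ (q : OrientedLL.S L₃ L₂ L₁ → ℂ)
            (P : OrientedLL.S L₃ L₂ L₁ → OrientedLL.S L₃ L₂ L₁ → ℂ),
            (∀ k : OrientedLL.S L₃ L₂ L₁, ∀ k₁ ∈ L₁.L, ∀ k₃ ∈ L₃.L, (k : D.G) = k₁ + k₃ →
              q k = φ W ε k₃ k₁ ∧ ∀ k' : OrientedLL.S L₃ L₂ L₁, P k k' = D.B k₃ k') ∧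
            IsQuadraticRefinement q P ∧ (∀ k k', P k k' = P k' k) ∧ IsTame q P ∧
            a = gaussSum q) ∧
          ((Odd D.r ∧ ¬ D.r.Prime →
              Module.Free (ZMod D.r) (OrientedLL.inter L₂ L₁) ∧
              Module.Free (ZMod D.r) (OrientedLL.inter L₃ L₂) ∧
              Module.Free (ZMod D.r) (OrientedLL.inter L₃ L₁) ∧
              Module.Free (ZMod D.r) ↥(L₁.L ⊓ L₂.L ⊓ L₃.L)) →
            a = b L₃ L₂ * b L₂ L₁ * (b L₃ L₁)⁻¹) := by
  refine ⟨fun L₂ L₁ => ⟨fun w _ => L₂.F_mem_I w, fun k w => L₂.F_ρt k w⟩, ?_⟩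
  have ha : ∀ L₃ L₂ L₁ : OrientedLL W ε,
      ∃ (q : OrientedLL.S L₃ L₂ L₁ → ℂ) (P : OrientedLL.S L₃ L₂ L₁ → OrientedLL.S L₃ L₂ L₁ → ℂ),
        (∀ k : OrientedLL.S L₃ L₂ L₁, ∀ k₁ ∈ L₁.L, ∀ k₃ ∈ L₃.L, (k : D.G) = k₁ + k₃ →
          q k = φ W ε k₃ k₁ ∧ ∀ k' : OrientedLL.S L₃ L₂ L₁, P k k' = D.B k₃ k') ∧
        IsQuadraticRefinement q P ∧ (∀ k k', P k k' = P k' k) ∧ IsTame q P ∧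
        OrientedLL.a L₃ L₂ L₁ = AbelianGauge.gaussSum q := fun L₃ L₂ L₁ =>
    ⟨OrientedLL.q L₃ L₂ L₁, OrientedLL.P L₃ L₂ L₁, fun k k₁ h₁ k₃ h₃ h =>
      ⟨OrientedLL.q_eq h₁ h₃ h, fun k' => OrientedLL.P_eq k' h₁ h₃ h⟩,
      OrientedLL.isQuadraticRefinement_q, OrientedLL.P_comm, OrientedLL.isTame_q, rfl⟩
  by_cases h2 : D.r = 2
  · have hp : ¬ (Odd D.r ∧ ¬ D.r.Prime) := fun h => h.2 (h2 ▸ Nat.prime_two)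
    have hA : ∀ L₃ L₂ L₁ : OrientedLL W ε, Nonempty (AdaptedBases L₁.L L₂.L L₃.L) :=
      fun L₃ L₂ L₁ => OrientedLL.nonempty_adaptedBases fun h => absurd h hp
    -- The auxiliary subgroup `L₀` does not depend on the argument, by proof irrelevance.
    let L₀ : OrientedLL W ε → OrientedLL W ε := fun L => Classical.choice ⟨L⟩
    refine ⟨fun L₂ L₁ => OrientedLL.signWith (L₀ L₁) L₂ L₁ * OrientedLL.modulus L₂ L₁,
      fun L₂ L₁ => ?_, fun L₂ L₁ => OrientedLL.exists_quotientOrientations,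
      fun h => absurd h2 h, fun _ L₂ L₁ => ?_, fun L₃ L₂ L₁ =>
      ⟨OrientedLL.a L₃ L₂ L₁, OrientedLL.forall_F_F_eq_iff L₃ L₂ L₁, ha L₃ L₂ L₁, fun _ =>
        OrientedLL.signWith_cocycle (hA _ _ _).some (hA _ _ _).some (hA _ _ _).some
          (hA _ _ _).some⟩⟩
    · refine mul_ne_zero ?_ (Complex.ofReal_ne_zero.2 (OrientedLL.modulus_pos L₂ L₁).ne')
      rcases OrientedLL.signWith_eq h2 (hA L₂ L₁ (L₀ L₁)).some with h | h <;> rw [h]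
      exacts [one_ne_zero, neg_ne_zero.2 one_ne_zero]
    · rcases OrientedLL.signWith_eq h2 (hA L₂ L₁ (L₀ L₁)).some with h | h
      · exact .inl ((congrArg (· * _) h).trans (one_mul _))
      · exact .inr ((congrArg (· * _) h).trans (neg_one_mul _))
  · refine ⟨OrientedLL.valueOrOne, OrientedLL.valueOrOne_ne_zero h2,
      fun L₂ L₁ => OrientedLL.exists_quotientOrientations, fun _ L₂ L₁ n₁₂ s f => ?_,
      fun h => absurd h h2, fun L₃ L₂ L₁ =>
      ⟨OrientedLL.a L₃ L₂ L₁, OrientedLL.forall_F_F_eq_iff L₃ L₂ L₁, ha L₃ L₂ L₁, fun hf => ?_⟩⟩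
    · rw [OrientedLL.valueOrOne_eq h2 f, OrientedLL.QuotientOrientations.value,
        QuadraticGauss.unitPhase_pow]
    · obtain ⟨A⟩ := OrientedLL.nonempty_adaptedBases hf
      obtain ⟨f₂₁, f₃₂, f₃₁⟩ := A.free_inter
      obtain ⟨_, _, ⟨g₂₁⟩⟩ := OrientedLL.exists_quotientOrientations f₂₁
      obtain ⟨_, _, ⟨g₃₂⟩⟩ := OrientedLL.exists_quotientOrientations f₃₂
      obtain ⟨_, _, ⟨g₃₁⟩⟩ := OrientedLL.exists_quotientOrientations f₃₁
      rw [eq_mul_inv_iff_mul_eq₀ (OrientedLL.valueOrOne_ne_zero h2 L₃ L₁),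
        OrientedLL.valueOrOne_eq h2 g₂₁, OrientedLL.valueOrOne_eq h2 g₃₂,
        OrientedLL.valueOrOne_eq h2 g₃₁, OrientedLL.a_mul_value h2 A g₂₁ g₃₂ g₃₁]
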